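/- **Setting.** Let $\mathbb F_q$ be a finite field of characteristic $p$, $A=\mathbb F_q[\theta]$, $k=\mathbb F_q(\theta)$, $A_+$ the set of monic polynomials and $A_{+,i}$ the set of monic polynomials of degree $i$. Let $v\in A_+$ be irreducible of degree $d$, $k_v$ the completion of $k$ at $v$, $A_v$ its ring of integers, and $\mathbb C_v$ the completion of an algebraic closure of $k_v$; all fields below lie in $\mathbb C_v$. For $x\in k$ let $\langle x\rangle_\infty$ be the unique element of $k$ with $|\langle x\rangle_\infty|_\infty<1$ and $x-\langle x\rangle_\infty\in A$, where $|f/g|_\infty=q^{\deg f-\deg g}$ and $|0|_\infty=0$. For $y\in\mathbb Q$ let $\langle y\rangle\in[0,1)$ be its fractional part. *Gamma functions.* For $x\in A_v$ put $x^\flat=x$ if $x\in A_v^\times$ and $x^\flat=1$ otherwise. For $x\in A_v$ and $y=\sum_{i\ge 0}y_iq^i\in\mathbb Z_p$ with $0\le y_i<q$ put $$\Pi_v^{\rm geo}(x)=\prod_{i\ge0}\ \prod_{a\in A_{+,i}}\frac{a^\flat}{(x+a)^\flat},\qquad \Pi_v^{\rm geo}(x,y)=\prod_{i\ge0}\Big(\prod_{a\in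 A_{+,i}}\frac{a^\flat}{(x+a)^\flat}\Big)^{y_i},\qquad \Pi_v^{\rm ari}(y)=\prod_{i\ge0}\Big(-\prod_{a\in A_{+,i}}a^\flat\Big)^{y_i},$$ $$\Gamma_v^{\rm geo}(x)=\frac{\Pi_v^{\rm geo}(x)}{x^\flat},\qquad \Gamma_v^{\rm geo}(x,y)=\frac{\Pi_v^{\rm geo}(x,y-1)}{x^\flat},\qquad \Gamma_v^{\rm ari}(y)=\Pi_v^{\rm ari}(y-1),\qquad \Gamma_v(x,y)=\frac{\Gamma_v^{\rm geo}(x,y)}{\Gamma_v^{\rm ari}(y)}.$$ *Gauss sums.* Let $C$ be the Carlitz module, $C_\theta(z)=\theta z+z^q$. Let $\mathfrak n\in A_+$ be prime to $v$, let $\ell$ be the order of $v$ modulo $\mathfrak n$, $\Lambda_{\mathfrak n}$ the set of roots of $C_{\mathfrak n}(z)$, $K_{\mathfrak n}=k(\Lambda_{\mathfrak n})$, $\mathcal O_{\mathfrak n}$ the integral closure of $A$ in $K_{\mathfrak n}$, $\mathfrak P$ the prime of $\mathcal O_{\mathfrak n}$ above $v$ determined by $K_{\mathfrak n}\subset\mathbb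 C_v$, $\mathbb F_{\mathfrak P}=\mathcal O_{\mathfrak n}/\mathfrak P$, and $K_{\mathfrak n,d\ell}=K_{\mathfrak n}\,\mathbb F_{q^{d\ell}}$. Let $\omega$ be the inverse of the reduction isomorphism $\Lambda_{\mathfrak n}\to C(\mathbb F_{\mathfrak P})[\mathfrak n]$, let $\psi:\mathbb F_{\mathfrak P}\to\mathbb F_{q^{d\ell}}\subset\mathbb C_v$ be the Teichmüller embedding, and let $\tau_q\in{\rm Gal}(K_{\mathfrak n,d\ell}/k)$ be the identity on $K_{\mathfrak n}$ and the $q$-th power map on $\mathbb F_{q^{d\ell}}$. For $x\in\mathfrak n^{-1}A$ and $y\in(q^{d\ell}-1)^{-1}\mathbb Z$ with $\langle y\rangle=\sum_{s=0}^{d\ell-1}\frac{y_sq^s}{q^{d\ell}-1}$, $0\le y_s<q$, put $$\mathcal G_x^{\rm geo}=1+\sum_{z\in\mathbb F_{\mathfrak P}^\times}\omega\big(C_{x(v^\ell-1)}(z^{-1})\big)\psi(z),\qquad G_\ell^{\rm geo}(x,y)=\prod_{s=0}^{d\ell-1}\tau_q^s(\mathcal G_x^{\rm geo})^{y_s},\qquad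 G_\ell^{\rm geo}(x)=\prod_{s=0}^{d\ell-1}\tau_q^s(\mathcal G_x^{\rm geo}).$$ **Theorem (Gross–Koblitz–Thakur formula for the geometric gamma function).** (1) Let $\mathfrak n,\ell$ be as above, $x\in\mathfrak n^{-1}A$, and write $\langle x\rangle_\infty=\sum_{i=0}^{\ell-1}\frac{x_iv^i}{v^\ell-1}$ with $x_i\in A$, $\deg x_i<d$. Put $\delta_{x,i}=v\,\langle v^{\ell-i-1}x\rangle_\infty$ if $x_i\in A_+$ and $\delta_{x,i}=1$ otherwise. For every $y\in(q^{d\ell}-1)^{-1}\mathbb Z$, with digits $y_s$ as above (if $x_i=0$ then $\delta_{x,i}=1$ and its exponent is irrelevant), $$G_\ell^{\rm geo}(x,y)=\prod_{i=0}^{\ell-1}\delta_{x,i}^{\,y_{di+\deg x_i}}\cdot\prod_{i=0}^{\ell-1}\Pi_v^{\rm geo}\big(\langle v^ix\rangle_\infty,-\langle|v^i|_\infty y\rangle\big)^{-1},$$ $$G_\ell^{\rm geo}(x,y)=\kappa_2\prod_{i=0}^{\ell-1}\Gamma_v^{\rm geo}\big(\langle v^ix\rangle_\infty,\langle|v^i|_\infty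 y\rangle\big),\qquad \kappa_2=\prod_{i=0}^{\ell-1}\delta_{x,i}^{\,y_{di+\deg x_i}}\langle v^ix\rangle_\infty^\flat\cdot\Big(G_\ell^{\rm geo}(x)\prod_{i=0}^{\ell-1}\delta_{x,i}^{-1}\Big)^{q-1}.$$ In particular, $$G_\ell^{\rm geo}(x)=\prod_{i=0}^{\ell-1}\delta_{x,i}\cdot\prod_{i=0}^{\ell-1}\Pi_v^{\rm geo}\big(\langle v^ix\rangle_\infty\big)^{-1}=\kappa_1\prod_{i=0}^{\ell-1}\Gamma_v^{\rm geo}\big(\langle v^ix\rangle_\infty\big)^{-1},\qquad \kappa_1=\prod_{i=0}^{\ell-1}\frac{\delta_{x,i}}{\langle v^ix\rangle_\infty^\flat}\in k,$$ and $G_\ell^{\rm geo}(x)$ (hence $\kappa_2$) is algebraic over $k$. (2) For all $a\in A$ and $r\in\mathbb Z$, the values $\Gamma_v^{\rm geo}\big(\frac a{v-1}\big)$, $\Gamma_v^{\rm geo}\big(\frac a{v-1},\frac r{q^d-1}\big)$ and $\Gamma_v\big(\frac a{v-1},\frac r{q^d-1}\big)$ are algebraic over $k$. -/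

import Mathlib

open Polynomial IsDedekindDomain Filter Topology
open scoped NNReal WithZero

noncomputable section

namespace GeoGauss

/-! ### The Carlitz module -/

section Carlitz

variable {F : Type*} [Field F] [Fintype F]

/-- The Carlitz polynomial `C_θ(z) = θ z + z ^ q`, a polynomial in `z` over `A = F[θ]`. -/
def carlitzTheta (F : Type*) [Field F] [Fintype F] : F[X][X] :=
  C X * X + X ^ Fintype.card F

/-- The Carlitz polynomial `C_a(z)` of `a = ∑ cᵢ θ ^ i`: it is `∑ cᵢ C_{θ ^ i}(z)`, where
`C_{θ ^ i}` is the `i`-fold composite of `C_θ`. -/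
def carlitz (a : F[X]) : F[X][X] :=
  a.sum fun i c => C (C c) * ((carlitzTheta F).comp^[i] X)

end Carlitz

/-! ### Fractional parts, absolute value at infinity, digits -/

section Digits

variable {F : Type*} [Field F]

/-- An element of `A`, as an element of `k`. -/
abbrev toK (a : F[X]) : RatFunc F := algebraMap F[X] (RatFunc F) a

/-- The `A`-fractional part of `x ∈ k`: writing `x = b / m`, it is `(b mod m) / m`, the unique
element congruent to `x` modulo `A` with absolute value `< 1` at infinity. -/
def fracInf (x : RatFunc F) : RatFunc F :=
  toK (x.num % x.denom) / toK x.denom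

open Classical in
/-- The absolute value at infinity on `k`, with `|f / g| = q ^ (deg f - deg g)`. -/
def absInf [Fintype F] (x : RatFunc F) : ℚ :=
  if x = 0 then 0 else (Fintype.card F : ℚ) ^ x.intDegree

/-- `⟨v ^ i x⟩`, an `A`-fractional part. -/
abbrev fracX (v : F[X]) (i : ℕ) (x : RatFunc F) : RatFunc F := fracInf (toK v ^ i * x)

/-- `⟨|v ^ i| y⟩`, a fractional part of a rational number. -/
abbrev fracY [Fintype F] (v : F[X]) (i : ℕ) (y : ℚ) : ℚ := Int.fract (absInf (toK v ^ i) * y)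

/-- The `s`-th base-`q` digit `y_s` of the numerator of the fractional part
`⟨y⟩ = ∑_{s < m} y_s q ^ s / (q ^ m - 1)`, for `y ∈ (q ^ m - 1)⁻¹ ℤ`. -/
def fracDigit (q m : ℕ) (y : ℚ) (s : ℕ) : ℕ :=
  ⌊Int.fract y * ((q : ℚ) ^ m - 1)⌋₊ / q ^ s % q

/-- The `i`-th digit of the `q`-adic expansion `y = ∑ yᵢ q ^ i`, `0 ≤ yᵢ < q`, of a `p`-adic
integer `y`, where `q` is a power of `p`. It is read off from `y` modulo `q ^ (i + 1)`. -/
def padicDigit {p : ℕ} [Fact p.Prime] (q : ℕ) (y : ℤ_[p]) (i : ℕ) : ℕ :=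
  (PadicInt.toZModPow (Nat.log p q * (i + 1)) y).val / q ^ i

/-- A rational number with denominator prime to `p`, as a `p`-adic integer (`0` for all other
rational numbers). -/
def ratToPadicInt (p : ℕ) [Fact p.Prime] (y : ℚ) : ℤ_[p] :=
  if h : ‖(y : ℚ_[p])‖ ≤ 1 then ⟨(y : ℚ_[p]), h⟩ else 0

end Digits

/-! ### The fields `k_v` and `ℂ_v` -/

section Fields

variable {F : Type*} [Field F] [Fintype F] (v : F[X]) [hv : Fact (Irreducible v)]

/-- The place of `k` given by the irreducible polynomial `v`. -/
def place : HeightOneSpectrum F[X] where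
  asIdeal := Ideal.span {v}
  isPrime := (Ideal.span_singleton_prime hv.out.ne_zero).2 hv.out.prime
  ne_bot := by simpa using hv.out.ne_zero

/-- The completion `k_v` of `k` at `v`. -/
abbrev Kv := (place v).adicCompletion (RatFunc F)

lemma one_lt_card_pow : (1 : ℝ≥0) < (Fintype.card F : ℝ≥0) ^ v.natDegree := by
  have h1 : (1 : ℝ≥0) < (Fintype.card F : ℝ≥0) := by
    exact_mod_cast Fintype.one_lt_card
  exact one_lt_pow₀ h1 hv.out.natDegree_pos.ne'

instance : (Valued.v : Valuation (Kv v) ℤᵐ⁰).RankOne :=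
  Valuation.IsRankOneDiscrete.rankOne _ (one_lt_card_pow v)

/-- The `v`-adic absolute value on `k_v`, inducing its topology. -/
instance : NontriviallyNormedField (Kv v) := Valued.toNontriviallyNormedField (Kv v) ℤᵐ⁰

/-- An algebraic closure of `k_v`. -/
abbrev KvBar := AlgebraicClosure (Kv v)

/-- The unique extension of the `v`-adic absolute value to the algebraic closure of `k_v`. -/
instance : NormedField (KvBar v) := spectralNorm.normedField (Kv v) (KvBar v)

instance : NormedAlgebra (Kv v) (KvBar v) := spectralNorm.normedAlgebra _ _

/-- `ℂ_v`, the completion of an algebraic closure of `k_v`. -/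
def Cv := UniformSpace.Completion (KvBar v)

instance : NormedField (Cv v) := inferInstanceAs (NormedField (UniformSpace.Completion (KvBar v)))

/-- The embedding of `k_v` into `ℂ_v`. -/
def KvToCv : Kv v →+* Cv v :=
  (UniformSpace.Completion.coeRingHom (α := KvBar v)).comp (algebraMap (Kv v) (KvBar v))

instance : Algebra (Kv v) (Cv v) := (KvToCv v).toAlgebra

instance : Algebra (RatFunc F) (Cv v) :=
  ((KvToCv v).comp (algebraMap (RatFunc F) (Kv v))).toAlgebra

instance : Algebra F[X] (Cv v) :=
  ((KvToCv v).comp (algebraMap F[X] (Kv v))).toAlgebra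

instance : IsScalarTower (RatFunc F) (Kv v) (Cv v) := IsScalarTower.of_algebraMap_eq fun _ => rfl

instance : IsScalarTower F[X] (Kv v) (Cv v) := IsScalarTower.of_algebraMap_eq fun _ => rfl

instance : IsScalarTower F[X] (RatFunc F) (Cv v) := IsScalarTower.of_algebraMap_eq fun a => by
  change KvToCv v _ = KvToCv v _
  rw [IsScalarTower.algebraMap_apply F[X] (RatFunc F) (Kv v)]

lemma norm_KvToCv (x : Kv v) : ‖KvToCv v x‖ = ‖x‖ :=
  (UniformSpace.Completion.norm_coe (E := KvBar v) (algebraMap (Kv v) (KvBar v) x)).trans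
    (spectralNorm_extends (L := KvBar v) x)

instance : IsUltrametricDist (Cv v) := by
  let _ : NormedAlgebra (Kv v) (Cv v) :=
    { (inferInstance : Algebra (Kv v) (Cv v)) with
      norm_smul_le := fun r x => by
        rw [Algebra.smul_def, norm_mul]
        exact le_of_eq (congrArg (· * ‖x‖) (norm_KvToCv v r)) }
  exact IsUltrametricDist.of_normedAlgebra (Kv v)

lemma norm_algebraMap_le_one (a : F[X]) : ‖algebraMap F[X] (Cv v) a‖ ≤ 1 := by
  have h : algebraMap F[X] (Cv v) a = KvToCv v (algebraMap F[X] (Kv v) a) := rfl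
  rw [h, norm_KvToCv]
  refine (Valued.toNormedField.norm_le_one_iff (L := Kv v) (Γ₀ := ℤᵐ⁰)).2 ?_
  rw [IsScalarTower.algebraMap_apply F[X] (RatFunc F) (Kv v)]
  exact (HeightOneSpectrum.valuedAdicCompletion_eq_valuation' (place v) _).trans_le
    ((place v).valuation_le_one a)

lemma norm_le_one_of_isIntegral {x : Cv v} (hx : IsIntegral F[X] x) : ‖x‖ ≤ 1 := by
  by_contra! h
  obtain ⟨f, hf, hfx⟩ := hx
  have hx0 : 0 < ‖x‖ := one_pos.trans h
  have key : x ^ f.natDegree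
      = -∑ i ∈ Finset.range f.natDegree, algebraMap F[X] (Cv v) (f.coeff i) * x ^ i := by
    rw [eval₂_eq_sum_range, Finset.sum_range_succ, hf.coeff_natDegree, map_one, one_mul] at hfx
    exact eq_neg_of_add_eq_zero_right hfx
  have hlt : ‖x ^ f.natDegree‖ < ‖x‖ ^ f.natDegree := by
    rw [key, norm_neg]
    refine lt_of_le_of_lt (IsUltrametricDist.norm_sum_le_of_forall_le_of_nonneg
      (C := ‖x‖ ^ f.natDegree / ‖x‖) (by positivity) fun i hi => ?_) ?_
    · rw [norm_mul, norm_pow, le_div_iff₀ hx0, mul_assoc, ← pow_succ]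
      calc _ ≤ 1 * ‖x‖ ^ (i + 1) := by gcongr; exact norm_algebraMap_le_one v _
        _ ≤ _ := by
          rw [one_mul]
          exact pow_le_pow_right₀ h.le (Finset.mem_range.1 hi)
    · exact div_lt_self (by positivity) h
  rw [norm_pow] at hlt
  exact lt_irrefl _ hlt

end Fields

/-! ### Cyclotomic function fields and geometric Gauss sums -/

section GaussSums

variable {F : Type*} [Field F] [Fintype F] (v : F[X]) [hv : Fact (Irreducible v)]

/-- The cyclotomic function field `K_n = k(Λ_n)` inside `ℂ_v`, where `Λ_n` is the set of roots of
`C_n(z)`. -/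
def cycField (n : F[X]) : IntermediateField (RatFunc F) (Cv v) :=
  IntermediateField.adjoin (RatFunc F) {z : Cv v | aeval z (carlitz n) = 0}

/-- The constant field extension `k 𝔽_{q ^ m}` of `k` inside `ℂ_v`. -/
def constField (m : ℕ) : IntermediateField (RatFunc F) (Cv v) :=
  IntermediateField.adjoin (RatFunc F) {z : Cv v | z ^ Fintype.card F ^ m = z}

/-- The compositum `K_{n,m}` of `K_n` and `k 𝔽_{q ^ m}`. -/
def compField (n : F[X]) (m : ℕ) : IntermediateField (RatFunc F) (Cv v) :=
  cycField v n ⊔ constField v m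

/-- The inclusion of `K_n` into `K_{n,m}`. -/
def cycToComp (n : F[X]) (m : ℕ) : cycField v n →ₐ[RatFunc F] compField v n m :=
  IntermediateField.inclusion le_sup_left

/-- `O_n`, the integral closure of `A` in `K_n`. -/
abbrev cycInt (n : F[X]) : Subalgebra F[X] (cycField v n) :=
  integralClosure F[X] (cycField v n)

/-- The prime `𝔓` of `O_n` above `v` singled out by the embedding `K_n ⊆ ℂ_v`. -/
def primeAbove (n : F[X]) : Ideal (cycInt v n) where
  carrier := {a | ‖((a : cycField v n) : Cv v)‖ < 1}
  add_mem' {a b} ha hb := by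
    have ha' : ‖((a : cycField v n) : Cv v)‖ < 1 := ha
    have hb' : ‖((b : cycField v n) : Cv v)‖ < 1 := hb
    refine lt_of_le_of_lt ?_ (max_lt ha' hb')
    exact IsUltrametricDist.norm_add_le_max ((a : cycField v n) : Cv v) ((b : cycField v n) : Cv v)
  zero_mem' := by simp
  smul_mem' c a ha := by
    have hc : ‖((c : cycField v n) : Cv v)‖ ≤ 1 :=
      norm_le_one_of_isIntegral v
        (c.2.map ((cycField v n).val.restrictScalars F[X]))
    have hm : (((c • a : cycInt v n) : cycField v n) : Cv v)
        = ((c : cycField v n) : Cv v) * ((a : cycField v n) : Cv v) := rfl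
    have ha' : ‖((a : cycField v n) : Cv v)‖ < 1 := ha
    change ‖(((c • a : cycInt v n) : cycField v n) : Cv v)‖ < 1
    rw [hm, norm_mul]
    exact (mul_le_of_le_one_left (norm_nonneg _) hc).trans_lt ha'

/-- `ℓ`, the order of `v` modulo `n`. -/
def ordMod (n : F[X]) : ℕ := orderOf (Ideal.Quotient.mk (Ideal.span {n}) v)

/-- The geometric Teichmüller character `ω`, the inverse of the reduction map from the
`n`-torsion points `Λ_n ⊆ O_n` to the `n`-torsion points of `C(O_n / 𝔓)`. -/
def omega (n : F[X]) (P : Ideal (cycInt v n)) (z : cycInt v n ⧸ P) : cycInt v n :=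
  Function.invFunOn (Ideal.Quotient.mk P) {t : cycInt v n | aeval t (carlitz n) = 0} z

/-- The geometric Gauss sum `1 + ∑_{z ≠ 0} ω(C_{x (v ^ ℓ - 1)}(z⁻¹)) ψ(z)` attached to a prime `𝔓`
of `O_n` above `v` and a map `ψ : O_n / 𝔓 → 𝔽_{q ^ (d ℓ)}`. Here `x ∈ n⁻¹ A`, so
`x (v ^ ℓ - 1)` is in `A` and is its own numerator. -/
def gaussSum (n : F[X]) (m : ℕ) (P : Ideal (cycInt v n)) (ψ : cycInt v n ⧸ P → compField v n m)
    (x : RatFunc F) : compField v n m :=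
  1 + ∑ᶠ z : (cycInt v n ⧸ P)ˣ,
    cycToComp v n m (omega v n P (aeval ((z⁻¹ : (cycInt v n ⧸ P)ˣ) : cycInt v n ⧸ P)
      (carlitz (x * (toK v ^ ordMod v n - 1)).num)))
      * ψ (z : cycInt v n ⧸ P)

/-- The (arithmetic) Teichmüller character `O_n / 𝔓 → 𝔽_{q ^ m}` for `𝔓 = primeAbove v n`: it sends
a residue class to the element `ζ` with `ζ ^ (q ^ m) = ζ` that reduces to this class. -/
def teich (n : F[X]) (m : ℕ) (z : cycInt v n ⧸ primeAbove v n) : compField v n m :=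
  Classical.epsilon fun ζ : compField v n m =>
    ζ ^ Fintype.card F ^ m = ζ ∧
      ∀ a : cycInt v n, Ideal.Quotient.mk (primeAbove v n) a = z →
        ‖(ζ : Cv v) - ((a : cycField v n) : Cv v)‖ < 1

/-- The automorphism `τ_q` of `K_{n,m}` over `k` that is the identity on `K_n` and the `q`-th power
Frobenius on `𝔽_{q ^ m}`. -/
def tauQ (n : F[X]) (m : ℕ) : compField v n m ≃ₐ[RatFunc F] compField v n m :=
  Classical.epsilon fun τ : compField v n m ≃ₐ[RatFunc F] compField v n m =>
    (∀ t : cycField v n, τ (cycToComp v n m t) = cycToComp v n m t) ∧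
      ∀ ζ : compField v n m, ζ ^ Fintype.card F ^ m = ζ → τ ζ = ζ ^ Fintype.card F

/-- The exponent `d ℓ`. -/
abbrev dl (n : F[X]) : ℕ := v.natDegree * ordMod v n

/-- The geometric Gauss sum at `x` for the prime and the Teichmüller character given by
`K_{n, d ℓ} ⊆ ℂ_v`. -/
def geoGauss (n : F[X]) (x : RatFunc F) : compField v n (dl v n) :=
  gaussSum v n (dl v n) (primeAbove v n) (teich v n (dl v n)) x

/-- The two-variable monomial `G(x, y) = ∏_s τ_q ^ s (g_x) ^ (y_s)`, where `g_x` is the Gauss sum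
at `x` and the `y_s` are the digits of `⟨y⟩`. -/
def gaussMonomial₂ (n : F[X]) (x : RatFunc F) (y : ℚ) : compField v n (dl v n) :=
  ∏ s ∈ Finset.range (dl v n),
    ((tauQ v n (dl v n) ^ s) (geoGauss v n x)) ^ fracDigit (Fintype.card F) (dl v n) y s

/-- The one-variable monomial `G(x) = ∏_s τ_q ^ s (g_x)`. -/
def gaussMonomial (n : F[X]) (x : RatFunc F) : compField v n (dl v n) :=
  ∏ s ∈ Finset.range (dl v n), (tauQ v n (dl v n) ^ s) (geoGauss v n x)

end GaussSums

/-! ### The `v`-adic gamma functions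

The functions below are considered for `x` in the ring of integers `A_v` of `k_v`. -/

section Gamma

variable {F : Type*} [Field F] [Fintype F] (v : F[X]) [hv : Fact (Irreducible v)]

/-- `x^♭`: equal to `x` if `x` is a unit for the valuation `w`, and to `1` otherwise. -/
def flat {R : Type*} [Ring R] (w : Valuation R ℤᵐ⁰) (x : R) : R := if w x = 1 then x else 1

/-- `x^♭` for `x ∈ k_v`. -/
abbrev flatV (x : Kv v) : Kv v := flat Valued.v x

/-- The set `A_{+,i}` of monic polynomials of degree `i`. -/
def monicDeg (F : Type*) [Field F] (i : ℕ) : Set F[X] := {a | a.Monic ∧ a.natDegree = i}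

/-- `∏_{a ∈ A_{+,i}} a^♭ / (x + a)^♭`. -/
def geoFactor (x : Kv v) (i : ℕ) : Kv v :=
  ∏ᶠ a ∈ monicDeg F i,
    flatV v (algebraMap F[X] (Kv v) a) / flatV v (x + algebraMap F[X] (Kv v) a)

/-- `-∏_{a ∈ A_{+,i}} a^♭`. -/
def ariFactor (i : ℕ) : Kv v :=
  -∏ᶠ a ∈ monicDeg F i, flatV v (algebraMap F[X] (Kv v) a)

/-- The geometric factorial `Π_v^geo(x)`. -/
def piGeo (x : Kv v) : Kv v :=
  limUnder atTop fun N : ℕ => ∏ i ∈ Finset.range N, geoFactor v x i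

variable {p : ℕ} [Fact p.Prime]

/-- The two-variable geometric factorial `Π_v^geo(x, y)`. -/
def piGeo₂ (x : Kv v) (y : ℤ_[p]) : Kv v :=
  limUnder atTop fun N : ℕ =>
    ∏ i ∈ Finset.range N, geoFactor v x i ^ padicDigit (Fintype.card F) y i

/-- The arithmetic factorial `Π_v^ari(y)`. -/
def piAri (y : ℤ_[p]) : Kv v :=
  limUnder atTop fun N : ℕ =>
    ∏ i ∈ Finset.range N, ariFactor v i ^ padicDigit (Fintype.card F) y i

/-- The geometric gamma function `Γ_v^geo(x)`. -/
def gammaGeo (x : Kv v) : Kv v := (flatV v x)⁻¹ * piGeo v x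

/-- The two-variable geometric gamma function `Γ_v^geo(x, y)`. -/
def gammaGeo₂ (x : Kv v) (y : ℤ_[p]) : Kv v := (flatV v x)⁻¹ * piGeo₂ v x (y - 1)

/-- The arithmetic gamma function `Γ_v^ari(y)`. -/
def gammaAri (y : ℤ_[p]) : Kv v := piAri v (y - 1)

/-- The two-variable gamma function `Γ_v(x, y)`. -/
def gammaTwo (x : Kv v) (y : ℤ_[p]) : Kv v := gammaGeo₂ v x y / gammaAri v y

end Gamma

/-! ### The factors `δ_{x,i}` -/

open Classical in
/-- `δ_{x,i} = v ⟨v ^ (ℓ - i - 1) x⟩` if the digit `xd i` is monic, and `1` otherwise. -/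
def delta {F : Type*} [Field F] [Fintype F] (v : F[X]) (l : ℕ) (xd : ℕ → F[X]) (x : RatFunc F)
    (i : ℕ) : RatFunc F :=
  if (xd i).Monic then
    toK v * fracX v (l - i - 1) x
  else 1

end GeoGauss

end

open GeoGauss

noncomputable section

set_option linter.unusedSectionVars false

namespace GeoGauss

/-! ### The Carlitz action on an `F[X]`-algebra -/

section CarlitzAction

variable {F : Type*} [Field F] [Fintype F] {R : Type*} [CommRing R] [Algebra F[X] R]

/-! Both sides are computed through the Carlitz binomial coefficients E_T (`cBin`). Two facts about
them carry the proof. They are the coefficients of the Carlitz polynomials, C_a(z) = ∑ E_T(a)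
z^(q^T) (`cAct_eq_sum`), which ties them to torsion points and so to Gauss sums. They also satisfy ∏
(1 + z/a) = 1 + E_T(z), the product being over the monic a of degree T (`prod_one_add_div`), which
ties them to the factors of the geometric factorial.

Let v^l x = x + b with b in A, and d = deg v. As C_v is congruent to τ^d modulo v, E_(T+dl)(v^l x)
is v-adically close to E_T(x), while E_T(b) = 0 for T > deg b. Hence E_T(x) converges as T runs to
infinity in a class s modulo dl (`tendsto_cLim`); call the limit e_s(x) (`cLim`).

Gauss sums: for w in F_(q^(dl)), the sum λ_x(w) = ∑ e_t(x) w^(q^t) (`lam`) is A-linear in x and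
vanishes for x in A, so it is a torsion point killed by the denominator of x. It reduces to -C_b(w).
Reduction is injective on torsion prime to v, so ω(C_b(z)) = -λ_x(ψ(z)) (`omega_eq`). Orthogonality
of the characters w ↦ w^(q^s) then extracts one coefficient: τ_q^s of the Gauss sum is 1 + e_s(x)
(`coe_tauQ_pow_geoGauss`). The existence of τ_q requires that K_n have no new constants; this
follows from an embedding of K_n into F((u)), where the torsion points are explicit Laurent series
(`carlitz_splits`).

Gamma functions: if v Y' = Y + c with deg c < d, the multiples of v hidden in ∏ (Y + a) are the v
(Y' + b). So the degree t + d factor of Π(Y), times 1 + E_(t+d)(Y), is 1 + E_t(Y')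
(`geoFactor_mul_add`). Along the periodic orbit Y = ⟨v^i x⟩ this telescopes, and in the limit 1 +
e_s(x) becomes δ divided by partial products of the Π(⟨v^i x⟩) over progressions modulo dl
(`prod_geoProg_mul_one_add_cLim`). Raising to the powers y_s and multiplying gives the formula with
Π, because multiplying y by |v^i| shifts its digits cyclically. The formula with Γ follows since the
q-adic digits of y - 1 and -y add up to q - 1.

Algebraicity: for n = v - 1 the period l is 1, so each partial product of Π is by itself δ/(1 +
e_s). A rational second argument has eventually periodic digits, hence gives finitely many such
products. For the arithmetic gamma function the q-th power of a partial product is an algebraic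
multiple of the next one, and d such steps return to the starting class. -/

lemma frob_add (x y : R) :
    (x + y) ^ Fintype.card F = x ^ Fintype.card F + y ^ Fintype.card F := by
  let _ : Algebra F R := ((algebraMap F[X] R).comp C).toAlgebra
  exact map_add (FiniteField.frobeniusAlgHom F R) x y

lemma frob_sub (x y : R) :
    (x - y) ^ Fintype.card F = x ^ Fintype.card F - y ^ Fintype.card F := by
  let _ : Algebra F R := ((algebraMap F[X] R).comp C).toAlgebra
  exact map_sub (FiniteField.frobeniusAlgHom F R) x y

lemma frob_const (c : F) :
    (algebraMap F[X] R (C c)) ^ Fintype.card F = algebraMap F[X] R (C c) := by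
  rw [← map_pow, ← C_pow, FiniteField.pow_card]

variable (F R) in
/-- The `q`-power map, as a ring homomorphism. -/
def frobHom : R →+* R where
  toFun x := x ^ Fintype.card F
  map_one' := one_pow _
  map_mul' x y := mul_pow x y _
  map_zero' := zero_pow Fintype.card_ne_zero
  map_add' := frob_add

lemma frobHom_apply (x : R) : frobHom F R x = x ^ Fintype.card F := rfl

lemma frobHom_pow_apply (n : ℕ) (x : R) : (frobHom F R ^ n) x = x ^ Fintype.card F ^ n := by
  induction n with
  | zero => simp
  | succ n ih =>
    rw [pow_succ', RingHom.mul_def, RingHom.comp_apply, ih, frobHom_apply, ← pow_mul, pow_succ]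

variable (F) in
lemma frobPow_add (n : ℕ) (x y : R) :
    (x + y) ^ Fintype.card F ^ n = x ^ Fintype.card F ^ n + y ^ Fintype.card F ^ n := by
  simp only [← frobHom_pow_apply, map_add]

variable (F) in
lemma frobPow_sub (n : ℕ) (x y : R) :
    (x - y) ^ Fintype.card F ^ n = x ^ Fintype.card F ^ n - y ^ Fintype.card F ^ n := by
  simp only [← frobHom_pow_apply, map_sub]

variable (F) in
lemma frobPow_sum (n : ℕ) {ι : Type*} (s : Finset ι) (f : ι → R) :
    (∑ i ∈ s, f i) ^ Fintype.card F ^ n = ∑ i ∈ s, f i ^ Fintype.card F ^ n := by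
  simp only [← frobHom_pow_apply, map_sum]

lemma frobPow_const (n : ℕ) (c : F) :
    (algebraMap F[X] R (C c)) ^ Fintype.card F ^ n = algebraMap F[X] R (C c) := by
  rw [← map_pow, ← C_pow, FiniteField.pow_card_pow]

/-- The action of `a ∈ F[X]` on `z` through the Carlitz module. -/
def cAct (a : F[X]) (z : R) : R := aeval z (carlitz a)

lemma carlitz_add (a b : F[X]) : carlitz (a + b) = carlitz a + carlitz b := by
  unfold carlitz
  exact Polynomial.sum_add_index a b _ (by simp) (by intros; simp [add_mul])

lemma carlitz_C_mul (c : F) (a : F[X]) : carlitz (C c * a) = C (C c) * carlitz a := by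
  unfold carlitz
  rw [← smul_eq_C_mul, Polynomial.sum_smul_index _ _ _ (by simp), Polynomial.sum, Polynomial.sum,
    Finset.mul_sum]
  simp [mul_assoc]

lemma carlitz_X_pow (i : ℕ) : carlitz (X ^ i : F[X]) = (carlitzTheta F).comp^[i] X := by
  unfold carlitz
  rw [X_pow_eq_monomial, Polynomial.sum_monomial_index _ _ (by simp)]
  simp

lemma cAct_add_left (a b : F[X]) (z : R) : cAct (a + b) z = cAct a z + cAct b z := by
  simp [cAct, carlitz_add]

lemma cAct_C_mul (c : F) (a : F[X]) (z : R) :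
    cAct (C c * a) z = algebraMap F[X] R (C c) * cAct a z := by
  simp [cAct, carlitz_C_mul]

lemma cAct_one (z : R) : cAct (1 : F[X]) z = z := by
  have := carlitz_X_pow (F := F) 0
  simp only [pow_zero, Function.iterate_zero, id] at this
  simp [cAct, this]

lemma cAct_C (c : F) (z : R) : cAct (C c) z = algebraMap F[X] R (C c) * z := by
  have := cAct_C_mul c 1 z
  rwa [mul_one, cAct_one] at this

lemma cAct_X_pow_succ (i : ℕ) (z : R) :
    cAct (X ^ (i + 1) : F[X]) z =
      algebraMap F[X] R X * cAct (X ^ i : F[X]) z + cAct (X ^ i : F[X]) z ^ Fintype.card F := by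
  simp only [cAct, carlitz_X_pow, Function.iterate_succ_apply']
  rw [aeval_comp]
  simp [carlitzTheta]

lemma cAct_X (z : R) : cAct (X : F[X]) z = algebraMap F[X] R X * z + z ^ Fintype.card F := by
  have := cAct_X_pow_succ (F := F) 0 z
  simpa [cAct_one] using this

lemma cAct_X_mul (a : F[X]) (z : R) : cAct (X * a) z = cAct (X : F[X]) (cAct a z) := by
  induction a using Polynomial.induction_on' with
  | add a b ha hb =>
    rw [mul_add, cAct_add_left, ha, hb, cAct_add_left, cAct_X, cAct_X, cAct_X, frob_add]
    ring
  | monomial i c =>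
    have h : X * (monomial i c : F[X]) = C c * X ^ (i + 1) := by
      rw [← C_mul_X_pow_eq_monomial]; ring
    rw [h, ← C_mul_X_pow_eq_monomial, cAct_C_mul, cAct_C_mul, cAct_X_pow_succ, cAct_X, mul_pow,
      frob_const]
    ring

lemma cAct_mul (a b : F[X]) (z : R) : cAct (a * b) z = cAct a (cAct b z) := by
  induction a using Polynomial.induction_on with
  | C c => rw [cAct_C_mul, cAct_C]
  | add p q hp hq => rw [add_mul, cAct_add_left, hp, hq, cAct_add_left]
  | monomial n c ih =>
    have h : C c * X ^ (n + 1) * b = X * (C c * X ^ n * b) := by ring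
    have h' : (C c * X ^ (n + 1) : F[X]) = X * (C c * X ^ n) := by ring
    rw [h, h', cAct_X_mul, ih, cAct_X_mul]

lemma cAct_add (a : F[X]) (z w : R) : cAct a (z + w) = cAct a z + cAct a w := by
  induction a using Polynomial.induction_on with
  | C c => simp only [cAct_C, mul_add]
  | add p q hp hq => simp only [cAct_add_left, hp, hq]; ring
  | monomial n c ih =>
    have h' : (C c * X ^ (n + 1) : F[X]) = X * (C c * X ^ n) := by ring
    rw [h', cAct_X_mul, ih, cAct_X_mul, cAct_X_mul, cAct_X, cAct_X, cAct_X, frob_add]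
    ring

lemma cAct_zero_left (z : R) : cAct (0 : F[X]) z = 0 := by
  simpa using cAct_add_left (0 : F[X]) 0 z

lemma cAct_zero (a : F[X]) : cAct a (0 : R) = 0 := by
  simpa using cAct_add a (0 : R) 0

lemma cAct_neg (a : F[X]) (z : R) : cAct a (-z) = -cAct a z := by
  rw [eq_neg_iff_add_eq_zero, ← cAct_add, neg_add_cancel, cAct_zero]

lemma cAct_sub (a : F[X]) (z w : R) : cAct a (z - w) = cAct a z - cAct a w := by
  rw [sub_eq_add_neg, cAct_add, cAct_neg, sub_eq_add_neg]

lemma cAct_neg_left (a : F[X]) (z : R) : cAct (-a) z = -cAct a z := by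
  rw [eq_neg_iff_add_eq_zero, ← cAct_add_left, neg_add_cancel, cAct_zero_left]

lemma cAct_sub_left (a b : F[X]) (z : R) : cAct (a - b) z = cAct a z - cAct b z := by
  rw [sub_eq_add_neg, cAct_add_left, cAct_neg_left, sub_eq_add_neg]

lemma map_cAct {S : Type*} [CommRing S] [Algebra F[X] S] (f : R →ₐ[F[X]] S) (a : F[X]) (z : R) :
    f (cAct a z) = cAct a (f z) := by
  simp [cAct, aeval_algHom_apply]

end CarlitzAction

/-! ### Carlitz binomial coefficients -/

section Binomial

variable {F : Type*} [Field F] [Fintype F] {L : Type*} [Field L] [Algebra F[X] L]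

variable (F) in
/-- The Carlitz binomial coefficients `E_T(z)`, the coefficients of `C_z = ∑ E_T(z) τ ^ T`. -/
def cBin : ℕ → L → L
  | 0, z => z
  | T + 1, z => (cBin T z ^ Fintype.card F - cBin T z) /
      (algebraMap F[X] L X ^ Fintype.card F ^ (T + 1) - algebraMap F[X] L X)

lemma cBin_zero_left (z : L) : cBin F 0 z = z := rfl

lemma cBin_succ (T : ℕ) (z : L) : cBin F (T + 1) z = (cBin F T z ^ Fintype.card F - cBin F T z) /
      (algebraMap F[X] L X ^ Fintype.card F ^ (T + 1) - algebraMap F[X] L X) := rfl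

lemma cBin_add (T : ℕ) (z w : L) : cBin F T (z + w) = cBin F T z + cBin F T w := by
  induction T with
  | zero => rfl
  | succ T ih => rw [cBin_succ, cBin_succ, cBin_succ, ih, frob_add]; ring

lemma cBin_const_mul (T : ℕ) (c : F) (z : L) :
    cBin F T (algebraMap F[X] L (C c) * z) = algebraMap F[X] L (C c) * cBin F T z := by
  induction T with
  | zero => rfl
  | succ T ih => rw [cBin_succ, cBin_succ, ih, mul_pow, frob_const]; ring

lemma cBin_zero (T : ℕ) : cBin F T (0 : L) = 0 := by
  simpa using cBin_add (F := F) T (0 : L) 0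

lemma cBin_neg (T : ℕ) (z : L) : cBin F T (-z) = -cBin F T z := by
  rw [eq_neg_iff_add_eq_zero, ← cBin_add, neg_add_cancel, cBin_zero]

lemma map_cBin {M : Type*} [Field M] [Algebra F[X] M] (f : L →+* M)
    (hf : ∀ a : F[X], f (algebraMap F[X] L a) = algebraMap F[X] M a) (T : ℕ) (z : L) :
    f (cBin F T z) = cBin F T (f z) := by
  induction T with
  | zero => rfl
  | succ T ih => rw [cBin_succ, cBin_succ, ← ih]; simp [hf]

variable (hinj : Function.Injective (algebraMap F[X] L))
include hinj

lemma theta_pow_sub_ne_zero (T : ℕ) :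
    algebraMap F[X] L X ^ Fintype.card F ^ (T + 1) - algebraMap F[X] L X ≠ 0 := by
  rw [← map_pow, ← map_sub]
  refine (map_ne_zero_iff _ hinj).2 ?_
  exact FiniteField.X_pow_card_sub_X_ne_zero F
    (Nat.one_lt_pow (Nat.succ_ne_zero T) Fintype.one_lt_card)

lemma cBin_succ_mul (T : ℕ) (z : L) :
    (algebraMap F[X] L X ^ Fintype.card F ^ (T + 1) - algebraMap F[X] L X) * cBin F (T + 1) z =
      cBin F T z ^ Fintype.card F - cBin F T z := by
  rw [cBin_succ, mul_div_cancel₀ _ (theta_pow_sub_ne_zero hinj T)]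

/-- With C_z = ∑ E_T(z) τ^T, this and `cBin_theta_mul'` are the coefficients of C_z C_θ and C_θ C_z.
The recursion defining `cBin` says exactly that the two agree. -/
lemma cBin_theta_mul (T : ℕ) (z : L) :
    cBin F (T + 1) (algebraMap F[X] L X * z) =
      algebraMap F[X] L X ^ Fintype.card F ^ (T + 1) * cBin F (T + 1) z + cBin F T z := by
  refine mul_left_cancel₀ (theta_pow_sub_ne_zero hinj T) ?_
  rw [cBin_succ_mul hinj, mul_add, mul_left_comm, cBin_succ_mul hinj]
  cases T with
  | zero => simp only [cBin_zero_left, zero_add, pow_one, mul_pow]; ring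
  | succ T =>
    rw [cBin_theta_mul T, frob_add, mul_pow, ← pow_mul, ← pow_succ]
    have := cBin_succ_mul hinj T z
    linear_combination -this

lemma cBin_theta_mul' (T : ℕ) (z : L) :
    cBin F (T + 1) (algebraMap F[X] L X * z) =
      algebraMap F[X] L X * cBin F (T + 1) z + cBin F T z ^ Fintype.card F := by
  rw [cBin_theta_mul hinj]
  linear_combination cBin_succ_mul hinj T z

lemma cBin_X_pow_of_lt {j T : ℕ} (h : j < T) : cBin F T (algebraMap F[X] L X ^ j) = 0 := by
  induction j generalizing T with
  | zero =>
    obtain ⟨T, rfl⟩ := Nat.exists_eq_succ_of_ne_zero h.ne'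
    clear h
    induction T with
    | zero => simp [cBin_succ, cBin_zero_left]
    | succ T ih =>
      rw [Nat.succ_eq_add_one, cBin_succ, ih]
      simp
  | succ j ih =>
    obtain ⟨T, rfl⟩ := Nat.exists_eq_succ_of_ne_zero (Nat.ne_zero_of_lt h)
    rw [pow_succ', cBin_theta_mul hinj, ih (by omega), ih (by omega)]
    simp

lemma cBin_X_pow_self (T : ℕ) : cBin F T (algebraMap F[X] L X ^ T) = 1 := by
  induction T with
  | zero => simp [cBin_zero_left]
  | succ T ih =>
    rw [pow_succ', cBin_theta_mul hinj, ih, cBin_X_pow_of_lt hinj (by omega)]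
    simp

lemma cBin_of_degree_lt {T : ℕ} {a : F[X]} (h : a.degree < T) :
    cBin F T (algebraMap F[X] L a) = 0 := by
  rw [a.as_sum_range_C_mul_X_pow, map_sum]
  have hs : ∀ (s : Finset ℕ) (f : ℕ → L), cBin F T (∑ i ∈ s, f i) = ∑ i ∈ s, cBin F T (f i) :=
    fun s f => map_sum (⟨⟨cBin F T, cBin_zero T⟩, cBin_add T⟩ : L →+ L) f s
  rw [hs]
  refine Finset.sum_eq_zero fun i hi => ?_
  rw [map_mul, map_pow, cBin_const_mul]
  rcases lt_or_ge i T with hiT | hiT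
  · rw [cBin_X_pow_of_lt hinj hiT, mul_zero]
  · rw [coeff_eq_zero_of_degree_lt (h.trans_le (by exact_mod_cast hiT))]
    simp

lemma cBin_of_monic {T : ℕ} {a : F[X]} (ha : a.Monic) (h : a.natDegree = T) :
    cBin F T (algebraMap F[X] L a) = 1 := by
  have : a = X ^ T + (a - X ^ T) := by ring
  rw [this, map_add, cBin_add, map_pow, cBin_X_pow_self hinj, cBin_of_degree_lt hinj, add_zero]
  have hd : a.degree = (X ^ T : F[X]).degree := by
    rw [degree_X_pow, degree_eq_natDegree ha.ne_zero, h]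
  refine (degree_sub_lt_left hd ha.ne_zero ?_).trans_eq ?_
  · rw [ha.leadingCoeff, leadingCoeff_X_pow]
  · rw [hd, degree_X_pow]

/-- The coefficient of τ^T in the composite C_z C_a. -/
lemma cBin_mul (T : ℕ) (a : F[X]) (z : L) :
    cBin F T (algebraMap F[X] L a * z) = ∑ i ∈ Finset.range (T + 1),
      cBin F i z * cBin F (T - i) (algebraMap F[X] L a) ^ Fintype.card F ^ i := by
  induction a using Polynomial.induction_on generalizing T z with
  | C c =>
    rw [Finset.sum_eq_single T]
    · rw [Nat.sub_self, cBin_const_mul, cBin_zero_left, frobPow_const, mul_comm]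
    · intro i hi hne
      rw [Finset.mem_range] at hi
      rw [cBin_of_degree_lt hinj, zero_pow (by positivity), mul_zero]
      exact degree_C_le.trans_lt (by exact_mod_cast (by omega : 0 < T - i))
    · simp
  | add p r hp hr =>
    rw [map_add, add_mul, cBin_add, hp, hr, ← Finset.sum_add_distrib]
    refine Finset.sum_congr rfl fun ij _ => ?_
    rw [cBin_add, frobPow_add F]
    ring
  | monomial n c ih =>
    have h' : (C c * X ^ (n + 1) : F[X]) = X * (C c * X ^ n) := by ring
    rw [h', map_mul (algebraMap F[X] L) X]
    generalize hb : algebraMap F[X] L (C c * X ^ n) = b at ih ⊢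
    -- The factor θ is moved from the polynomial onto z, which is why the induction generalizes z.
    rw [mul_comm (algebraMap F[X] L X) b, mul_assoc, ih]
    cases T with
    | zero => simp [cBin_zero_left]; ring
    | succ T =>
      have hL : ∀ i ∈ Finset.range (T + 1),
          cBin F (i + 1) (algebraMap F[X] L X * z) * cBin F (T + 1 - (i + 1)) b ^ Fintype.card F ^ (i + 1)
          = algebraMap F[X] L X ^ Fintype.card F ^ (i + 1) * cBin F (i + 1) z *
              cBin F (T + 1 - (i + 1)) b ^ Fintype.card F ^ (i + 1) +
            cBin F i z * cBin F (T - i) b ^ Fintype.card F ^ (i + 1) := by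
        intro i _
        rw [cBin_theta_mul hinj, Nat.add_sub_add_right]
        ring
      have hR : ∀ i ∈ Finset.range (T + 1),
          cBin F i z * cBin F (T + 1 - i) (b * algebraMap F[X] L X) ^ Fintype.card F ^ i
          = algebraMap F[X] L X ^ Fintype.card F ^ i * cBin F i z *
              cBin F (T + 1 - i) b ^ Fintype.card F ^ i +
            cBin F i z * cBin F (T - i) b ^ Fintype.card F ^ (i + 1) := by
        intro i hi
        rw [Finset.mem_range] at hi
        obtain ⟨j, rfl⟩ := Nat.exists_eq_add_of_le (Nat.lt_succ_iff.1 hi)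
        rw [show i + j + 1 - i = j + 1 by omega, show i + j - i = j by omega, mul_comm b,
          cBin_theta_mul' hinj, frobPow_add F, mul_pow, ← pow_mul, ← pow_succ']
        ring
      rw [Finset.sum_range_succ', Finset.sum_congr rfl hL, Finset.sum_add_distrib,
        Finset.sum_range_succ _ (T + 1), Finset.sum_congr rfl hR, Finset.sum_add_distrib]
      -- The terms containing θ form the same sum over T + 2 indices on both sides, peeled at
      -- opposite ends.
      have key := Finset.sum_range_succ' (fun i => algebraMap F[X] L X ^ Fintype.card F ^ i *
        cBin F i z * cBin F (T + 1 - i) b ^ Fintype.card F ^ i) (T + 1)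
      rw [Finset.sum_range_succ] at key
      simp only [cBin_zero_left, pow_zero, pow_one, Nat.sub_self, Nat.sub_zero] at key ⊢
      rw [mul_pow]
      linear_combination -key

/-- The Carlitz binomial coefficients are the coefficients of the Carlitz polynomials. -/
lemma cAct_eq_sum {M : ℕ} {a : F[X]} (h : a.degree < M) (z : L) :
    cAct a z = ∑ T ∈ Finset.range M,
      cBin F T (algebraMap F[X] L a) * z ^ Fintype.card F ^ T := by
  have key : ∀ (j M : ℕ), j < M → cAct (X ^ j : F[X]) z = ∑ T ∈ Finset.range M,
      cBin F T (algebraMap F[X] L X ^ j) * z ^ Fintype.card F ^ T := by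
    intro j
    induction j with
    | zero =>
      intro M hM
      rw [Finset.sum_eq_single 0]
      · simp [cAct_one, cBin_zero_left]
      · intro T _ hT
        rw [cBin_X_pow_of_lt hinj (Nat.pos_of_ne_zero hT), zero_mul]
      · simp [hM.ne']
    | succ j ih =>
      intro M hM
      obtain ⟨M, rfl⟩ := Nat.exists_eq_succ_of_ne_zero (Nat.ne_zero_of_lt hM)
      rw [cAct_X_pow_succ]
      nth_rw 1 [ih (M + 1) (by omega)]
      rw [ih M (by omega), Finset.sum_range_succ', Finset.sum_range_succ', mul_add,
        Finset.mul_sum]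
      have := frobPow_sum F 1 (Finset.range M)
        fun T => cBin F T (algebraMap F[X] L X ^ j) * z ^ Fintype.card F ^ T
      rw [pow_one] at this
      rw [this, add_right_comm, ← Finset.sum_add_distrib]
      congr 1
      · refine Finset.sum_congr rfl fun T _ => ?_
        rw [pow_succ' (algebraMap F[X] L X) j, cBin_theta_mul' hinj, mul_pow, ← pow_mul,
          ← pow_succ]
        ring
      · simp only [cBin_zero_left]; ring
  have hs : ∀ (T : ℕ) (s : Finset ℕ) (f : ℕ → L),
      cBin F T (∑ i ∈ s, f i) = ∑ i ∈ s, cBin F T (f i) :=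
    fun T s f => map_sum (⟨⟨cBin F T, cBin_zero T⟩, cBin_add T⟩ : L →+ L) f s
  have hc : ∀ (s : Finset ℕ) (f : ℕ → F[X]), cAct (∑ i ∈ s, f i) z = ∑ i ∈ s, cAct (f i) z :=
    fun s f => map_sum (⟨⟨fun a => cAct a z, cAct_zero_left z⟩,
      fun a b => cAct_add_left a b z⟩ : F[X] →+ L) f s
  rcases eq_or_ne a 0 with rfl | ha
  · simp [cAct_zero_left, cBin_zero]
  have hM : a.natDegree < M := (natDegree_lt_iff_degree_lt ha).2 h
  rw [a.as_sum_range_C_mul_X_pow, hc, map_sum]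
  simp only [hs, Finset.sum_mul]
  rw [Finset.sum_comm]
  refine Finset.sum_congr rfl fun j hj => ?_
  rw [Finset.mem_range] at hj
  rw [cAct_C_mul, key j M (by omega), Finset.mul_sum]
  refine Finset.sum_congr rfl fun T _ => ?_
  rw [map_mul, map_pow, cBin_const_mul]
  ring

end Binomial

/-! ### Monic polynomials of given degree -/

section MonicDeg

variable {F : Type*} [Field F] [Fintype F]

omit [Fintype F] in
lemma monicDeg_eq_image (t : ℕ) :
    monicDeg F t = (fun a => X ^ t + a) '' {a : F[X] | a ∈ degreeLT F t} := by
  ext a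
  simp only [monicDeg, Set.mem_ofPred_eq, Set.mem_image, mem_degreeLT]
  constructor
  · rintro ⟨ha, rfl⟩
    refine ⟨a - X ^ a.natDegree, ?_, by ring⟩
    have hd : a.degree = (X ^ a.natDegree : F[X]).degree := by
      rw [degree_X_pow, degree_eq_natDegree ha.ne_zero]
    refine (degree_sub_lt_left hd ha.ne_zero ?_).trans_eq (degree_eq_natDegree ha.ne_zero)
    rw [ha.leadingCoeff, leadingCoeff_X_pow]
  · rintro ⟨b, hb, rfl⟩
    refine ⟨monic_X_pow_add hb, ?_⟩
    rw [natDegree_add_eq_left_of_degree_lt, natDegree_X_pow]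
    rwa [degree_X_pow]

lemma ncard_degreeLT (t : ℕ) : {a : F[X] | a ∈ degreeLT F t}.ncard = Fintype.card F ^ t := by
  have : Nat.card (degreeLT F t) = Fintype.card F ^ t := by
    rw [Nat.card_congr (degreeLTEquiv F t).toEquiv]
    simp
  exact this

lemma finite_degreeLT (t : ℕ) : {a : F[X] | a ∈ degreeLT F t}.Finite := by
  refine Set.finite_of_ncard_ne_zero ?_
  rw [ncard_degreeLT]
  positivity

lemma finite_monicDeg (t : ℕ) : (monicDeg F t).Finite := by
  rw [monicDeg_eq_image]
  exact (finite_degreeLT t).image _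

lemma ncard_monicDeg (t : ℕ) : (monicDeg F t).ncard = Fintype.card F ^ t := by
  rw [monicDeg_eq_image, Set.ncard_image_of_injective _ (add_right_injective _), ncard_degreeLT]

/-- The finite set of monic polynomials of degree `t`. -/
def monicFin (F : Type*) [Field F] [Fintype F] (t : ℕ) : Finset F[X] :=
  (finite_monicDeg (F := F) t).toFinset

lemma mem_monicFin {t : ℕ} {a : F[X]} : a ∈ monicFin F t ↔ a.Monic ∧ a.natDegree = t := by
  simp [monicFin, monicDeg]

lemma card_monicFin (t : ℕ) : (monicFin F t).card = Fintype.card F ^ t := by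
  rw [← ncard_monicDeg, Set.ncard_eq_toFinset_card _ (finite_monicDeg t), monicFin]

lemma finprod_monicDeg {M : Type*} [CommMonoid M] (t : ℕ) (f : F[X] → M) :
    ∏ᶠ a ∈ monicDeg F t, f a = ∏ a ∈ monicFin F t, f a :=
  finprod_mem_eq_finite_toFinset_prod _ (finite_monicDeg t)

lemma monic_add_of_degree_lt {t : ℕ} {a b : F[X]} (ha : a ∈ monicFin F t) (hb : b.degree < t) :
    a + b ∈ monicFin F t := by
  rw [mem_monicFin] at ha ⊢
  have h : b.degree < a.degree := by
    rwa [degree_eq_natDegree ha.1.ne_zero, ha.2]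
  exact ⟨ha.1.add_of_left h, by rw [natDegree_add_eq_left_of_degree_lt h, ha.2]⟩

/-- Translation by a polynomial of degree `< t` permutes the monic polynomials of degree `t`. -/
lemma prod_monicFin_add {M : Type*} [CommMonoid M] {t : ℕ} (f : F[X] → M) {b : F[X]}
    (hb : b.degree < t) : ∏ a ∈ monicFin F t, f (a + b) = ∏ a ∈ monicFin F t, f a := by
  refine Finset.prod_bij (fun a _ => a + b) (fun a ha => monic_add_of_degree_lt ha hb)
    (fun _ _ _ _ h => add_right_cancel h) (fun a ha => ⟨a - b, ?_, by ring⟩) fun _ _ => rfl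
  rw [sub_eq_add_neg]
  exact monic_add_of_degree_lt ha (by rwa [degree_neg])

end MonicDeg

/-! ### The product formula for Carlitz binomial coefficients -/

section BinomialProduct

variable {F : Type*} [Field F] [Fintype F] {L : Type*} [Field L] [Algebra F[X] L]

variable (F L) in
/-- The Carlitz binomial coefficient `E_T` as a polynomial. -/
def cBinPoly : ℕ → L[X]
  | 0 => X
  | T + 1 => C (algebraMap F[X] L X ^ Fintype.card F ^ (T + 1) - algebraMap F[X] L X)⁻¹ *
      (cBinPoly T ^ Fintype.card F - cBinPoly T)

lemma eval_cBinPoly (T : ℕ) (z : L) : (cBinPoly F L T).eval z = cBin F T z := by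
  induction T with
  | zero => simp [cBinPoly, cBin_zero_left]
  | succ T ih => simp [cBinPoly, ih, cBin_succ, div_eq_inv_mul]

lemma natDegree_cBinPoly_le (T : ℕ) : (cBinPoly F L T).natDegree ≤ Fintype.card F ^ T := by
  induction T with
  | zero => simp [cBinPoly]
  | succ T ih =>
    refine (natDegree_C_mul_le _ _).trans ((natDegree_sub_le _ _).trans (max_le ?_ ?_))
    · exact natDegree_pow_le.trans (by rw [pow_succ']; gcongr)
    · exact ih.trans (Nat.pow_le_pow_right Fintype.card_pos (Nat.le_succ T))

/-- `∏ (X + a) = D_T (1 + E_T(X))`, the product being over the monic `a` of degree `T`. -/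
lemma prod_one_add_div (hinj : Function.Injective (algebraMap F[X] L)) (T : ℕ) (z : L) :
    ∏ a ∈ monicFin F T, (1 + z / algebraMap F[X] L a) = 1 + cBin F T z := by
  classical
  set P : L[X] := ∏ a ∈ monicFin F T, (1 + C (algebraMap F[X] L a)⁻¹ * X) with hP
  have hPdeg : P.natDegree ≤ Fintype.card F ^ T := by
    refine (natDegree_prod_le _ _).trans ?_
    rw [← card_monicFin T, Finset.card_eq_sum_ones]
    refine Finset.sum_le_sum fun a _ => ?_
    exact (natDegree_add_le _ _).trans (by
      simpa using (natDegree_C_mul_le (algebraMap F[X] L a)⁻¹ X).trans natDegree_X_le)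
  have hQdeg : (1 + cBinPoly F L T).natDegree ≤ Fintype.card F ^ T :=
    (natDegree_add_le _ _).trans (by simpa using natDegree_cBinPoly_le T)
  -- Both sides have degree at most q^T and agree at the q^T + 1 points 0 and -a: the value is 1 at
  -- 0 and 0 at -a.
  set S : Finset L := insert 0 ((monicFin F T).image fun a => -algebraMap F[X] L a) with hS
  have hne : ∀ a ∈ monicFin F T, algebraMap F[X] L a ≠ 0 := fun a ha =>
    (map_ne_zero_iff _ hinj).2 (mem_monicFin.1 ha).1.ne_zero
  have hScard : S.card = Fintype.card F ^ T + 1 := by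
    rw [hS, Finset.card_insert_of_notMem, Finset.card_image_of_injective, card_monicFin]
    · exact neg_injective.comp hinj
    · simp only [Finset.mem_image, not_exists, not_and, neg_eq_zero]
      exact hne
  have hPQ : P = 1 + cBinPoly F L T := by
    refine eq_of_degrees_lt_of_eval_finset_eq S ?_ ?_ fun x hx => ?_
    · rw [hScard]
      exact degree_le_natDegree.trans_lt (by exact_mod_cast Nat.lt_succ_of_le hPdeg)
    · rw [hScard]
      exact degree_le_natDegree.trans_lt (by exact_mod_cast Nat.lt_succ_of_le hQdeg)
    · rw [hS, Finset.mem_insert, Finset.mem_image] at hx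
      rcases hx with rfl | ⟨a, ha, rfl⟩
      · simp [hP, eval_prod, eval_cBinPoly, cBin_zero]
      · rw [hP, eval_prod, Finset.prod_eq_zero ha]
        · rw [mem_monicFin] at ha
          simp [eval_cBinPoly, cBin_neg, cBin_of_monic hinj ha.1 ha.2]
        · simp [hne a ha]
  have := congrArg (eval z) hPQ
  rw [hP, eval_prod] at this
  simpa [eval_cBinPoly, div_eq_inv_mul] using this

end BinomialProduct

lemma norm_sub_le_max_norm {E : Type*} [SeminormedAddCommGroup E] [IsUltrametricDist E] (x y : E) :
    ‖x - y‖ ≤ max ‖x‖ ‖y‖ := by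
  rw [sub_eq_add_neg, ← norm_neg y]
  exact IsUltrametricDist.norm_add_le_max x (-y)

/-! ### Absolute values in `k_v` -/

section Norms

variable {F : Type*} [Field F] [Fintype F] (v : F[X]) [hv : Fact (Irreducible v)]

/-- The embedding of `A` into `k_v`. -/
abbrev toKv (a : F[X]) : Kv v := algebraMap F[X] (Kv v) a

lemma toKv_eq (a : F[X]) : toKv v a = algebraMap (RatFunc F) (Kv v) (toK a) :=
  IsScalarTower.algebraMap_apply F[X] (RatFunc F) (Kv v) a

lemma toKv_injective : Function.Injective (algebraMap F[X] (Kv v)) := by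
  rw [IsScalarTower.algebraMap_eq F[X] (RatFunc F) (Kv v)]
  exact (algebraMap (RatFunc F) (Kv v)).injective.comp (IsFractionRing.injective F[X] (RatFunc F))

lemma valued_algebraMap (x : RatFunc F) :
    Valued.v (algebraMap (RatFunc F) (Kv v) x) = (place v).valuation (RatFunc F) x :=
  HeightOneSpectrum.valuedAdicCompletion_eq_valuation' (place v) x

lemma norm_toKv_le_one (a : F[X]) : ‖toKv v a‖ ≤ 1 := by
  rw [toKv_eq, Valued.toNormedField.norm_le_one_iff (L := Kv v) (Γ₀ := ℤᵐ⁰), valued_algebraMap]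
  exact (place v).valuation_le_one a

lemma norm_toKv_lt_one_iff (a : F[X]) : ‖toKv v a‖ < 1 ↔ v ∣ a := by
  rw [toKv_eq, Valued.toNormedField.norm_lt_one_iff (L := Kv v) (Γ₀ := ℤᵐ⁰), valued_algebraMap,
    HeightOneSpectrum.valuation_lt_one_iff_mem]
  exact Ideal.mem_span_singleton

lemma norm_toKv_eq_one_iff (a : F[X]) : ‖toKv v a‖ = 1 ↔ ¬ v ∣ a := by
  rw [← norm_toKv_lt_one_iff, not_lt]
  exact ⟨fun h => h.ge, fun h => le_antisymm (norm_toKv_le_one v a) h⟩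

lemma norm_v_lt_one : ‖toKv v v‖ < 1 := (norm_toKv_lt_one_iff v v).2 dvd_rfl

lemma norm_v_pos : 0 < ‖toKv v v‖ :=
  norm_pos_iff.2 ((map_ne_zero_iff _ (toKv_injective v)).2 hv.out.ne_zero)

lemma v_dvd_of_degree_lt {a : F[X]} (h : v ∣ a) (hd : a.degree < v.natDegree) : a = 0 := by
  refine eq_zero_of_dvd_of_degree_lt h ?_
  rwa [degree_eq_natDegree hv.out.ne_zero]

/-- The denominator is prime to v, so a Bézout relation inverts it modulo v^M. -/
lemma exists_norm_sub_le_of_ratFunc (x : RatFunc F) (hx : ‖algebraMap (RatFunc F) (Kv v) x‖ ≤ 1)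
    (M : ℕ) : ∃ b : F[X], ‖algebraMap (RatFunc F) (Kv v) x - toKv v b‖ ≤ ‖toKv v v‖ ^ M := by
  have hden0 : toKv v x.denom ≠ 0 :=
    (map_ne_zero_iff _ (toKv_injective v)).2 x.denom_ne_zero
  have hx' : algebraMap (RatFunc F) (Kv v) x = toKv v x.num / toKv v x.denom := by
    rw [toKv_eq, toKv_eq, ← map_div₀, x.num_div_denom]
  have hden : ¬ v ∣ x.denom := by
    intro h
    have h1 : ‖toKv v x.num‖ < 1 := by
      have : toKv v x.num = algebraMap (RatFunc F) (Kv v) x * toKv v x.denom := by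
        rw [hx', div_mul_cancel₀ _ hden0]
      rw [this, norm_mul]
      exact (mul_le_of_le_one_left (norm_nonneg _) hx).trans_lt ((norm_toKv_lt_one_iff v _).2 h)
    have h2 := (norm_toKv_lt_one_iff v _).1 h1
    exact hv.out.not_isUnit (x.isCoprime_num_denom.isUnit_of_dvd' h2 h)
  have hcop : IsCoprime (x.denom) (v ^ M) :=
    ((hv.out.coprime_iff_not_dvd.2 hden).symm).pow_right
  obtain ⟨a, c, hac⟩ := hcop
  refine ⟨x.num * a, ?_⟩
  have key : algebraMap (RatFunc F) (Kv v) x - toKv v (x.num * a) =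
      toKv v x.num * toKv v c * toKv v v ^ M / toKv v x.denom := by
    have hac' := congrArg (algebraMap F[X] (Kv v)) hac
    simp only [map_add, map_mul, map_pow, map_one] at hac'
    rw [hx', eq_div_iff hden0, sub_mul, div_mul_cancel₀ _ hden0]
    simp only [toKv, map_mul] at *
    linear_combination -(algebraMap F[X] (Kv v) x.num) * hac'
  rw [key, norm_div, (norm_toKv_eq_one_iff v _).2 hden, div_one, norm_mul, norm_mul, norm_pow]
  refine mul_le_of_le_one_left (by positivity) ?_
  exact mul_le_one₀ (norm_toKv_le_one v _) (norm_nonneg _) (norm_toKv_le_one v _)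

lemma exists_norm_sub_le {x : Kv v} (hx : ‖x‖ ≤ 1) (M : ℕ) :
    ∃ b : F[X], ‖x - toKv v b‖ ≤ ‖toKv v v‖ ^ M := by
  have hpos : 0 < ‖toKv v v‖ ^ M := pow_pos (norm_v_pos v) M
  obtain ⟨r, hr⟩ := (HeightOneSpectrum.denseRange_algebraMap (RatFunc F) (place v)).exists_dist_lt x hpos
  rw [dist_eq_norm] at hr
  have hr1 : ‖algebraMap (RatFunc F) (Kv v) r‖ ≤ 1 := by
    have : algebraMap (RatFunc F) (Kv v) r = x - (x - algebraMap (RatFunc F) (Kv v) r) := by ring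
    rw [this]
    refine (norm_sub_le_max_norm _ _).trans (max_le hx (hr.le.trans ?_))
    exact pow_le_one₀ (norm_nonneg _) (norm_v_lt_one v).le
  obtain ⟨b, hb⟩ := exists_norm_sub_le_of_ratFunc v r hr1 M
  refine ⟨b, ?_⟩
  have : x - toKv v b = (x - algebraMap (RatFunc F) (Kv v) r) +
    (algebraMap (RatFunc F) (Kv v) r - toKv v b) := by ring
  rw [this]
  exact (IsUltrametricDist.norm_add_le_max _ _).trans (max_le hr.le hb)

end Norms

/-! ### Absolute values of Carlitz binomial coefficients -/

section BinNorms

variable {F : Type*} [Field F] [Fintype F] (v : F[X]) [hv : Fact (Irreducible v)]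

/-- E_T(a) lies in A; the recursion `cBin_theta_mul'` contains no division. -/
lemma norm_cBin_toKv_le_one (T : ℕ) (a : F[X]) : ‖cBin F T (toKv v a)‖ ≤ 1 := by
  induction a using Polynomial.induction_on generalizing T with
  | C c =>
    cases T with
    | zero => exact norm_toKv_le_one v _
    | succ T =>
      rw [toKv, cBin_of_degree_lt (toKv_injective v)]
      · simp
      · exact degree_C_le.trans_lt (by exact_mod_cast Nat.succ_pos T)
  | add p r hp hr =>
    rw [toKv, map_add, cBin_add]
    exact (IsUltrametricDist.norm_add_le_max _ _).trans (max_le (hp T) (hr T))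
  | monomial n c ih =>
    have h' : (C c * X ^ (n + 1) : F[X]) = X * (C c * X ^ n) := by ring
    cases T with
    | zero => exact norm_toKv_le_one v _
    | succ T =>
      rw [h', toKv, map_mul, cBin_theta_mul' (toKv_injective v)]
      refine (IsUltrametricDist.norm_add_le_max _ _).trans (max_le ?_ ?_)
      · rw [norm_mul]
        exact mul_le_one₀ (norm_toKv_le_one v X) (norm_nonneg _) (ih _)
      · rw [norm_pow]
        exact pow_le_one₀ (norm_nonneg _) (ih _)

lemma continuous_cBin (T : ℕ) : Continuous (cBin F T : Kv v → Kv v) := by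
  have : (cBin F T : Kv v → Kv v) = fun z => (cBinPoly F (Kv v) T).eval z :=
    funext fun z => (eval_cBinPoly T z).symm
  rw [this]
  exact (cBinPoly F (Kv v) T).continuous

/-- E_T is additive and continuous, and integral on A, which is dense in A_v. -/
lemma norm_cBin_le_one (T : ℕ) {x : Kv v} (hx : ‖x‖ ≤ 1) : ‖cBin F T x‖ ≤ 1 := by
  have hc := (continuous_cBin v T).tendsto 0
  rw [cBin_zero, Metric.tendsto_nhds_nhds] at hc
  obtain ⟨δ, hδ, hδ'⟩ := hc 1 one_pos
  obtain ⟨M, hM⟩ := exists_pow_lt_of_lt_one hδ (norm_v_lt_one v)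
  obtain ⟨b, hb⟩ := exists_norm_sub_le v hx M
  have : x = toKv v b + (x - toKv v b) := by ring
  rw [this, cBin_add]
  refine (IsUltrametricDist.norm_add_le_max _ _).trans (max_le (norm_cBin_toKv_le_one v T b) ?_)
  have h2 := hδ' (x := x - toKv v b) (by rw [dist_zero_right]; exact hb.trans_lt hM)
  rw [dist_zero_right] at h2
  exact h2.le

/-- An irreducible divisor of X^(q^k) - X has degree dividing k, and 0 < T + 1 < d. -/
lemma norm_theta_pow_sub {T : ℕ} (hT : T + 1 < v.natDegree) :
    ‖toKv v X ^ Fintype.card F ^ (T + 1) - toKv v X‖ = 1 := by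
  rw [toKv, ← map_pow, ← map_sub, norm_toKv_eq_one_iff, ← Nat.card_eq_fintype_card]
  intro h
  have := hv.out.natDegree_dvd_of_dvd_X_pow_card_pow_sub_X h
  exact absurd (Nat.le_of_dvd (Nat.succ_pos T) this) (by omega)

/-- For T < d every denominator met in the recursion is a v-adic unit. Applied to x = v, it gives
the congruence between C_v and τ^d modulo v. -/
lemma norm_cBin_le_norm {T : ℕ} (hT : T < v.natDegree) {x : Kv v} (hx : ‖x‖ ≤ 1) :
    ‖cBin F T x‖ ≤ ‖x‖ := by
  induction T with
  | zero => exact le_rfl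
  | succ T ih =>
    have ih := ih (by omega)
    rw [cBin_succ, norm_div, norm_theta_pow_sub v hT, div_one]
    refine (norm_sub_le_max_norm _ _).trans (max_le ?_ ih)
    rw [norm_pow]
    exact (pow_le_of_le_one (norm_nonneg _) (ih.trans hx) Fintype.card_ne_zero).trans ih

lemma norm_pow_card_le {c : ℝ} (h0 : 0 ≤ c) (h1 : c < 1) {i T : ℕ} (h : T ≤ i) :
    c ^ Fintype.card F ^ i ≤ c ^ T :=
  pow_le_pow_of_le_one h0 h1.le (h.trans (Nat.lt_pow_self Fintype.one_lt_card).le)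

variable (hmon : v.Monic)
include hmon

/-- In the expansion of `cBin_mul` the index i = T contributes E_T(x), since E_d(v) = 1 for monic v.
Indices i < T involve E_j(v) with j > d, which vanish. Indices i > T involve E_j(v)^(q^i) with j <
d, divisible by v^(q^i), and q^i exceeds T + 1. -/
lemma norm_cBin_v_mul_sub (T : ℕ) {x : Kv v} (hx : ‖x‖ ≤ 1) :
    ‖cBin F (T + v.natDegree) (toKv v v * x) - cBin F T x‖ ≤ ‖toKv v v‖ ^ (T + 1) := by
  rw [toKv, cBin_mul (toKv_injective v)]
  rw [← Finset.sum_erase_add _ _ (show T ∈ Finset.range (T + v.natDegree + 1) by simp)]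
  rw [Nat.add_sub_cancel_left, cBin_of_monic (toKv_injective v) hmon rfl, one_pow, mul_one,
    add_sub_cancel_right]
  refine IsUltrametricDist.norm_sum_le_of_forall_le_of_nonneg (by positivity) fun i hi => ?_
  rw [Finset.mem_erase, Finset.mem_range] at hi
  rw [norm_mul, norm_pow]
  rcases lt_or_gt_of_ne hi.1 with h | h
  · rw [cBin_of_degree_lt (toKv_injective v)]
    · rw [norm_zero, zero_pow (by positivity), mul_zero]
      positivity
    · rw [degree_eq_natDegree hv.out.ne_zero]
      exact_mod_cast (by omega)
  · refine (mul_le_of_le_one_left (by positivity) (norm_cBin_le_one v i hx)).trans ?_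
    refine le_trans ?_ (norm_pow_card_le (F := F) (norm_nonneg _) (norm_v_lt_one v) h)
    gcongr
    exact norm_cBin_le_norm v (by omega) (norm_toKv_le_one v v)

omit hmon in
lemma norm_cBin_v_mul_le {T : ℕ} (hT : T < v.natDegree) {x : Kv v} (hx : ‖x‖ ≤ 1) :
    ‖cBin F T (toKv v v * x)‖ ≤ ‖toKv v v‖ := by
  have h1 : ‖toKv v v * x‖ ≤ ‖toKv v v‖ := by
    rw [norm_mul]
    exact mul_le_of_le_one_right (norm_nonneg _) hx
  exact (norm_cBin_le_norm v hT (h1.trans (norm_v_lt_one v).le)).trans h1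

omit hmon in
lemma norm_v_pow_mul_le_one (l : ℕ) {x : Kv v} (hx : ‖x‖ ≤ 1) : ‖toKv v v ^ l * x‖ ≤ 1 := by
  rw [norm_mul, norm_pow]
  exact mul_le_one₀ (pow_le_one₀ (norm_nonneg _) (norm_v_lt_one v).le) (norm_nonneg _) hx

lemma norm_cBin_v_pow_mul_sub (T l : ℕ) {x : Kv v} (hx : ‖x‖ ≤ 1) :
    ‖cBin F (T + v.natDegree * l) (toKv v v ^ l * x) - cBin F T x‖ ≤ ‖toKv v v‖ ^ (T + 1) := by
  induction l with
  | zero => simp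
  | succ l ih =>
    have h := norm_cBin_v_mul_sub v hmon (T + v.natDegree * l) (norm_v_pow_mul_le_one v l hx)
    rw [← mul_assoc, ← pow_succ', add_assoc, ← Nat.mul_succ] at h
    rw [← sub_add_sub_cancel _ (cBin F (T + v.natDegree * l) (toKv v v ^ l * x))]
    refine (IsUltrametricDist.norm_add_le_max _ _).trans (max_le (h.trans ?_) ih)
    exact pow_le_pow_of_le_one (norm_nonneg _) (norm_v_lt_one v).le (by omega)

/-- Modulo v each factor v lowers the index by d. As T < dl, the index falls below d while a factor
v is still left, and `norm_cBin_v_mul_le` applies. -/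
lemma norm_cBin_v_pow_mul_le {T l : ℕ} (hT : T < v.natDegree * l) {x : Kv v} (hx : ‖x‖ ≤ 1) :
    ‖cBin F T (toKv v v ^ l * x)‖ ≤ ‖toKv v v‖ := by
  induction l generalizing T with
  | zero => omega
  | succ l ih =>
    rw [pow_succ', mul_assoc]
    rcases lt_or_ge T v.natDegree with h | h
    · exact norm_cBin_v_mul_le v h (norm_v_pow_mul_le_one v l hx)
    · obtain ⟨T, rfl⟩ := Nat.exists_eq_add_of_le' h
      have h1 := norm_cBin_v_mul_sub v hmon T (norm_v_pow_mul_le_one v l hx)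
      rw [← sub_add_cancel (cBin F (T + v.natDegree) (toKv v v * (toKv v v ^ l * x)))
        (cBin F T (toKv v v ^ l * x))]
      refine (IsUltrametricDist.norm_add_le_max _ _).trans (max_le (h1.trans ?_) (ih ?_))
      · exact pow_le_of_le_one (norm_nonneg _) (norm_v_lt_one v).le (Nat.succ_ne_zero T)
      · rw [Nat.mul_succ] at hT; omega

end BinNorms

/-! ### Limits of Carlitz binomial coefficients -/

section Limits

variable {F : Type*} [Field F] [Fintype F] (v : F[X]) [hv : Fact (Irreducible v)]

/-- The integral elements of `(v ^ l - 1)⁻¹ A` in `k_v`. -/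
def IsFrac (l : ℕ) (x : Kv v) : Prop := ‖x‖ ≤ 1 ∧ ∃ b : F[X], toKv v v ^ l * x = x + toKv v b

variable {v}

lemma IsFrac.add {l : ℕ} {x y : Kv v} (hx : IsFrac v l x) (hy : IsFrac v l y) :
    IsFrac v l (x + y) := by
  obtain ⟨hx1, b, hb⟩ := hx
  obtain ⟨hy1, c, hc⟩ := hy
  refine ⟨(IsUltrametricDist.norm_add_le_max _ _).trans (max_le hx1 hy1), b + c, ?_⟩
  simp only [toKv, map_add] at *
  linear_combination hb + hc

lemma IsFrac.mul {l : ℕ} {x : Kv v} (hx : IsFrac v l x) (a : F[X]) :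
    IsFrac v l (toKv v a * x) := by
  obtain ⟨hx1, b, hb⟩ := hx
  refine ⟨?_, a * b, ?_⟩
  · rw [norm_mul]
    exact mul_le_one₀ (norm_toKv_le_one v a) (norm_nonneg _) hx1
  · simp only [toKv, map_mul] at *
    linear_combination algebraMap F[X] (Kv v) a * hb

lemma IsFrac.toKv (l : ℕ) (a : F[X]) : IsFrac v l (toKv v a) :=
  ⟨norm_toKv_le_one v a, (v ^ l - 1) * a, by simp only [GeoGauss.toKv, map_mul, map_sub, map_pow, map_one]; ring⟩

variable (v) in
/-- The limit of `E_T(x)` for `T → ∞` in the class of `s` modulo `d l`. -/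
def cLim (l s : ℕ) (x : Kv v) : Kv v :=
  limUnder atTop fun j : ℕ => cBin F (s + v.natDegree * l * j) x

lemma cBin_toKv_eventually (a : F[X]) : ∀ᶠ T in atTop, cBin F T (GeoGauss.toKv v a) = 0 := by
  filter_upwards [eventually_gt_atTop a.natDegree] with T hT
  exact cBin_of_degree_lt (toKv_injective v) (degree_le_natDegree.trans_lt (by exact_mod_cast hT))

lemma tendsto_progression {m : ℕ} (hm : m ≠ 0) (s : ℕ) :
    Tendsto (fun j : ℕ => s + m * j) atTop atTop :=
  tendsto_atTop_mono (fun j => (Nat.le_mul_of_pos_left j (Nat.pos_of_ne_zero hm)).trans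
    (Nat.le_add_left _ _)) tendsto_id

variable (hmon : v.Monic) {l : ℕ} (hl : l ≠ 0)
include hmon hl

/-- Since v^l x = x + b and E_T(b) = 0 for large T, `norm_cBin_v_pow_mul_sub` bounds consecutive
differences by |v|^(T+1). In a complete ultrametric field that suffices. -/
lemma tendsto_cLim (s : ℕ) {x : Kv v} (hx : IsFrac v l x) :
    Tendsto (fun j : ℕ => cBin F (s + v.natDegree * l * j) x) atTop (𝓝 (cLim v l s x)) := by
  have hm : v.natDegree * l ≠ 0 := mul_ne_zero hv.out.natDegree_pos.ne' hl
  refine tendsto_nhds_limUnder (cauchySeq_tendsto_of_complete ?_)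
  refine NonarchimedeanAddGroup.cauchySeq_of_tendsto_sub_nhds_zero ?_
  obtain ⟨hx1, b, hb⟩ := hx
  have hz : ∀ᶠ j : ℕ in atTop,
      ‖cBin F (s + v.natDegree * l * (j + 1)) x - cBin F (s + v.natDegree * l * j) x‖ ≤
        ‖toKv v v‖ ^ (s + v.natDegree * l * j + 1) := by
    filter_upwards [((tendsto_progression hm s).comp (tendsto_add_atTop_nat 1)).eventually
      (cBin_toKv_eventually (v := v) b)] with j hj
    have h := norm_cBin_v_pow_mul_sub v hmon (s + v.natDegree * l * j) l hx1
    rw [hb, cBin_add] at h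
    simp only [Function.comp] at hj
    rw [show s + v.natDegree * l * j + v.natDegree * l = s + v.natDegree * l * (j + 1) by ring,
      hj, add_zero] at h
    exact h
  refine squeeze_zero_norm' hz ?_
  refine (tendsto_pow_atTop_nhds_zero_of_lt_one (norm_nonneg _) (norm_v_lt_one v)).comp ?_
  exact (tendsto_add_atTop_nat 1).comp (tendsto_progression hm s)

lemma cLim_add_period (s : ℕ) {x : Kv v} (hx : IsFrac v l x) :
    cLim v l (s + v.natDegree * l) x = cLim v l s x := by
  refine tendsto_nhds_unique (tendsto_cLim hmon hl _ hx) ?_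
  refine ((tendsto_cLim hmon hl s hx).comp (tendsto_add_atTop_nat 1)).congr fun j => ?_
  simp only [Function.comp]
  congr 1
  ring

lemma cLim_add (s : ℕ) {x y : Kv v} (hx : IsFrac v l x) (hy : IsFrac v l y) :
    cLim v l s (x + y) = cLim v l s x + cLim v l s y := by
  refine tendsto_nhds_unique (tendsto_cLim hmon hl _ (hx.add hy)) ?_
  refine ((tendsto_cLim hmon hl s hx).add (tendsto_cLim hmon hl s hy)).congr fun j => ?_
  rw [cBin_add]

lemma cLim_const_mul (s : ℕ) (c : F) {x : Kv v} (hx : IsFrac v l x) :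
    cLim v l s (toKv v (C c) * x) = toKv v (C c) * cLim v l s x := by
  refine tendsto_nhds_unique (tendsto_cLim hmon hl _ (hx.mul _)) ?_
  refine ((tendsto_cLim hmon hl s hx).const_mul (toKv v (C c))).congr fun j => ?_
  rw [toKv, cBin_const_mul]

lemma cLim_theta_mul (s : ℕ) {x : Kv v} (hx : IsFrac v l x) :
    cLim v l (s + 1) (toKv v X * x) =
      toKv v X * cLim v l (s + 1) x + cLim v l s x ^ Fintype.card F := by
  refine tendsto_nhds_unique (tendsto_cLim hmon hl _ (hx.mul _)) ?_
  refine (((tendsto_cLim hmon hl (s + 1) hx).const_mul (toKv v X)).add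
    ((tendsto_cLim hmon hl s hx).pow _)).congr fun j => ?_
  rw [show s + 1 + v.natDegree * l * j = s + v.natDegree * l * j + 1 by ring, toKv,
    cBin_theta_mul' (toKv_injective v)]

lemma cLim_toKv (s : ℕ) (a : F[X]) : cLim v l s (toKv v a) = 0 := by
  have hm : v.natDegree * l ≠ 0 := mul_ne_zero hv.out.natDegree_pos.ne' hl
  refine tendsto_nhds_unique (tendsto_cLim hmon hl _ (IsFrac.toKv l a)) ?_
  refine tendsto_const_nhds.congr' ?_
  filter_upwards [(tendsto_progression hm s).eventually (cBin_toKv_eventually (v := v) a)] with j hj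
  exact hj.symm

/-- Modulo v, e_s(x) is minus the sum of the coefficients of C_b with index in the class of s. It
comes from adding up E_(T+dl)(x) + E_(T+dl)(b) ≡ E_T(x) along the progression, which starts from v ∣
E_s(v^l x). -/
lemma norm_cLim_add_sum_lt_one {s : ℕ} (hs : s < v.natDegree * l) {x : Kv v} (hx : ‖x‖ ≤ 1)
    {b : F[X]} (hb : toKv v v ^ l * x = x + toKv v b) {M : ℕ}
    (hM : b.degree < (v.natDegree * l * M : ℕ)) :
    ‖cLim v l s x + ∑ j ∈ Finset.range M, cBin F (s + v.natDegree * l * j) (toKv v b)‖ < 1 := by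
  -- The bound |v| is uniform in J, so a strict inequality survives the passage to the limit.
  have hfin : ∀ J : ℕ, ‖cBin F (s + v.natDegree * l * J) x +
      ∑ j ∈ Finset.range (J + 1), cBin F (s + v.natDegree * l * j) (toKv v b)‖ ≤ ‖toKv v v‖ := by
    intro J
    induction J with
    | zero =>
      have := norm_cBin_v_pow_mul_le v hmon hs hx
      rw [hb, cBin_add] at this
      simpa using this
    | succ J ih =>
      have h := norm_cBin_v_pow_mul_sub v hmon (s + v.natDegree * l * J) l hx
      rw [hb, cBin_add,
        show s + v.natDegree * l * J + v.natDegree * l = s + v.natDegree * l * (J + 1) by ring] at h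
      have e : cBin F (s + v.natDegree * l * (J + 1)) x +
          ∑ j ∈ Finset.range (J + 1 + 1), cBin F (s + v.natDegree * l * j) (toKv v b) =
          (cBin F (s + v.natDegree * l * (J + 1)) x +
            cBin F (s + v.natDegree * l * (J + 1)) (toKv v b) -
            cBin F (s + v.natDegree * l * J) x) +
          (cBin F (s + v.natDegree * l * J) x +
            ∑ j ∈ Finset.range (J + 1), cBin F (s + v.natDegree * l * j) (toKv v b)) := by
        rw [Finset.sum_range_succ _ (J + 1)]
        ring
      rw [e]
      refine (IsUltrametricDist.norm_add_le_max _ _).trans (max_le (h.trans ?_) ih)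
      exact pow_le_of_le_one (norm_nonneg _) (norm_v_lt_one v).le (Nat.succ_ne_zero _)
  have hlim := (tendsto_cLim hmon hl s ⟨hx, b, hb⟩).add_const
    (∑ j ∈ Finset.range M, cBin F (s + v.natDegree * l * j) (toKv v b))
  refine (le_of_tendsto hlim.norm ?_).trans_lt (norm_v_lt_one v)
  filter_upwards [eventually_ge_atTop M] with J hJ
  refine le_trans (le_of_eq ?_) (hfin J)
  congr 2
  refine Finset.sum_subset (Finset.range_mono (by omega)) fun j _ hj => ?_
  rw [Finset.mem_range, not_lt] at hj
  refine cBin_of_degree_lt (toKv_injective v) (hM.trans_le ?_)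
  exact_mod_cast (Nat.mul_le_mul_left _ hj).trans (Nat.le_add_left _ _)

end Limits

/-! ### The factors of the geometric factorial -/

section Factors

variable {F : Type*} [Field F] [Fintype F] (v : F[X]) [hv : Fact (Irreducible v)]

lemma valued_eq_one_iff (x : Kv v) : Valued.v x = (1 : ℤᵐ⁰) ↔ ‖x‖ = 1 := by
  rw [le_antisymm_iff, le_antisymm_iff, Valued.toNormedField.norm_le_one_iff (L := Kv v) (Γ₀ := ℤᵐ⁰),
    Valued.toNormedField.one_le_norm_iff (L := Kv v) (Γ₀ := ℤᵐ⁰)]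

lemma flatV_of_norm_eq_one {x : Kv v} (hx : ‖x‖ = 1) : flatV v x = x :=
  if_pos ((valued_eq_one_iff v x).2 hx)

lemma flatV_of_norm_ne_one {x : Kv v} (hx : ‖x‖ ≠ 1) : flatV v x = 1 :=
  if_neg fun h => hx ((valued_eq_one_iff v x).1 h)

lemma norm_flatV (x : Kv v) : ‖flatV v x‖ = 1 := by
  by_cases hx : ‖x‖ = 1
  · rw [flatV_of_norm_eq_one v hx, hx]
  · rw [flatV_of_norm_ne_one v hx, norm_one]

lemma flatV_ne_zero (x : Kv v) : flatV v x ≠ 0 := by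
  rw [← norm_ne_zero_iff, norm_flatV]
  exact one_ne_zero

lemma flatV_algebraMap (x : RatFunc F) : flatV v (algebraMap (RatFunc F) (Kv v) x) =
    algebraMap (RatFunc F) (Kv v) (flat ((place v).valuation (RatFunc F)) x) := by
  unfold flatV flat
  rw [valued_algebraMap]
  split_ifs <;> simp

lemma geoFactor_eq (x : Kv v) (t : ℕ) :
    geoFactor v x t = ∏ a ∈ monicFin F t, flatV v (toKv v a) / flatV v (x + toKv v a) :=
  finprod_monicDeg t _

lemma ariFactor_eq (t : ℕ) : ariFactor v t = -∏ a ∈ monicFin F t, flatV v (toKv v a) :=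
  congrArg _ (finprod_monicDeg t _)

lemma norm_geoFactor (x : Kv v) (t : ℕ) : ‖geoFactor v x t‖ = 1 := by
  rw [geoFactor_eq, norm_prod]
  exact Finset.prod_eq_one fun a _ => by rw [norm_div, norm_flatV, norm_flatV, div_one]

lemma norm_ariFactor (t : ℕ) : ‖ariFactor v t‖ = 1 := by
  rw [ariFactor_eq, norm_neg, norm_prod]
  exact Finset.prod_eq_one fun a _ => norm_flatV v _

lemma norm_prod_sub_one_le {ι : Type*} (s : Finset ι) (f : ι → Kv v) {c : ℝ} (hc : 0 ≤ c)
    (h1 : ∀ i ∈ s, ‖f i‖ = 1) (h : ∀ i ∈ s, ‖f i - 1‖ ≤ c) : ‖∏ i ∈ s, f i - 1‖ ≤ c := by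
  classical
  induction s using Finset.induction_on with
  | empty => simpa using hc
  | insert i s hi ih =>
    rw [Finset.prod_insert hi]
    have e : f i * ∏ j ∈ s, f j - 1 = f i * (∏ j ∈ s, f j - 1) + (f i - 1) := by ring
    rw [e]
    refine (IsUltrametricDist.norm_add_le_max _ _).trans (max_le ?_ (h i (by simp)))
    rw [norm_mul, h1 i (by simp), one_mul]
    exact ih (fun j hj => h1 j (by simp [hj])) fun j hj => h j (by simp [hj])

/-- Elements at distance less than 1 are both units or both non-units. -/
lemma norm_flatV_div_sub_one_le {x y : Kv v} {c : ℝ} (hc0 : 0 ≤ c) (hc1 : c < 1)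
    (h : ‖x - y‖ ≤ c) (hx : ‖x‖ ≤ 1) : ‖flatV v x / flatV v y - 1‖ ≤ c := by
  have hlt : ‖x - y‖ < 1 := h.trans_lt hc1
  by_cases hx1 : ‖x‖ = 1
  · have hy1 : ‖y‖ = 1 := by
      rw [← hx1, eq_comm]
      exact IsUltrametricDist.norm_eq_of_add_norm_lt_max (x := x) (y := -y) (by
        rw [← sub_eq_add_neg, hx1]
        exact hlt.trans_le (le_max_left _ _)) |>.trans (norm_neg y)
    have hy0 : y ≠ 0 := norm_ne_zero_iff.1 (by rw [hy1]; exact one_ne_zero)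
    rw [flatV_of_norm_eq_one v hx1, flatV_of_norm_eq_one v hy1, div_sub_one hy0, norm_div, hy1,
      div_one]
    exact h
  · have hy1 : ‖y‖ ≠ 1 := by
      have hx2 : ‖x‖ < 1 := lt_of_le_of_ne hx hx1
      have e : y = x - (x - y) := by ring
      rw [e]
      exact ((norm_sub_le_max_norm _ _).trans_lt (max_lt hx2 hlt)).ne
    rw [flatV_of_norm_ne_one v hx1, flatV_of_norm_ne_one v hy1, div_one, sub_self, norm_zero]
    exact hc0

/-- Take b in A close to x. Once t > deg b, translation by b permutes the monic polynomials of
degree t, so a^♭ may be replaced by (a + b)^♭ in the numerators, and every quotient (a + b)^♭/(x +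
a)^♭ is close to 1. -/
lemma tendsto_geoFactor {x : Kv v} (hx : ‖x‖ ≤ 1) : Tendsto (geoFactor v x) atTop (𝓝 1) := by
  rw [Metric.tendsto_nhds]
  intro ε hε
  obtain ⟨M, hM⟩ := exists_pow_lt_of_lt_one hε (norm_v_lt_one v)
  obtain ⟨b, hb⟩ := exists_norm_sub_le v hx (M + 1)
  have hc1 : ‖toKv v v‖ ^ (M + 1) < 1 :=
    pow_lt_one₀ (norm_nonneg _) (norm_v_lt_one v) (Nat.succ_ne_zero M)
  filter_upwards [eventually_gt_atTop b.natDegree] with t ht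
  have hbt : b.degree < t := degree_le_natDegree.trans_lt (by exact_mod_cast ht)
  rw [dist_eq_norm, geoFactor_eq, Finset.prod_div_distrib,
    ← prod_monicFin_add (fun a => flatV v (toKv v a)) hbt, ← Finset.prod_div_distrib]
  refine lt_of_le_of_lt (norm_prod_sub_one_le v _ _ (by positivity) (fun a _ => ?_)
    fun a _ => norm_flatV_div_sub_one_le v (by positivity) hc1 ?_ (norm_toKv_le_one v _))
    ((pow_le_pow_of_le_one (norm_nonneg _) (norm_v_lt_one v).le (Nat.le_succ M)).trans_lt hM)
  · rw [norm_div, norm_flatV, norm_flatV, div_one]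
  · rw [norm_sub_rev]
    refine le_trans (le_of_eq ?_) hb
    congr 1
    simp only [toKv, map_add]
    ring

/-! ### Infinite products -/

variable {v}

lemma norm_pow_sub_one_le {x : Kv v} (hx : ‖x‖ = 1) (c : ℕ) : ‖x ^ c - 1‖ ≤ ‖x - 1‖ := by
  have := norm_prod_sub_one_le v (Finset.range c) (fun _ => x) (norm_nonneg (x - 1))
    (fun _ _ => hx) fun _ _ => le_rfl
  simpa using this

lemma tendsto_pow_one {f : ℕ → Kv v} (hf : ∀ i, ‖f i‖ = 1) (h : Tendsto f atTop (𝓝 1))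
    (c : ℕ → ℕ) : Tendsto (fun i => f i ^ c i) atTop (𝓝 1) := by
  rw [tendsto_iff_norm_sub_tendsto_zero] at h ⊢
  exact squeeze_zero (fun _ => norm_nonneg _) (fun i => norm_pow_sub_one_le (hf i) (c i)) h

/-- The infinite product `∏ f i`. -/
def infProd (f : ℕ → Kv v) : Kv v := limUnder atTop fun N : ℕ => ∏ i ∈ Finset.range N, f i

lemma tendsto_infProd {f : ℕ → Kv v} (hf : ∀ i, ‖f i‖ = 1) (h : Tendsto f atTop (𝓝 1)) :
    Tendsto (fun N : ℕ => ∏ i ∈ Finset.range N, f i) atTop (𝓝 (infProd f)) := by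
  refine tendsto_nhds_limUnder (cauchySeq_tendsto_of_complete ?_)
  refine NonarchimedeanAddGroup.cauchySeq_of_tendsto_sub_nhds_zero ?_
  rw [tendsto_iff_norm_sub_tendsto_zero] at h
  refine squeeze_zero_norm (fun N => ?_) h
  rw [Finset.prod_range_succ, ← mul_sub_one, norm_mul, norm_prod,
    Finset.prod_eq_one fun i _ => hf i, one_mul]

lemma norm_infProd {f : ℕ → Kv v} (hf : ∀ i, ‖f i‖ = 1) (h : Tendsto f atTop (𝓝 1)) :
    ‖infProd f‖ = 1 := by
  refine tendsto_nhds_unique (tendsto_infProd hf h).norm ?_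
  refine tendsto_const_nhds.congr fun N => ?_
  rw [norm_prod, Finset.prod_eq_one fun i _ => hf i]

lemma infProd_ne_zero {f : ℕ → Kv v} (hf : ∀ i, ‖f i‖ = 1) (h : Tendsto f atTop (𝓝 1)) :
    infProd f ≠ 0 := by
  rw [← norm_ne_zero_iff, norm_infProd hf h]
  exact one_ne_zero

lemma prod_range_mul_eq {M : Type*} [CommMonoid M] (g : ℕ → M) (m J : ℕ) :
    ∏ i ∈ Finset.range (m * J), g i =
      ∏ s ∈ Finset.range m, ∏ j ∈ Finset.range J, g (s + m * j) := by
  induction J with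
  | zero => simp
  | succ J ih =>
    rw [Nat.mul_succ, Finset.prod_range_add, ih, ← Finset.prod_mul_distrib]
    refine Finset.prod_congr rfl fun s _ => ?_
    rw [Finset.prod_range_succ, add_comm]

/-- The product of `f` over the arithmetic progression `s + m ℕ`. -/
def progProd (f : ℕ → Kv v) (m s : ℕ) : Kv v := infProd fun j => f (s + m * j)

lemma tendsto_progProd {f : ℕ → Kv v} (hf : ∀ i, ‖f i‖ = 1) (h : Tendsto f atTop (𝓝 1)) {m : ℕ}
    (hm : m ≠ 0) (s : ℕ) : Tendsto (fun J : ℕ => ∏ j ∈ Finset.range J, f (s + m * j)) atTop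
      (𝓝 (progProd f m s)) :=
  tendsto_infProd (fun _ => hf _) (h.comp (tendsto_progression hm s))

lemma progProd_ne_zero {f : ℕ → Kv v} (hf : ∀ i, ‖f i‖ = 1) (h : Tendsto f atTop (𝓝 1)) {m : ℕ}
    (hm : m ≠ 0) (s : ℕ) : progProd f m s ≠ 0 :=
  infProd_ne_zero (fun _ => hf _) (h.comp (tendsto_progression hm s))

lemma tendsto_mul_atTop {m : ℕ} (hm : m ≠ 0) : Tendsto (fun J : ℕ => m * J) atTop atTop := by
  simpa using tendsto_progression hm 0

lemma infProd_pow_eq {f : ℕ → Kv v} (hf : ∀ i, ‖f i‖ = 1) (h : Tendsto f atTop (𝓝 1)) {m : ℕ}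
    (hm : m ≠ 0) (c : ℕ → ℕ) (hc : ∀ s < m, ∀ j, c (s + m * j) = c s) :
    infProd (fun i => f i ^ c i) = ∏ s ∈ Finset.range m, progProd f m s ^ c s := by
  have h1 := (tendsto_infProd (f := fun i => f i ^ c i) (fun i => by rw [norm_pow, hf, one_pow])
    (tendsto_pow_one hf h c)).comp (tendsto_mul_atTop hm)
  refine tendsto_nhds_unique h1 ?_
  refine (tendsto_finsetProd (Finset.range m) fun s _ =>
    (tendsto_progProd hf h hm s).pow (c s)).congr fun J => ?_
  simp only [Function.comp]
  rw [prod_range_mul_eq]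
  refine Finset.prod_congr rfl fun s hs => ?_
  rw [← Finset.prod_pow]
  refine Finset.prod_congr rfl fun j _ => ?_
  rw [hc s (Finset.mem_range.1 hs)]

lemma infProd_eq_prod_progProd {f : ℕ → Kv v} (hf : ∀ i, ‖f i‖ = 1) (h : Tendsto f atTop (𝓝 1))
    {m : ℕ} (hm : m ≠ 0) : infProd f = ∏ s ∈ Finset.range m, progProd f m s := by
  simpa using infProd_pow_eq hf h hm (fun _ => 1) fun _ _ _ => rfl

end Factors

/-! ### Telescoping -/

section Telescope

variable {F : Type*} [Field F] [Fintype F] {v : F[X]} [hv : Fact (Irreducible v)]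

open Classical in
/-- The complementary factor to `x^♭`. -/
def coflat (x : Kv v) : Kv v := if ‖x‖ = 1 then 1 else x

lemma flatV_mul_coflat (x : Kv v) : flatV v x * coflat x = x := by
  unfold coflat
  split_ifs with h
  · rw [flatV_of_norm_eq_one v h, mul_one]
  · rw [flatV_of_norm_ne_one v h, one_mul]

/-- 1 + E_t(Y) is the product of the (Y + a)/a; the factor of Π cancels the unit numerators and
denominators and leaves the others. -/
lemma geoFactor_mul_one_add_cBin (Y : Kv v) (t : ℕ) :
    geoFactor v Y t * (1 + cBin F t Y) =
      (∏ a ∈ monicFin F t, coflat (Y + toKv v a)) / ∏ a ∈ monicFin F t, coflat (toKv v a) := by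
  rw [← prod_one_add_div (toKv_injective v), geoFactor_eq, ← Finset.prod_mul_distrib,
    ← Finset.prod_div_distrib]
  refine Finset.prod_congr rfl fun a ha => ?_
  have ha0 : toKv v a ≠ 0 :=
    (map_ne_zero_iff _ (toKv_injective v)).2 (mem_monicFin.1 ha).1.ne_zero
  have h1 := flatV_mul_coflat (toKv v a)
  have h2 := flatV_mul_coflat (Y + toKv v a)
  have hf := flatV_ne_zero v (toKv v a)
  have hf' := flatV_ne_zero v (Y + toKv v a)
  have hc : coflat (toKv v a) ≠ 0 := right_ne_zero_of_mul (h1.trans_ne ha0)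
  change flatV v (toKv v a) / flatV v (Y + toKv v a) * (1 + Y / toKv v a) = _
  rw [one_add_div ha0, div_mul_div_comm, div_eq_div_iff (mul_ne_zero hf' ha0) hc]
  linear_combination (toKv v a + Y) * h1 - toKv v a * h2

/-- Y + a = v Y' + (a - c), where v Y' is not a unit. -/
lemma norm_add_toKv_eq_one_iff {Y Y' : Kv v} {c : F[X]} (hY' : ‖Y'‖ ≤ 1)
    (h : toKv v v * Y' = Y + toKv v c) (a : F[X]) : ‖Y + toKv v a‖ = 1 ↔ ¬ v ∣ a - c := by
  have e : Y + toKv v a = toKv v v * Y' + toKv v (a - c) := by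
    simp only [toKv, map_sub] at *
    linear_combination -h
  have h1 : ‖toKv v v * Y'‖ < 1 := by
    rw [norm_mul]
    exact (mul_le_of_le_one_right (norm_nonneg _) hY').trans_lt (norm_v_lt_one v)
  rw [e]
  constructor
  · intro h2 h3
    have := (IsUltrametricDist.norm_add_le_max (toKv v v * Y') (toKv v (a - c))).trans_lt
      (max_lt h1 ((norm_toKv_lt_one_iff v _).2 h3))
    exact this.ne h2
  · intro h2
    have h3 := (norm_toKv_eq_one_iff v _).2 h2
    rw [IsUltrametricDist.norm_add_eq_max_of_norm_ne_norm (by rw [h3]; exact h1.ne), h3]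
    exact max_eq_right h1.le

open Classical in
-- Both a and c have degree less than d, so v ∣ a - c only for a = c, and Y + c = v Y'.
lemma prod_coflat_of_lt {Y Y' : Kv v} {c : F[X]} (hY' : ‖Y'‖ ≤ 1) (hc : c.degree < v.natDegree)
    (h : toKv v v * Y' = Y + toKv v c) {t : ℕ} (ht : t < v.natDegree) :
    ∏ a ∈ monicFin F t, coflat (Y + toKv v a) =
      if c ∈ monicFin F t then toKv v v * Y' else 1 := by
  have key : ∀ a ∈ monicFin F t, coflat (Y + toKv v a) = if a = c then toKv v v * Y' else 1 := by
    intro a ha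
    rw [mem_monicFin] at ha
    unfold coflat
    simp only [norm_add_toKv_eq_one_iff hY' h]
    have had : (a - c).degree < v.natDegree := by
      refine (degree_sub_le _ _).trans_lt (max_lt ?_ hc)
      rw [degree_eq_natDegree ha.1.ne_zero, ha.2]
      exact_mod_cast ht
    by_cases hac : a = c
    · subst hac
      simp [h]
    · rw [if_pos, if_neg hac]
      intro h'
      exact hac (sub_eq_zero.1 (v_dvd_of_degree_lt v h' had))
  rw [Finset.prod_congr rfl key, Finset.prod_ite_eq']

/-- The non-unit factors are those with a = v b + c, b monic of degree t, and then Y + a = v (Y' +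
b). -/
lemma prod_coflat_add (hmon : v.Monic) {Y Y' : Kv v} {c : F[X]} (hY' : ‖Y'‖ ≤ 1)
    (hc : c.degree < v.natDegree) (h : toKv v v * Y' = Y + toKv v c) (t : ℕ) :
    ∏ a ∈ monicFin F (t + v.natDegree), coflat (Y + toKv v a) =
      ∏ a ∈ monicFin F t, toKv v v * (Y' + toKv v a) := by
  classical
  have hdeg : ∀ b ∈ monicFin F t, v * b + c ∈ monicFin F (t + v.natDegree) := by
    intro b hb
    rw [mem_monicFin] at hb
    refine monic_add_of_degree_lt (mem_monicFin.2 ⟨hmon.mul hb.1, ?_⟩) (hc.trans_le ?_)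
    · rw [hmon.natDegree_mul hb.1, hb.2, add_comm]
    · exact_mod_cast Nat.le_add_left _ _
  symm
  refine Finset.prod_of_injOn (fun b => v * b + c) ?_ (fun b hb => hdeg b hb) ?_ ?_
  · intro b _ b' _ hbb
    exact mul_left_cancel₀ hv.out.ne_zero (add_right_cancel hbb)
  · intro a ha hna
    unfold coflat
    rw [if_pos]
    rw [norm_add_toKv_eq_one_iff hY' h]
    rintro ⟨b, hb⟩
    refine hna ⟨b, ?_, by simp only [← hb]; ring⟩
    have hab : a = v * b + c := by rw [← hb]; ring
    rw [mem_monicFin] at ha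
    have hvb : v * b = a + -c := by rw [hab]; ring
    have hvb' : v * b ∈ monicFin F (t + v.natDegree) := by
      rw [hvb]
      refine monic_add_of_degree_lt (mem_monicFin.2 ha) ?_
      rw [degree_neg]
      exact hc.trans_le (by exact_mod_cast Nat.le_add_left _ _)
    rw [mem_monicFin] at hvb'
    have hbm : b.Monic := hmon.of_mul_monic_left hvb'.1
    refine mem_monicFin.2 ⟨hbm, ?_⟩
    have := hvb'.2
    rw [hmon.natDegree_mul hbm] at this
    omega
  · intro b _
    unfold coflat
    have e : Y + toKv v (v * b + c) = toKv v v * (Y' + toKv v b) := by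
      simp only [toKv, map_add, map_mul] at *
      linear_combination -h
    rw [if_neg, e]
    rw [norm_add_toKv_eq_one_iff hY' h]
    simp

open Classical in
lemma geoFactor_mul_of_lt {Y Y' : Kv v} {c : F[X]} (hY' : ‖Y'‖ ≤ 1) (hc : c.degree < v.natDegree)
    (h : toKv v v * Y' = Y + toKv v c) {t : ℕ} (ht : t < v.natDegree) :
    geoFactor v Y t * (1 + cBin F t Y) = if c ∈ monicFin F t then toKv v v * Y' else 1 := by
  -- The denominators are the case Y = Y' = c = 0; the polynomial 0 is not monic, so they contribute
  -- 1.
  have h0 := prod_coflat_of_lt (v := v) (Y := 0) (Y' := 0) (c := 0) (by simp) (by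
    rw [degree_zero]; exact WithBot.bot_lt_coe _) (by simp [toKv]) ht
  rw [if_neg (by simp [mem_monicFin])] at h0
  simp only [zero_add] at h0
  rw [geoFactor_mul_one_add_cBin, prod_coflat_of_lt hY' hc h ht, h0, div_one]

/-- The numerator is the product of the v (Y' + b) and the denominator, the case Y = 0, that of the
v b. The powers of v cancel and the product formula applies again. -/
lemma geoFactor_mul_add (hmon : v.Monic) {Y Y' : Kv v} {c : F[X]} (hY' : ‖Y'‖ ≤ 1)
    (hc : c.degree < v.natDegree) (h : toKv v v * Y' = Y + toKv v c) (t : ℕ) :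
    geoFactor v Y (t + v.natDegree) * (1 + cBin F (t + v.natDegree) Y) = 1 + cBin F t Y' := by
  have h0 := prod_coflat_add (v := v) hmon (Y := 0) (Y' := 0) (c := 0) (by simp) (by
    rw [degree_zero]; exact WithBot.bot_lt_coe _) (by simp [toKv]) t
  simp only [zero_add] at h0
  rw [geoFactor_mul_one_add_cBin, prod_coflat_add hmon hY' hc h, h0, ← Finset.prod_div_distrib,
    ← prod_one_add_div (toKv_injective v)]
  refine Finset.prod_congr rfl fun a ha => ?_
  have ha0 : toKv v a ≠ 0 :=
    (map_ne_zero_iff _ (toKv_injective v)).2 (mem_monicFin.1 ha).1.ne_zero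
  rw [mul_div_mul_left _ _ (norm_pos_iff.1 (norm_v_pos v)), one_add_div ha0, add_comm]

open Classical in
-- By `geoFactor_mul_add` each new factor turns 1 + E at one level into 1 + E at the level below, so
-- the product telescopes to the bottom level, where only the first digit c 0 matters.
lemma prod_geoFactor_mul (hmon : v.Monic) (Y : ℕ → Kv v) (hY : ∀ u, ‖Y u‖ ≤ 1) (c : ℕ → F[X])
    (hc : ∀ u, (c u).degree < v.natDegree)
    (h : ∀ u, toKv v v * Y u = Y (u + 1) + toKv v (c u)) {s : ℕ} (hs : s < v.natDegree) (U : ℕ) :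
    (∏ u ∈ Finset.range (U + 1), geoFactor v (Y (u + 1)) (s + v.natDegree * u)) *
      (1 + cBin F (s + v.natDegree * U) (Y (U + 1))) =
      if c 0 ∈ monicFin F s then toKv v v * Y 0 else 1 := by
  induction U with
  | zero => simpa using geoFactor_mul_of_lt (hY 0) (hc 0) (h 0) hs
  | succ U ih =>
    rw [Finset.prod_range_succ, mul_assoc, Nat.mul_succ, ← add_assoc,
      geoFactor_mul_add hmon (hY _) (hc _) (h _), ih]

end Telescope

/-! ### Fractional parts of elements of `(v ^ l - 1)⁻¹ A` -/

section FracInf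

variable {F : Type*} [Field F]

lemma toK_injective : Function.Injective (algebraMap F[X] (RatFunc F)) :=
  IsFractionRing.injective F[X] (RatFunc F)

lemma toK_ne_zero {a : F[X]} (ha : a ≠ 0) : toK a ≠ 0 := (map_ne_zero_iff _ toK_injective).2 ha

lemma toK_add (a b : F[X]) : toK (a + b) = toK a + toK b := map_add _ a b

lemma toK_sub (a b : F[X]) : toK (a - b) = toK a - toK b := map_sub _ a b

lemma toK_mul (a b : F[X]) : toK (a * b) = toK a * toK b := map_mul _ a b

lemma toK_pow (a : F[X]) (n : ℕ) : toK (a ^ n) = toK a ^ n := map_pow _ a n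

lemma toK_zero : toK (0 : F[X]) = 0 := map_zero _

lemma toK_one : toK (1 : F[X]) = 1 := map_one _

lemma degree_mod_lt' (a : F[X]) {b : F[X]} (hb : b ≠ 0) : (a % b).degree < b.degree :=
  EuclideanDomain.mod_lt a hb

lemma div_toK_eq_add (a : F[X]) {b : F[X]} (hb : b ≠ 0) :
    toK a / toK b = toK (a % b) / toK b + toK (a / b) := by
  have hb' := toK_ne_zero hb
  have h := congrArg (algebraMap F[X] (RatFunc F)) (EuclideanDomain.div_add_mod a b)
  rw [map_add, map_mul] at h
  field_simp
  linear_combination -h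

lemma fracInf_add_toK (x : RatFunc F) : ∃ a : F[X], x = fracInf x + toK a :=
  ⟨x.num / x.denom, by
    unfold fracInf
    rw [← div_toK_eq_add _ x.denom_ne_zero, x.num_div_denom]⟩

/-- A difference of proper fractions has absolute value less than 1 at infinity, a nonzero
polynomial at least 1. This is the uniqueness of the fractional part. -/
lemma eq_of_div_add_toK {r r' b b' a : F[X]} (hb : b ≠ 0) (hb' : b' ≠ 0)
    (hr : r.degree < b.degree) (hr' : r'.degree < b'.degree)
    (h : toK r / toK b = toK r' / toK b' + toK a) : a = 0 := by
  have h1 := toK_ne_zero hb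
  have h2 := toK_ne_zero hb'
  have h3 : r * b' - r' * b = a * (b * b') := by
    apply toK_injective
    simp only [map_sub, map_mul]
    field_simp at h
    linear_combination h
  by_contra ha
  have hlt : (r * b' - r' * b).degree < (b * b').degree := by
    refine (degree_sub_le _ _).trans_lt (max_lt ?_ ?_)
    · rw [degree_mul, degree_mul]
      exact WithBot.add_lt_add_right (degree_ne_bot.2 hb') hr
    · rw [degree_mul, degree_mul, add_comm b.degree]
      exact WithBot.add_lt_add_right (degree_ne_bot.2 hb) hr'
  rw [h3, degree_mul (p := a)] at hlt
  have : (0 : WithBot ℕ) ≤ a.degree := zero_le_degree_iff.2 ha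
  exact absurd hlt (not_lt.2 (le_add_of_nonneg_left this))

lemma fracInf_eq {x : RatFunc F} {r b a : F[X]} (hb : b ≠ 0) (hr : r.degree < b.degree)
    (h : x = toK r / toK b + toK a) : fracInf x = toK r / toK b := by
  obtain ⟨a', ha'⟩ := fracInf_add_toK x
  have e : toK r / toK b = toK (x.num % x.denom) / toK x.denom + toK (a' - a) := by
    change _ = fracInf x + _
    rw [toK_sub]
    linear_combination ha' - h
  have := eq_of_div_add_toK hb x.denom_ne_zero hr (degree_mod_lt' _ x.denom_ne_zero) e
  rw [this, toK_zero, add_zero] at e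
  exact e.symm

lemma fracInf_eq_of_sub {x y : RatFunc F} {a : F[X]} (h : x = y + toK a) :
    fracInf x = fracInf y := by
  obtain ⟨a', ha'⟩ := fracInf_add_toK y
  refine fracInf_eq (a := a' + a) y.denom_ne_zero (degree_mod_lt' _ y.denom_ne_zero) ?_
  change x = fracInf y + _
  rw [toK_add, h]
  linear_combination ha'

end FracInf

/-! ### Periodicity and base-v digits in (v^l - 1)⁻¹ A -/

section Torsion

variable {F : Type*} [Field F] [Fintype F] {v : F[X]} [hv : Fact (Irreducible v)]

variable (v) in
/-- The elements of `(v ^ l - 1)⁻¹ A`. -/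
def IsTors (l : ℕ) (x : RatFunc F) : Prop := ∃ B : F[X], x * (toK v ^ l - 1) = toK B

variable (hmon : v.Monic) {l : ℕ} (hl : l ≠ 0)
include hmon hl

lemma monic_pow_sub_one : (v ^ l - 1).Monic ∧ (v ^ l - 1).natDegree = v.natDegree * l := by
  have h : (v ^ l).natDegree = v.natDegree * l := by rw [hmon.natDegree_pow, mul_comm]
  have h1 : (-1 : F[X]).degree < (v ^ l).degree := by
    rw [degree_neg, degree_one, degree_eq_natDegree (hmon.pow l).ne_zero, h]
    exact_mod_cast Nat.mul_pos hv.out.natDegree_pos (Nat.pos_of_ne_zero hl)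
  rw [sub_eq_add_neg]
  exact ⟨(hmon.pow l).add_of_left h1, by rw [natDegree_add_eq_left_of_degree_lt h1, h]⟩

lemma pow_sub_one_ne_zero' : v ^ l - 1 ≠ 0 := (monic_pow_sub_one hmon hl).1.ne_zero

lemma degree_pow_sub_one : (v ^ l - 1).degree = (v.natDegree * l : ℕ) := by
  rw [degree_eq_natDegree (pow_sub_one_ne_zero' hmon hl), (monic_pow_sub_one hmon hl).2]

variable {x : RatFunc F} (hx : IsTors v l x)
include hx

lemma exists_fracX_eq (i : ℕ) : ∃ r : F[X], r.degree < (v ^ l - 1).degree ∧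
    fracX v i x = toK r / toK (v ^ l - 1) := by
  obtain ⟨B, hB⟩ := hx
  have hN := pow_sub_one_ne_zero' hmon hl
  have h1 := toK_ne_zero hN
  refine ⟨(v ^ i * B) % (v ^ l - 1), degree_mod_lt' _ hN,
    fracInf_eq (a := (v ^ i * B) / (v ^ l - 1)) hN (degree_mod_lt' _ hN) ?_⟩
  rw [← div_toK_eq_add _ hN, eq_div_iff h1]
  simp only [toK, map_mul, map_pow, map_sub, map_one] at *
  rw [← hB]
  ring

lemma fracX_add_period (i : ℕ) : fracX v (i + l) x = fracX v i x := by
  obtain ⟨B, hB⟩ := hx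
  refine fracInf_eq_of_sub (a := v ^ i * B) ?_
  rw [toK_mul, toK_pow, ← hB]
  ring

lemma fracX_add_mul_period (i j : ℕ) : fracX v (i + l * j) x = fracX v i x := by
  induction j with
  | zero => rfl
  | succ j ih => rw [Nat.mul_succ, ← add_assoc, fracX_add_period hmon hl hx, ih]

lemma fracX_mod (i : ℕ) : fracX v (i % l) x = fracX v i x := by
  rw [← fracX_add_mul_period hmon hl hx (i % l) (i / l), Nat.mod_add_div]

/-- One step of long division in base v: c is the polynomial part of v ⟨v^i x⟩, whose absolute value
is less than |v|. -/
lemma exists_v_mul_fracX (i : ℕ) : ∃ c : F[X], c.degree < v.natDegree ∧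
    toK v * fracX v i x = fracX v (i + 1) x + toK c := by
  have hN := pow_sub_one_ne_zero' hmon hl
  have h1 := toK_ne_zero hN
  obtain ⟨r, hr, hr'⟩ := exists_fracX_eq hmon hl hx i
  obtain ⟨r₁, hr₁, hr₁'⟩ := exists_fracX_eq hmon hl hx (i + 1)
  obtain ⟨a, ha⟩ := fracInf_add_toK (toK v ^ i * x)
  obtain ⟨a₁, ha₁⟩ := fracInf_add_toK (toK v ^ (i + 1) * x)
  have hc : toK v * fracX v i x = fracX v (i + 1) x + toK (a₁ - v * a) := by
    unfold fracX
    rw [toK_sub, toK_mul]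
    linear_combination ha₁ - toK v * ha
  refine ⟨a₁ - v * a, ?_, hc⟩
  have e : (a₁ - v * a) * (v ^ l - 1) = v * r - r₁ := by
    apply toK_injective
    rw [hr', hr₁'] at hc
    simp only [toK, map_mul, map_sub, map_pow, map_one] at *
    field_simp at hc
    linear_combination -hc
  have hlt : ((a₁ - v * a) * (v ^ l - 1)).degree < (v.natDegree : WithBot ℕ) + (v ^ l - 1).degree := by
    rw [e]
    refine (degree_sub_le _ _).trans_lt (max_lt ?_ ?_)
    · rw [degree_mul, degree_eq_natDegree hmon.ne_zero]
      exact WithBot.add_lt_add_left WithBot.coe_ne_bot hr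
    · refine hr₁.trans_le (le_add_of_nonneg_left ?_)
      exact_mod_cast Nat.zero_le _
  rw [degree_mul] at hlt
  exact lt_of_add_lt_add_right hlt

lemma exists_v_pow_mul_fracX (i : ℕ) :
    ∃ b : F[X], toK v ^ l * fracX v i x = fracX v i x + toK b := by
  have h1 := toK_ne_zero (pow_sub_one_ne_zero' hmon hl)
  obtain ⟨r, -, hr'⟩ := exists_fracX_eq hmon hl hx i
  refine ⟨r, ?_⟩
  rw [hr']
  simp only [toK, map_sub, map_pow, map_one] at *
  field_simp
  ring

omit hmon hl hx in
lemma base_expansion_unique {a b : ℕ → F[X]} (n : ℕ) (ha : ∀ i < n, (a i).degree < v.natDegree)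
    (hb : ∀ i < n, (b i).degree < v.natDegree)
    (h : ∑ i ∈ Finset.range n, a i * v ^ i = ∑ i ∈ Finset.range n, b i * v ^ i) :
    ∀ i < n, a i = b i := by
  induction n generalizing a b with
  | zero => simp
  | succ n ih =>
    rw [Finset.sum_range_succ', Finset.sum_range_succ'] at h
    have h0 : a 0 = b 0 := by
      have hdvd : v ∣ a 0 - b 0 := by
        refine ⟨∑ i ∈ Finset.range n, (b (i + 1) - a (i + 1)) * v ^ i, ?_⟩
        have e : v * ∑ i ∈ Finset.range n, (b (i + 1) - a (i + 1)) * v ^ i =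
          ∑ i ∈ Finset.range n, b (i + 1) * v ^ (i + 1) -
            ∑ i ∈ Finset.range n, a (i + 1) * v ^ (i + 1) := by
          rw [← Finset.sum_sub_distrib, Finset.mul_sum]
          exact Finset.sum_congr rfl fun i _ => by ring
        rw [e]
        simp only [pow_zero, mul_one] at h
        linear_combination h
      refine sub_eq_zero.1 (v_dvd_of_degree_lt v hdvd ?_)
      exact (degree_sub_le _ _).trans_lt (max_lt (ha 0 (by omega)) (hb 0 (by omega)))
    have h' : ∑ i ∈ Finset.range n, a (i + 1) * v ^ i = ∑ i ∈ Finset.range n, b (i + 1) * v ^ i := by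
      refine mul_left_cancel₀ hv.out.ne_zero ?_
      rw [h0] at h
      have := add_right_cancel h
      rw [Finset.mul_sum, Finset.mul_sum]
      refine (Finset.sum_congr rfl fun i _ => ?_).trans (this.trans
        (Finset.sum_congr rfl fun i _ => ?_)) <;> ring
    intro i hi
    cases i with
    | zero => exact h0
    | succ i =>
      exact ih (fun j hj => ha (j + 1) (by omega)) (fun j hj => hb (j + 1) (by omega)) h' i
        (by omega)

/-- The base-`v` digits of `⟨x⟩` are the polynomial parts of the `v ⟨v ^ i x⟩`. -/
lemma v_mul_fracX_eq {xd : ℕ → F[X]} (hxd : ∀ i < l, (xd i).degree < v.natDegree)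
    (h : fracInf x = ∑ i ∈ Finset.range l, toK (xd i) * toK v ^ i / (toK v ^ l - 1))
    {i : ℕ} (hi : i < l) :
    toK v * fracX v (l - i - 1) x = fracX v (l - i - 1 + 1) x + toK (xd i) := by
  have h1 := toK_ne_zero (pow_sub_one_ne_zero' hmon hl)
  choose c hc hc' using exists_v_mul_fracX hmon hl hx
  -- At k = l, periodicity of ⟨v^k x⟩ turns this into a second base-v expansion of (v^l - 1)⟨x⟩,
  -- with digits c (l - 1 - j): the long division yields the digits in reverse order.
  have hpow : ∀ k, toK v ^ k * fracX v 0 x =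
      fracX v k x + ∑ j ∈ Finset.range k, toK (c (k - 1 - j)) * toK v ^ j := by
    intro k
    induction k with
    | zero => simp
    | succ k ih =>
      rw [pow_succ', mul_assoc, ih, mul_add, hc', Finset.sum_range_succ', Finset.mul_sum,
        add_assoc]
      congr 1
      rw [add_comm]
      simp only [Nat.add_sub_cancel, Nat.sub_zero, pow_zero, mul_one]
      congr 1
      refine Finset.sum_congr rfl fun j _ => ?_
      rw [show k - (j + 1) = k - 1 - j by omega]
      ring
  have hl' := hpow l
  have e0 : fracX v l x = fracX v 0 x := by
    have := fracX_add_period hmon hl hx 0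
    rwa [zero_add] at this
  have e1 : fracX v 0 x = fracInf x := by simp [fracX]
  rw [e0, e1, h, ← Finset.sum_div] at hl'
  have hN : toK v ^ l - 1 ≠ 0 := by simpa [toK] using h1
  have key : ∑ j ∈ Finset.range l, xd j * v ^ j = ∑ j ∈ Finset.range l, c (l - 1 - j) * v ^ j := by
    apply toK_injective
    simp only [map_sum, map_mul, map_pow]
    field_simp at hl'
    refine mul_left_cancel₀ hN ?_
    change _ * ∑ j ∈ Finset.range l, toK (xd j) * toK v ^ j =
      _ * ∑ j ∈ Finset.range l, toK (c (l - 1 - j)) * toK v ^ j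
    linear_combination hl'
  have := base_expansion_unique l hxd (fun j _ => hc _) key i hi
  rw [this, hc', show l - i - 1 = l - 1 - i by omega]

end Torsion

/-! ### The product of the factors and the limit of Carlitz binomial coefficients -/

section Key

variable {F : Type*} [Field F] [Fintype F] {v : F[X]} [hv : Fact (Irreducible v)]

/-- The element `⟨v ^ i x⟩` of `k_v`. -/
abbrev fracKv (v : F[X]) [Fact (Irreducible v)] (i : ℕ) (x : RatFunc F) : Kv v :=
  algebraMap (RatFunc F) (Kv v) (fracX v i x)

variable (hmon : v.Monic) {l : ℕ} (hl : l ≠ 0) {x : RatFunc F} (hx : IsTors v l x)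
include hmon hl hx

omit hmon hx in
lemma norm_pow_sub_one : ‖toKv v (v ^ l - 1)‖ = 1 := by
  rw [norm_toKv_eq_one_iff]
  intro h
  have h1 : v ∣ (1 : F[X]) := by
    have := dvd_sub (dvd_pow_self v hl) h
    rwa [sub_sub_cancel] at this
  exact hv.out.not_isUnit (isUnit_of_dvd_one h1)

lemma norm_fracKv_le_one (i : ℕ) : ‖fracKv v i x‖ ≤ 1 := by
  obtain ⟨r, -, hr'⟩ := exists_fracX_eq hmon hl hx i
  rw [fracKv, hr', map_div₀, ← toKv_eq, ← toKv_eq, norm_div, norm_pow_sub_one hl, div_one]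
  exact norm_toKv_le_one v r

lemma isFrac_fracKv (i : ℕ) : IsFrac v l (fracKv v i x) := by
  refine ⟨norm_fracKv_le_one hmon hl hx i, ?_⟩
  obtain ⟨b, hb⟩ := exists_v_pow_mul_fracX hmon hl hx i
  refine ⟨b, ?_⟩
  rw [toKv_eq, toKv_eq, ← map_pow, ← map_mul, hb, map_add]

lemma tendsto_geoFactor_fracKv (i : ℕ) : Tendsto (geoFactor v (fracKv v i x)) atTop (𝓝 1) :=
  tendsto_geoFactor v (norm_fracKv_le_one hmon hl hx i)

open Classical in
-- The orbit starts at ⟨v^(l - s₁ - 1) x⟩ so that the first digit split off is x_(s₁). The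
-- telescoped identity is then passed to the limit along steps that return to ⟨x⟩ and stay in one
-- class modulo dl.
lemma prod_progProd_mul_one_add_cLim {xd : ℕ → F[X]} (hxd : ∀ i < l, (xd i).degree < v.natDegree)
    (h : fracInf x = ∑ i ∈ Finset.range l, toK (xd i) * toK v ^ i / (toK v ^ l - 1))
    {s₀ s₁ : ℕ} (hs₀ : s₀ < v.natDegree) (hs₁ : s₁ < l) :
    (∏ k ∈ Finset.range l, progProd (geoFactor v (fracKv v (k + (l - s₁)) x)) (v.natDegree * l)
      (s₀ + v.natDegree * k)) * (1 + cLim v l (s₀ + v.natDegree * s₁) (fracKv v 0 x)) =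
      algebraMap (RatFunc F) (Kv v)
        (if xd s₁ ∈ monicFin F s₀ then toK v * fracX v (l - s₁ - 1) x else 1) := by
  have hm : v.natDegree * l ≠ 0 := mul_ne_zero hv.out.natDegree_pos.ne' hl
  set Y : ℕ → Kv v := fun u => fracKv v (l - s₁ - 1 + u) x with hY
  choose c' hc' hcY' using exists_v_mul_fracX hmon hl hx
  have hc0 : c' (l - s₁ - 1) = xd s₁ := by
    have h1 := hcY' (l - s₁ - 1)
    rw [v_mul_fracX_eq hmon hl hx hxd h hs₁] at h1
    exact (toK_injective (add_left_cancel h1)).symm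
  have htel := prod_geoFactor_mul hmon Y (fun u => norm_fracKv_le_one hmon hl hx _)
    (fun u => c' (l - s₁ - 1 + u)) (fun u => hc' _) (fun u => by
      have := congrArg (algebraMap (RatFunc F) (Kv v)) (hcY' (l - s₁ - 1 + u))
      rw [map_mul, map_add, ← toKv_eq, ← toKv_eq] at this
      exact this) hs₀
  have hrhs : algebraMap (RatFunc F) (Kv v)
      (if xd s₁ ∈ monicFin F s₀ then toK v * fracX v (l - s₁ - 1) x else 1) =
      if c' (l - s₁ - 1 + 0) ∈ monicFin F s₀ then toKv v v * Y 0 else 1 := by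
    rw [add_zero, hc0]
    split_ifs
    · rw [map_mul, ← toKv_eq]; rfl
    · rw [map_one]
  rw [hrhs]
  set g : ℕ → Kv v := fun u => geoFactor v (Y (u + 1)) (s₀ + v.natDegree * u) with hg
  have hgk : ∀ k j, g (k + l * j) = geoFactor v (fracKv v (k + (l - s₁)) x)
      (s₀ + v.natDegree * k + v.natDegree * l * j) := by
    intro k j
    simp only [hg, hY, fracKv]
    rw [show l - s₁ - 1 + (k + l * j + 1) = k + (l - s₁) + l * j by omega,
      fracX_add_mul_period hmon hl hx]
    congr 1
    ring
  have hlim1 : Tendsto (fun J => ∏ u ∈ Finset.range (l * J), g u) atTop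
      (𝓝 (∏ k ∈ Finset.range l, progProd (geoFactor v (fracKv v (k + (l - s₁)) x))
        (v.natDegree * l) (s₀ + v.natDegree * k))) := by
    simp only [prod_range_mul_eq, hgk]
    exact tendsto_finsetProd _ fun k _ =>
      tendsto_progProd (norm_geoFactor v _) (tendsto_geoFactor_fracKv hmon hl hx _) hm _
  -- The s₁ + 1 factors beyond the last full period tend to 1.
  have hlim2 : Tendsto (fun J => ∏ k ∈ Finset.range (s₁ + 1), g (l * J + k)) atTop (𝓝 1) := by
    rw [← Finset.prod_const_one (M := Kv v) (s := Finset.range (s₁ + 1))]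
    refine tendsto_finsetProd _ fun k _ => ?_
    simp only [add_comm (l * _) k, hgk]
    exact (tendsto_geoFactor_fracKv hmon hl hx _).comp (tendsto_progression hm _)
  have hlim3 := tendsto_cLim hmon hl (s₀ + v.natDegree * s₁) (isFrac_fracKv hmon hl hx 0)
  have hlim := (hlim1.mul hlim2).mul (hlim3.const_add 1)
  rw [mul_one] at hlim
  refine tendsto_nhds_unique hlim (tendsto_const_nhds.congr fun J => ?_)
  -- For U = l J + s₁ the last point of the orbit is ⟨v^(l + lJ) x⟩ = ⟨x⟩ and the index s₀ + d U
  -- lies in the class of s₀ + d s₁ modulo dl.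
  rw [← htel (l * J + s₁), ← Finset.prod_range_add]
  congr 2
  simp only [hY, fracKv]
  rw [show l - s₁ - 1 + (l * J + s₁ + 1) = l + l * J by omega, fracX_add_mul_period hmon hl hx,
    ← fracX_add_period hmon hl hx 0, zero_add]
  congr 1
  ring

end Key

/-! ### Digits of natural numbers and of rational numbers -/

section NatDigits

lemma sum_digits_lt {q : ℕ} {c : ℕ → ℕ} {n : ℕ} (hc : ∀ t < n, c t < q) :
    ∑ t ∈ Finset.range n, c t * q ^ t < q ^ n := by
  induction n with
  | zero => simp
  | succ n ih =>
    rw [Finset.sum_range_succ]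
    have h1 := ih fun t ht => hc t (by omega)
    have h2 := Nat.mul_le_mul_right (q ^ n) (Nat.succ_le_of_lt (hc n (by omega)))
    rw [pow_succ', Nat.succ_mul] at *
    omega

lemma sum_digits_div_mod {q : ℕ} {c : ℕ → ℕ} {n s : ℕ} (hc : ∀ t < n, c t < q) (hs : s < n) :
    (∑ t ∈ Finset.range n, c t * q ^ t) / q ^ s % q = c s := by
  have hq : 0 < q := (Nat.zero_le _).trans_lt (hc s hs)
  obtain ⟨k, rfl⟩ := Nat.exists_eq_add_of_lt hs
  rw [show s + k + 1 = s + (k + 1) by ring, Finset.sum_range_add, Finset.sum_range_succ']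
  have h1 := sum_digits_lt (q := q) (c := c) (n := s) fun t ht => hc t (by omega)
  have e : ∑ t ∈ Finset.range s, c t * q ^ t +
      (∑ t ∈ Finset.range k, c (s + (t + 1)) * q ^ (s + (t + 1)) + c (s + 0) * q ^ (s + 0)) =
      ∑ t ∈ Finset.range s, c t * q ^ t +
        q ^ s * (c s + q * ∑ t ∈ Finset.range k, c (s + (t + 1)) * q ^ t) := by
    rw [mul_add, ← mul_assoc, Finset.mul_sum]
    simp only [add_zero]
    rw [add_comm (∑ t ∈ Finset.range k, c (s + (t + 1)) * q ^ (s + (t + 1))), mul_comm (q ^ s) (c s)]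
    congr 2
    exact Finset.sum_congr rfl fun t _ => by ring
  rw [e, Nat.add_mul_div_left _ _ (by positivity), Nat.div_eq_of_lt h1, zero_add,
    Nat.add_mul_mod_self_left, Nat.mod_eq_of_lt (hc s hs)]

lemma sum_digits_eq {q : ℕ} (A : ℕ) (n : ℕ) :
    ∑ t ∈ Finset.range n, (A / q ^ t % q) * q ^ t = A % q ^ n := by
  induction n with
  | zero => simp [Nat.mod_one]
  | succ n ih => rw [Finset.sum_range_succ, ih, pow_succ, Nat.mod_mul, mul_comm (q ^ n)]

lemma sum_max_digit (q : ℕ) (hq : 0 < q) (n : ℕ) :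
    ∑ t ∈ Finset.range n, (q - 1) * q ^ t + 1 = q ^ n := by
  obtain ⟨q, rfl⟩ := Nat.exists_eq_succ_of_ne_zero hq.ne'
  induction n with
  | zero => simp
  | succ n ih =>
    rw [Finset.sum_range_succ, add_right_comm, ih, Nat.succ_sub_one, pow_succ]
    simp only [Nat.succ_eq_add_one]
    ring

lemma sum_digits_lt_sub_one {q : ℕ} {c : ℕ → ℕ} {n : ℕ} (hc : ∀ t < n, c t < q)
    {s : ℕ} (hs : s < n) (h : c s < q - 1) : ∑ t ∈ Finset.range n, c t * q ^ t + 1 < q ^ n := by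
  have hq : 0 < q := (Nat.zero_le _).trans_lt (hc s hs)
  rw [← sum_max_digit q hq n]
  refine Nat.succ_lt_succ (Finset.sum_lt_sum (fun t ht => ?_) ⟨s, Finset.mem_range.2 hs, ?_⟩)
  · exact Nat.mul_le_mul_right _ (Nat.le_sub_one_of_lt (hc t (Finset.mem_range.1 ht)))
  · exact Nat.mul_lt_mul_of_pos_right h (by positivity)

lemma shift_mod {m e s : ℕ} (he : e ≤ m) (hs : s < m) : ((s + e) % m + (m - e)) % m = s := by
  rw [Nat.mod_add_mod, add_assoc, Nat.add_sub_cancel' he, Nat.add_mod_right, Nat.mod_eq_of_lt hs]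

lemma shift_mod' {m e s : ℕ} (he : e ≤ m) (hs : s < m) : ((s + (m - e)) % m + e) % m = s := by
  rw [Nat.mod_add_mod, add_assoc, Nat.sub_add_cancel he, Nat.add_mod_right, Nat.mod_eq_of_lt hs]

/-- Reindexing by a cyclic shift. -/
lemma prod_shift {M : Type*} [CommMonoid M] {m e : ℕ} (he : e ≤ m) (hm : 0 < m)
    (f : ℕ → ℕ → M) : ∏ s ∈ Finset.range m, f s ((s + e) % m) =
      ∏ s ∈ Finset.range m, f ((s + (m - e)) % m) s := by
  refine Finset.prod_bij' (fun s _ => (s + e) % m) (fun t _ => (t + (m - e)) % m) ?_ ?_ ?_ ?_ ?_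
  · exact fun s _ => Finset.mem_range.2 (Nat.mod_lt _ hm)
  · exact fun s _ => Finset.mem_range.2 (Nat.mod_lt _ hm)
  · exact fun s hs => shift_mod he (Finset.mem_range.1 hs)
  · exact fun s hs => shift_mod' he (Finset.mem_range.1 hs)
  · intro s hs
    rw [shift_mod he (Finset.mem_range.1 hs)]

lemma sum_shift {M : Type*} [AddCommMonoid M] {m e : ℕ} (he : e ≤ m) (hm : 0 < m)
    (f : ℕ → ℕ → M) : ∑ s ∈ Finset.range m, f s ((s + e) % m) =
      ∑ s ∈ Finset.range m, f ((s + (m - e)) % m) s :=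
  prod_shift (M := Multiplicative M) he hm f

variable {q m : ℕ} {y : ℚ} {yd : ℕ → ℕ}

lemma fracDigit_eq (hq : 1 < q) (hm : m ≠ 0) (hyd : ∀ s < m, yd s < q)
    (h : Int.fract y = ∑ s ∈ Finset.range m, (yd s : ℚ) * (q : ℚ) ^ s / ((q : ℚ) ^ m - 1))
    {s : ℕ} (hs : s < m) : fracDigit q m y s = yd s := by
  have hQ : ((q : ℚ) ^ m - 1) ≠ 0 :=
    sub_ne_zero.2 (one_lt_pow₀ (by exact_mod_cast hq) hm).ne'
  unfold fracDigit
  have e : Int.fract y * ((q : ℚ) ^ m - 1) = ((∑ t ∈ Finset.range m, yd t * q ^ t : ℕ) : ℚ) := by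
    rw [h, ← Finset.sum_div, div_mul_cancel₀ _ hQ]
    push_cast
    rfl
  rw [e, Nat.floor_natCast, sum_digits_div_mod hyd hs]

/-- Multiplication by `q ^ e` shifts the digits of `⟨y⟩` cyclically. -/
lemma fract_pow_mul (hq : 1 < q) (hm : m ≠ 0) (hyd : ∀ s < m, yd s < q)
    (h : Int.fract y = ∑ s ∈ Finset.range m, (yd s : ℚ) * (q : ℚ) ^ s / ((q : ℚ) ^ m - 1))
    {e : ℕ} (he : e ≤ m) : Int.fract ((q : ℚ) ^ e * y) =
      ((∑ s ∈ Finset.range m, yd ((s + (m - e)) % m) * q ^ s : ℕ) : ℚ) / ((q : ℚ) ^ m - 1) := by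
  have hQ : 0 < ((q : ℚ) ^ m - 1) :=
    sub_pos.2 (one_lt_pow₀ (by exact_mod_cast hq) hm)
  have hm0 := Nat.pos_of_ne_zero hm
  rw [← Finset.sum_div] at h
  -- Not all digits are q - 1, as ⟨y⟩ < 1. The shifted sum therefore stays below q^m - 1 and
  -- represents a fractional part.
  have hex : ∃ s < m, yd s < q - 1 := by
    by_contra! hcon
    have e1 : ∀ s ∈ Finset.range m, yd s * q ^ s = (q - 1) * q ^ s := fun s hs => by
      have h1 := hcon s (Finset.mem_range.1 hs)
      have h2 := hyd s (Finset.mem_range.1 hs)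
      rw [show yd s = q - 1 by omega]
    have e2 : (∑ s ∈ Finset.range m, (yd s : ℚ) * (q : ℚ) ^ s) = (q : ℚ) ^ m - 1 := by
      have := sum_max_digit q (by omega) m
      rw [← Finset.sum_congr rfl e1] at this
      rw [eq_sub_iff_add_eq]
      exact_mod_cast this
    rw [e2, div_self hQ.ne'] at h
    exact (Int.fract_lt_one y).ne h
  obtain ⟨s₀, hs₀, hys₀⟩ := hex
  have hlt := sum_digits_lt_sub_one (q := q) (c := fun s => yd ((s + (m - e)) % m)) (n := m)
    (fun t _ => hyd _ (Nat.mod_lt _ hm0)) (Nat.mod_lt (s₀ + e) hm0)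
    (by simpa only [shift_mod he hs₀] using hys₀)
  -- Exponents of q matter only modulo m, since q^m is congruent to 1 modulo q^m - 1.
  have hdvd : ((q : ℤ) ^ m - 1) ∣ (q : ℤ) ^ e * (∑ s ∈ Finset.range m, (yd s : ℤ) * (q : ℤ) ^ s) -
      ∑ s ∈ Finset.range m, (yd ((s + (m - e)) % m) : ℤ) * (q : ℤ) ^ s := by
    rw [← sum_shift he hm0 (fun a b => (yd a : ℤ) * (q : ℤ) ^ b), Finset.mul_sum,
      ← Finset.sum_sub_distrib]
    refine Finset.dvd_sum fun s _ => ?_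
    have e3 : (q : ℤ) ^ e * ((yd s : ℤ) * (q : ℤ) ^ s) - (yd s : ℤ) * (q : ℤ) ^ ((s + e) % m) =
        (yd s : ℤ) * (q : ℤ) ^ ((s + e) % m) * (((q : ℤ) ^ m) ^ ((s + e) / m) - 1) := by
      have : (q : ℤ) ^ (s + e) = (q : ℤ) ^ ((s + e) % m) * ((q : ℤ) ^ m) ^ ((s + e) / m) := by
        rw [← pow_mul, ← pow_add, Nat.mod_add_div]
      rw [mul_sub, mul_one, mul_assoc _ _ (((q : ℤ) ^ m) ^ ((s + e) / m)), ← this, pow_add]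
      ring
    rw [e3]
    refine Dvd.dvd.mul_left ?_ _
    simpa using sub_dvd_pow_sub_pow ((q : ℤ) ^ m) 1 ((s + e) / m)
  obtain ⟨k, hk⟩ := hdvd
  rw [Int.fract_eq_iff]
  refine ⟨by positivity, ?_, k + q ^ e * ⌊y⌋, ?_⟩
  · rw [div_lt_one hQ, lt_sub_iff_add_lt]
    exact_mod_cast hlt
  · have hk' := congrArg (Int.cast : ℤ → ℚ) hk
    push_cast at hk' ⊢
    have hy : y = ⌊y⌋ + (∑ s ∈ Finset.range m, (yd s : ℚ) * (q : ℚ) ^ s) / ((q : ℚ) ^ m - 1) := by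
      rw [← h, Int.floor_add_fract]
    have h3 : (q : ℚ) ^ e * y = q ^ e * ⌊y⌋ +
        q ^ e * (∑ s ∈ Finset.range m, (yd s : ℚ) * (q : ℚ) ^ s) / ((q : ℚ) ^ m - 1) := by
      nth_rw 1 [hy]
      ring
    rw [h3]
    have := hQ.ne'
    field_simp
    linear_combination hk'

end NatDigits

/-! ### Digits of `p`-adic integers -/

section PadicDigits

variable {F : Type*} [Field F] [Fintype F] {p : ℕ} [Fact p.Prime] [CharP F p]

local notation "𝔮" => Fintype.card F

variable (F p) in
lemma card_eq_pow_log : 𝔮 = p ^ Nat.log p 𝔮 := by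
  obtain ⟨n, hp, hn⟩ := FiniteField.card F p
  rw [hn, Nat.log_pow hp.one_lt]

lemma padicDigit_eq {y z : ℤ_[p]} {c : ℕ → ℕ} {n : ℕ} (hc : ∀ t < n, c t < 𝔮)
    (h : y = (∑ t ∈ Finset.range n, c t * 𝔮 ^ t : ℕ) + (𝔮 : ℤ_[p]) ^ n * z) {i : ℕ} (hi : i < n) :
    padicDigit 𝔮 y i = c i := by
  have hp : (p ^ Nat.log p 𝔮) ^ (i + 1) = 𝔮 ^ (i + 1) := by rw [← card_eq_pow_log F p]
  have hqz : ((𝔮 ^ (i + 1) : ℕ) : ZMod (p ^ (Nat.log p 𝔮 * (i + 1)))) = 0 := by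
    rw [← hp, ← pow_mul, ZMod.natCast_self]
  obtain ⟨k, rfl⟩ := Nat.exists_eq_add_of_lt hi
  have hA := sum_digits_lt (q := 𝔮) (c := c) (n := i + 1) fun t ht => hc t (by omega)
  have e : PadicInt.toZModPow (Nat.log p 𝔮 * (i + 1)) y =
      ((∑ t ∈ Finset.range (i + 1), c t * 𝔮 ^ t : ℕ) : ZMod (p ^ (Nat.log p 𝔮 * (i + 1)))) := by
    have hy : y = ((∑ t ∈ Finset.range (i + 1), c t * 𝔮 ^ t : ℕ) : ℤ_[p]) +
        ((𝔮 ^ (i + 1) : ℕ) : ℤ_[p]) * ((∑ t ∈ Finset.range k, c (i + 1 + t) * 𝔮 ^ t : ℕ) +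
          (𝔮 : ℤ_[p]) ^ k * z) := by
      rw [h, show i + k + 1 = (i + 1) + k by ring, Finset.sum_range_add]
      push_cast
      rw [mul_add, Finset.mul_sum, add_assoc]
      congr 1
      congr 1
      · exact Finset.sum_congr rfl fun t _ => by ring
      · ring
    rw [hy, map_add, map_mul, map_natCast, map_natCast, hqz, zero_mul, add_zero]
  unfold padicDigit
  rw [e, ZMod.val_natCast, Nat.mod_eq_of_lt (by rwa [pow_mul, hp])]
  have h1 := sum_digits_lt (q := 𝔮) (c := c) (n := i) fun t ht => hc t (by omega)
  have hq0 : 0 < 𝔮 ^ i := pow_pos Fintype.card_pos i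
  rw [Finset.sum_range_succ, Nat.add_mul_div_right _ _ hq0, Nat.div_eq_of_lt h1, zero_add]

lemma ratToPadicInt_eq {y : ℚ} {w : ℤ_[p]} (h : (w : ℚ_[p]) = y) : ratToPadicInt p y = w := by
  have h1 : ‖(y : ℚ_[p])‖ ≤ 1 := h ▸ w.2
  exact (dif_pos h1).trans (Subtype.ext h.symm)

lemma isUnit_card_pow_sub_one {m : ℕ} (hm : m ≠ 0) : IsUnit ((𝔮 : ℤ_[p]) ^ m - 1) := by
  rw [PadicInt.isUnit_iff]
  have h1 : ‖(𝔮 : ℤ_[p]) ^ m‖ < 1 := by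
    rw [norm_pow]
    refine pow_lt_one₀ (norm_nonneg _) ?_ hm
    rw [PadicInt.norm_natCast_lt_one_iff]
    exact (CharP.cast_eq_zero_iff F p _).1 (FiniteField.cast_card_eq_zero F)
  have h2 : ‖(1 : ℤ_[p])‖ = 1 := norm_one
  rw [norm_sub_rev, sub_eq_add_neg, IsUltrametricDist.norm_add_eq_max_of_norm_ne_norm]
  · rw [norm_neg, h2]
    exact max_eq_left h1.le
  · rw [norm_neg, h2]
    exact h1.ne'

lemma card_pow_sub_one_mul_ratToPadicInt {m : ℕ} (hm : m ≠ 0) (r : ℤ) :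
    ((𝔮 : ℤ_[p]) ^ m - 1) * ratToPadicInt p (r / ((𝔮 : ℚ) ^ m - 1)) = r := by
  obtain ⟨u, hu⟩ := isUnit_card_pow_sub_one (F := F) (p := p) hm
  have hne : ((u : ℤ_[p]) : ℚ_[p]) ≠ 0 := by
    intro h
    exact u.ne_zero (Subtype.ext h)
  rw [ratToPadicInt_eq (w := (r : ℤ_[p]) * ((u⁻¹ : ℤ_[p]ˣ) : ℤ_[p]))]
  · rw [← hu, mul_comm, mul_assoc, Units.inv_mul, mul_one]
  · have hu' : ((u : ℤ_[p]) : ℚ_[p]) = (𝔮 : ℚ_[p]) ^ m - 1 := by rw [hu]; push_cast; rfl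
    push_cast
    rw [← hu', eq_div_iff hne, mul_assoc, ← PadicInt.coe_mul, Units.inv_mul]
    simp

variable {m : ℕ} {c : ℕ → ℕ} {w : ℤ_[p]}

/-- Iteration of w = N + q^m w with N = ∑ c_s q^s: the number -N/(q^m - 1) has a purely periodic
expansion. -/
lemma eq_sum_periodic (hw : ((𝔮 : ℤ_[p]) ^ m - 1) * w = -(∑ s ∈ Finset.range m, c s * 𝔮 ^ s : ℕ))
    (J : ℕ) : w = (∑ t ∈ Finset.range (m * J), c (t % m) * 𝔮 ^ t : ℕ) +
      (𝔮 : ℤ_[p]) ^ (m * J) * w := by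
  induction J with
  | zero => simp
  | succ J ih =>
    nth_rw 1 [ih]
    have hw' : w = (∑ s ∈ Finset.range m, c s * 𝔮 ^ s : ℕ) + (𝔮 : ℤ_[p]) ^ m * w := by
      linear_combination -hw
    nth_rw 1 [hw']
    rw [Nat.mul_succ, Finset.sum_range_add]
    have e : ∀ s ∈ Finset.range m, c ((m * J + s) % m) * 𝔮 ^ (m * J + s) =
        𝔮 ^ (m * J) * (c s * 𝔮 ^ s) := fun s hs => by
      rw [Nat.mul_add_mod, Nat.mod_eq_of_lt (Finset.mem_range.1 hs)]
      ring
    rw [Finset.sum_congr rfl e, ← Finset.mul_sum]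
    push_cast
    ring

lemma padicDigit_periodic (hm : m ≠ 0) (hc : ∀ s < m, c s < 𝔮)
    (hw : ((𝔮 : ℤ_[p]) ^ m - 1) * w = -(∑ s ∈ Finset.range m, c s * 𝔮 ^ s : ℕ)) (t : ℕ) :
    padicDigit 𝔮 w t = c (t % m) := by
  refine padicDigit_eq (c := fun t => c (t % m)) (n := m * (t + 1))
    (fun t _ => hc _ (Nat.mod_lt _ (Nat.pos_of_ne_zero hm))) (eq_sum_periodic hw (t + 1)) ?_
  exact Nat.lt_of_succ_le (Nat.le_mul_of_pos_left _ (Nat.pos_of_ne_zero hm))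

/-- The sum of w and -w - 1 is -1, all of whose digits are q - 1, so no carry occurs. -/
lemma padicDigit_neg_sub_one (hm : m ≠ 0) (hc : ∀ s < m, c s < 𝔮)
    (hw : ((𝔮 : ℤ_[p]) ^ m - 1) * w = -(∑ s ∈ Finset.range m, c s * 𝔮 ^ s : ℕ)) (t : ℕ) :
    padicDigit 𝔮 (-w - 1) t = 𝔮 - 1 - c (t % m) := by
  have hq : 0 < 𝔮 := Fintype.card_pos
  refine padicDigit_eq (c := fun t => 𝔮 - 1 - c (t % m)) (n := m * (t + 1)) (z := -w - 1)
    (fun t _ => by omega) ?_ ?_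
  · have h1 := eq_sum_periodic hw (t + 1)
    have h2 : (∑ i ∈ Finset.range (m * (t + 1)), (𝔮 - 1 - c (i % m)) * 𝔮 ^ i) +
        ∑ i ∈ Finset.range (m * (t + 1)), c (i % m) * 𝔮 ^ i + 1 = 𝔮 ^ (m * (t + 1)) := by
      rw [← sum_max_digit 𝔮 hq, ← Finset.sum_add_distrib]
      congr 1
      refine Finset.sum_congr rfl fun i _ => ?_
      have := hc (i % m) (Nat.mod_lt _ (Nat.pos_of_ne_zero hm))
      rw [← add_mul]
      congr 1
      omega
    have h3 := congrArg (Nat.cast : ℕ → ℤ_[p]) h2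
    rw [Nat.cast_add, Nat.cast_add, Nat.cast_pow, Nat.cast_one] at h3
    linear_combination -h3 - h1
  · exact Nat.lt_of_succ_le (Nat.le_mul_of_pos_left _ (Nat.pos_of_ne_zero hm))

/-- Split w = A + q^n z with 0 ≤ A < q^n and q^n > |r|. Then (q^m - 1) z is an integer in (-q^m, 0],
so the tail z is purely periodic. -/
lemma padicDigit_eventually_periodic (hm : m ≠ 0) {r : ℤ}
    (hw : ((𝔮 : ℤ_[p]) ^ m - 1) * w = r) :
    ∃ n₀, ∀ t ≥ n₀, padicDigit 𝔮 w (t + m) = padicDigit 𝔮 w t := by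
  have hq1 : 1 < 𝔮 := Fintype.one_lt_card
  have hq0 : 0 < 𝔮 := by omega
  obtain ⟨n, hn⟩ : ∃ n : ℕ, r.natAbs < 𝔮 ^ n := ⟨_, Nat.lt_pow_self hq1⟩
  set A := (PadicInt.toZModPow (Nat.log p 𝔮 * n) w).val with hA
  have hpn : p ^ (Nat.log p 𝔮 * n) = 𝔮 ^ n := by rw [pow_mul, ← card_eq_pow_log F p]
  have hAlt : A < 𝔮 ^ n := by
    have : NeZero (p ^ (Nat.log p 𝔮 * n)) := ⟨pow_ne_zero _ (Fact.out : p.Prime).ne_zero⟩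
    rw [← hpn]
    exact ZMod.val_lt _
  obtain ⟨z, hz⟩ : ∃ z, w - A = (𝔮 : ℤ_[p]) ^ n * z := by
    have h1 : w - A ∈ RingHom.ker (PadicInt.toZModPow (p := p) (Nat.log p 𝔮 * n)) := by
      have : NeZero (p ^ (Nat.log p 𝔮 * n)) := ⟨pow_ne_zero _ (Fact.out : p.Prime).ne_zero⟩
      rw [RingHom.mem_ker, map_sub, map_natCast, hA, ZMod.natCast_val, ZMod.cast_id', id, sub_self]
    rw [PadicInt.ker_toZModPow, Ideal.mem_span_singleton] at h1
    obtain ⟨z, hz⟩ := h1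
    refine ⟨z, hz.trans ?_⟩
    congr 1
    exact_mod_cast hpn
  obtain ⟨R, hR⟩ : ∃ R : ℤ, r - ((𝔮 : ℤ) ^ m - 1) * A = (𝔮 : ℤ) ^ n * R := by
    have h1 : ((p : ℤ_[p]) ^ (Nat.log p 𝔮 * n)) ∣ ((r - ((𝔮 : ℤ) ^ m - 1) * A : ℤ) : ℤ_[p]) := by
      refine ⟨((𝔮 : ℤ_[p]) ^ m - 1) * z, ?_⟩
      have hpn' : (p : ℤ_[p]) ^ (Nat.log p 𝔮 * n) = (𝔮 : ℤ_[p]) ^ n := by exact_mod_cast hpn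
      rw [hpn']
      push_cast
      linear_combination ((𝔮 : ℤ_[p]) ^ m - 1) * hz - hw
    rw [PadicInt.pow_p_dvd_int_iff] at h1
    obtain ⟨R, hR⟩ := h1
    refine ⟨R, hR.trans ?_⟩
    congr 1
    exact_mod_cast hpn
  have hqn : (0 : ℤ) < (𝔮 : ℤ) ^ n := by positivity
  have hQm : (0 : ℤ) < (𝔮 : ℤ) ^ m - 1 :=
    sub_pos.2 (one_lt_pow₀ (by exact_mod_cast hq1) hm)
  have hr1 : -((𝔮 : ℤ) ^ n) < r ∧ r < (𝔮 : ℤ) ^ n := by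
    have : |r| < (𝔮 : ℤ) ^ n := by
      rw [Int.abs_eq_natAbs]
      exact_mod_cast hn
    exact abs_lt.1 this
  have hA1 : (A : ℤ) ≤ (𝔮 : ℤ) ^ n - 1 := by
    have : (A : ℤ) < (𝔮 : ℤ) ^ n := by exact_mod_cast hAlt
    omega
  -- R = (q^m - 1) z; both bounds follow from q^n R = r - (q^m - 1) A, |r| < q^n and 0 ≤ A ≤ q^n -
  -- 1.
  have hR0 : R ≤ 0 := by
    by_contra! hcon
    have h1 : (𝔮 : ℤ) ^ n * 1 ≤ (𝔮 : ℤ) ^ n * R := by gcongr; omega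
    have h2 : 0 ≤ ((𝔮 : ℤ) ^ m - 1) * A := by positivity
    linarith
  have hRlow : -((𝔮 : ℤ) ^ m) < R := by
    by_contra! hcon
    have h1 : (𝔮 : ℤ) ^ n * R ≤ (𝔮 : ℤ) ^ n * (-((𝔮 : ℤ) ^ m)) := by gcongr
    have h2 : ((𝔮 : ℤ) ^ m - 1) * A ≤ ((𝔮 : ℤ) ^ m - 1) * ((𝔮 : ℤ) ^ n - 1) := by gcongr
    nlinarith
  obtain ⟨S, hS⟩ : ∃ S : ℕ, R = -(S : ℤ) := ⟨(-R).toNat, by omega⟩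
  have hSlt : S < 𝔮 ^ m := by
    have : (S : ℤ) < (𝔮 : ℤ) ^ m := by omega
    exact_mod_cast this
  have hqz : (𝔮 : ℤ_[p]) ^ n ≠ 0 := by
    have : ((𝔮 ^ n : ℕ) : ℤ_[p]) ≠ 0 := Nat.cast_ne_zero.2 (pow_pos hq0 n).ne'
    rwa [Nat.cast_pow] at this
  have hzS : ((𝔮 : ℤ_[p]) ^ m - 1) * z =
      -(∑ s ∈ Finset.range m, (S / 𝔮 ^ s % 𝔮) * 𝔮 ^ s : ℕ) := by
    rw [sum_digits_eq, Nat.mod_eq_of_lt hSlt]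
    refine mul_left_cancel₀ hqz ?_
    have hR' := congrArg (Int.cast : ℤ → ℤ_[p]) hR
    rw [hS] at hR'
    push_cast at hR'
    linear_combination hR' - ((𝔮 : ℤ_[p]) ^ m - 1) * hz + hw
  have hdig : ∀ t, padicDigit 𝔮 w (n + t) = S / 𝔮 ^ (t % m) % 𝔮 := by
    intro t
    have h1 := eq_sum_periodic (c := fun s => S / 𝔮 ^ s % 𝔮) hzS (t + 1)
    have ht : t < m * (t + 1) :=
      Nat.lt_of_succ_le (Nat.le_mul_of_pos_left _ (Nat.pos_of_ne_zero hm))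
    have := padicDigit_eq (y := w) (z := z) (i := n + t) (n := n + m * (t + 1))
      (c := fun i => if i < n then A / 𝔮 ^ i % 𝔮 else S / 𝔮 ^ ((i - n) % m) % 𝔮)
      (fun i _ => by
        split_ifs <;> exact Nat.mod_lt _ hq0) ?_ (by omega)
    · rw [this, if_neg (by omega), Nat.add_sub_cancel_left]
    · rw [Finset.sum_range_add]
      have e1 : ∑ i ∈ Finset.range n,
          (if i < n then A / 𝔮 ^ i % 𝔮 else S / 𝔮 ^ ((i - n) % m) % 𝔮) * 𝔮 ^ i = A := by
        rw [← Nat.mod_eq_of_lt hAlt, ← sum_digits_eq A n]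
        refine Finset.sum_congr rfl fun i hi => ?_
        rw [if_pos (Finset.mem_range.1 hi), sum_digits_eq, Nat.mod_eq_of_lt hAlt]
      have e2 : ∑ i ∈ Finset.range (m * (t + 1)),
          (if n + i < n then A / 𝔮 ^ (n + i) % 𝔮 else S / 𝔮 ^ ((n + i - n) % m) % 𝔮) * 𝔮 ^ (n + i) =
          𝔮 ^ n * ∑ i ∈ Finset.range (m * (t + 1)), S / 𝔮 ^ (i % m) % 𝔮 * 𝔮 ^ i := by
        rw [Finset.mul_sum]
        refine Finset.sum_congr rfl fun i _ => ?_
        rw [if_neg (by omega), Nat.add_sub_cancel_left]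
        ring
      rw [e1, e2, Nat.cast_add, Nat.cast_mul, Nat.cast_pow]
      linear_combination hz + (𝔮 : ℤ_[p]) ^ n * h1
  refine ⟨n, fun t ht => ?_⟩
  obtain ⟨t, rfl⟩ := Nat.exists_eq_add_of_le ht
  rw [add_assoc, hdig, hdig, Nat.add_mod_right]

end PadicDigits

/-! ### Degrees of Carlitz polynomials -/

section CarlitzDegree

variable {F : Type*} [Field F] [Fintype F]

lemma carlitzTheta_monic : (carlitzTheta F).Monic ∧ (carlitzTheta F).natDegree = Fintype.card F := by
  have h : (C X * X : F[X][X]).degree < Fintype.card F :=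
    (degree_C_mul_X_le _).trans_lt (by exact_mod_cast Fintype.one_lt_card)
  have h' : (C X * X : F[X][X]).degree < (X ^ Fintype.card F : F[X][X]).degree := by
    rwa [degree_X_pow]
  unfold carlitzTheta
  refine ⟨(monic_X_pow _).add_of_right h', ?_⟩
  rw [natDegree_add_eq_right_of_degree_lt h', natDegree_X_pow]

lemma carlitz_X_pow_monic (i : ℕ) : (carlitz (X ^ i : F[X])).Monic ∧
    (carlitz (X ^ i : F[X])).natDegree = Fintype.card F ^ i := by
  rw [carlitz_X_pow]
  induction i with
  | zero => simp
  | succ i ih =>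
    rw [Function.iterate_succ_apply']
    refine ⟨carlitzTheta_monic.1.comp ih.1 ?_, ?_⟩
    · rw [ih.2]; positivity
    · rw [natDegree_comp, ih.2, carlitzTheta_monic.2, pow_succ']

lemma degree_carlitz_lt {a : F[X]} {r : ℕ} (ha : a.degree < r) :
    (carlitz a).degree < (Fintype.card F ^ r : ℕ) := by
  have h : carlitz a = ∑ i ∈ a.support, C (C (a.coeff i)) * carlitz (X ^ i : F[X]) := by
    simp only [carlitz_X_pow]
    rfl
  rw [h]
  refine (degree_sum_le _ _).trans_lt ((Finset.sup_lt_iff (WithBot.bot_lt_coe _)).2 fun i hi => ?_)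
  have hir : i < r := by
    have := (le_degree_of_mem_supp i hi).trans_lt ha
    exact_mod_cast this
  refine degree_le_natDegree.trans_lt ?_
  have h1 := natDegree_C_mul_le (C (a.coeff i)) (carlitz (X ^ i : F[X]))
  rw [(carlitz_X_pow_monic i).2] at h1
  exact_mod_cast h1.trans_lt (Nat.pow_lt_pow_right Fintype.one_lt_card hir)

lemma carlitz_monic {a : F[X]} (ha : a.Monic) : (carlitz a).Monic ∧
    (carlitz a).natDegree = Fintype.card F ^ a.natDegree := by
  have hmem : a ∈ monicDeg F a.natDegree := ⟨ha, rfl⟩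
  rw [monicDeg_eq_image] at hmem
  obtain ⟨b, hb, hab⟩ := hmem
  replace hb : b.degree < a.natDegree := mem_degreeLT.1 hb
  have hX := carlitz_X_pow_monic (F := F) a.natDegree
  have hlt : (carlitz b).degree < (carlitz (X ^ a.natDegree : F[X])).degree := by
    rw [degree_eq_natDegree hX.1.ne_zero, hX.2]
    exact degree_carlitz_lt hb
  have e : carlitz a = carlitz (X ^ a.natDegree) + carlitz b := by
    rw [← carlitz_add]
    exact congrArg carlitz hab.symm
  rw [e]
  exact ⟨hX.1.add_of_left hlt, by rw [natDegree_add_eq_left_of_degree_lt hlt, hX.2]⟩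

variable {R : Type*} [CommRing R] [IsDomain R] [Algebra F[X] R]

/-- A set of `a`-torsion points of the Carlitz module has at most `q ^ deg a` elements. -/
lemma card_torsion_le {a : F[X]} (ha : a ≠ 0) (S : Finset R)
    (hS : ∀ z ∈ S, cAct a z = 0) : S.card ≤ Fintype.card F ^ a.natDegree := by
  classical
  have hlc : a.leadingCoeff ≠ 0 := leadingCoeff_ne_zero.2 ha
  set b : F[X] := C a.leadingCoeff⁻¹ * a with hb
  have hbm : b.Monic := by
    rw [mul_comm] at hb
    exact hb ▸ monic_mul_leadingCoeff_inv ha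
  have hbd : b.natDegree = a.natDegree := natDegree_C_mul (inv_ne_zero hlc)
  have hc := carlitz_monic hbm
  have hmon : ((carlitz b).map (algebraMap F[X] R)).Monic := hc.1.map _
  rw [← hbd, ← hc.2, ← hc.1.natDegree_map (algebraMap F[X] R)]
  refine (Finset.card_le_card (t := ((carlitz b).map (algebraMap F[X] R)).roots.toFinset)
    fun z hz => ?_).trans ((Multiset.toFinset_card_le _).trans (card_roots' _))
  rw [Multiset.mem_toFinset, mem_roots hmon.ne_zero, IsRoot.def, eval_map_algebraMap]
  change cAct b z = 0
  rw [hb, cAct_C_mul, hS z hz, mul_zero]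

end CarlitzDegree

/-! ### The finite field `𝔽_{q ^ m}` in `ℂ_v` -/

section FiniteSubfield

variable {F : Type*} [Field F] [Fintype F] (v : F[X]) [hv : Fact (Irreducible v)]

lemma algebraMap_Cv_eq (a : F[X]) : algebraMap F[X] (Cv v) a = KvToCv v (toKv v a) := rfl

lemma norm_algebraMap_Cv (a : F[X]) : ‖algebraMap F[X] (Cv v) a‖ = ‖toKv v a‖ :=
  norm_KvToCv v _

lemma KvToCv_cBin (T : ℕ) (z : Kv v) : KvToCv v (cBin F T z) = cBin F T (KvToCv v z) :=
  map_cBin _ (fun _ => rfl) T z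

lemma algebraMap_Cv_injective : Function.Injective (algebraMap F[X] (Cv v)) :=
  (KvToCv v).injective.comp (toKv_injective v)

/-- The field `𝔽_{q ^ m}` inside `ℂ_v`. -/
def finSub (m : ℕ) : Subring (Cv v) where
  carrier := {z | z ^ Fintype.card F ^ m = z}
  mul_mem' {a b} ha hb := by
    have ha' : a ^ Fintype.card F ^ m = a := ha
    have hb' : b ^ Fintype.card F ^ m = b := hb
    change (a * b) ^ Fintype.card F ^ m = a * b
    rw [mul_pow, ha', hb']
  one_mem' := one_pow _
  add_mem' {a b} ha hb := by
    have ha' : a ^ Fintype.card F ^ m = a := ha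
    have hb' : b ^ Fintype.card F ^ m = b := hb
    change (a + b) ^ Fintype.card F ^ m = a + b
    rw [frobPow_add F, ha', hb']
  zero_mem' := zero_pow (pow_ne_zero _ Fintype.card_ne_zero)
  neg_mem' {a} ha := by
    have ha' : a ^ Fintype.card F ^ m = a := ha
    change (-a) ^ Fintype.card F ^ m = -a
    rw [← zero_sub, frobPow_sub F, ha', zero_pow (pow_ne_zero _ Fintype.card_ne_zero)]

variable {v}

lemma mem_finSub {m : ℕ} {z : Cv v} : z ∈ finSub v m ↔ z ^ Fintype.card F ^ m = z := Iff.rfl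

lemma inv_mem_finSub {m : ℕ} {z : Cv v} (hz : z ∈ finSub v m) : z⁻¹ ∈ finSub v m := by
  rw [mem_finSub, inv_pow, mem_finSub.1 hz]

lemma norm_eq_one_of_mem_finSub {m : ℕ} (hm : m ≠ 0) {z : Cv v} (hz : z ∈ finSub v m)
    (h0 : z ≠ 0) : ‖z‖ = 1 := by
  have h1 : 1 < Fintype.card F ^ m := Nat.one_lt_pow hm Fintype.one_lt_card
  have h2 : z ^ (Fintype.card F ^ m - 1) = 1 := by
    refine mul_right_cancel₀ h0 ?_
    rw [← pow_succ, Nat.sub_add_cancel h1.le, mem_finSub.1 hz, one_mul]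
  have h3 := congrArg norm h2
  rw [norm_pow, norm_one] at h3
  exact (pow_eq_one_iff_of_nonneg (norm_nonneg z) (by omega)).1 h3

lemma norm_le_one_of_mem_finSub {m : ℕ} (hm : m ≠ 0) {z : Cv v} (hz : z ∈ finSub v m) :
    ‖z‖ ≤ 1 := by
  rcases eq_or_ne z 0 with rfl | h0
  · simp
  · exact (norm_eq_one_of_mem_finSub hm hz h0).le

/-- The difference lies in the finite field again, where nonzero elements are roots of unity and
have norm 1. -/
lemma eq_of_mem_finSub_of_norm_lt {m : ℕ} (hm : m ≠ 0) {z w : Cv v} (hz : z ∈ finSub v m)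
    (hw : w ∈ finSub v m) (h : ‖z - w‖ < 1) : z = w := by
  by_contra hne
  exact h.ne (norm_eq_one_of_mem_finSub hm (sub_mem hz hw) (sub_ne_zero.2 hne))

lemma X_pow_sub_X_ne_zero' {m : ℕ} (hm : m ≠ 0) : (X ^ Fintype.card F ^ m - X : (Cv v)[X]) ≠ 0 :=
  FiniteField.X_pow_card_sub_X_ne_zero _ (Nat.one_lt_pow hm Fintype.one_lt_card)

variable (v) in
open Classical in
/-- The elements of `𝔽_{q ^ m}` as a finite set. -/
def finSubFin (m : ℕ) : Finset (Cv v) := (X ^ Fintype.card F ^ m - X : (Cv v)[X]).roots.toFinset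

lemma mem_finSubFin {m : ℕ} (hm : m ≠ 0) {z : Cv v} : z ∈ finSubFin v m ↔ z ∈ finSub v m := by
  classical
  rw [finSubFin, Multiset.mem_toFinset, mem_roots (X_pow_sub_X_ne_zero' hm), mem_finSub]
  simp [sub_eq_zero]

lemma card_finSubFin {m : ℕ} (hm : m ≠ 0) : (finSubFin v m).card = Fintype.card F ^ m := by
  classical
  obtain ⟨p, hp⟩ := CharP.exists F
  have hpF : CharP (Cv v) p := by
    have hi : Function.Injective ((algebraMap F[X] (Cv v)).comp C) :=
      (algebraMap_Cv_injective v).comp C_injective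
    exact charP_of_injective_ringHom hi p
  have hpc : p ∣ Fintype.card F ^ m :=
    dvd_pow ((CharP.cast_eq_zero_iff F p _).1 (FiniteField.cast_card_eq_zero F)) hm
  have hsep : (X ^ Fintype.card F ^ m - X : (Cv v)[X]).Separable :=
    galois_poly_separable p _ hpc
  -- It already splits over the algebraic closure of k_v, before completion.
  have hsplit : (X ^ Fintype.card F ^ m - X : (Cv v)[X]).Splits := by
    have h1 := (IsAlgClosed.splits (X ^ Fintype.card F ^ m - X : (KvBar v)[X])).map
      (UniformSpace.Completion.coeRingHom (α := KvBar v))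
    have h2 : (X ^ Fintype.card F ^ m - X : (KvBar v)[X]).map
      (UniformSpace.Completion.coeRingHom (α := KvBar v)) =
      (X ^ Fintype.card F ^ m - X : (UniformSpace.Completion (KvBar v))[X]) := by simp
    rw [h2] at h1
    exact h1
  rw [finSubFin, Multiset.toFinset_card_of_nodup (nodup_roots hsep),
    ← hsplit.natDegree_eq_card_roots,
    FiniteField.X_pow_card_sub_X_natDegree_eq _ (Nat.one_lt_pow hm Fintype.one_lt_card)]

open Classical in
-- Orthogonality: the sum of the nontrivial character w ↦ w^(q^s - q^t) is unchanged when multiplied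
-- by a value χ(w₀) ≠ 1.
lemma sum_pow_mul_inv_pow_eq_zero {m s t : ℕ} (hm : m ≠ 0) (hs : s < m) (ht : t < m)
    (hst : s ≠ t) : ∑ w ∈ (finSubFin v m).erase 0,
      w ^ Fintype.card F ^ s * (w⁻¹) ^ Fintype.card F ^ t = 0 := by
  set χ : Cv v → Cv v := fun w => w ^ Fintype.card F ^ s * (w⁻¹) ^ Fintype.card F ^ t with hχ
  have hmul : ∀ a b, χ (a * b) = χ a * χ b := by
    intro a b
    simp only [hχ, mul_inv, mul_pow]
    ring
  obtain ⟨w₀, hw₀, hχ₀⟩ : ∃ w₀ ∈ (finSubFin v m).erase 0, χ w₀ ≠ 1 := by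
    by_contra! hcon
    have hall : ∀ w ∈ finSubFin v m, w ^ Fintype.card F ^ s = w ^ Fintype.card F ^ t := by
      intro w hw
      rcases eq_or_ne w 0 with rfl | hw0
      · rw [zero_pow (by positivity), zero_pow (by positivity)]
      · have := hcon w (Finset.mem_erase.2 ⟨hw0, hw⟩)
        simp only [hχ, inv_pow] at this
        exact (mul_inv_eq_one₀ (pow_ne_zero _ hw0)).1 this
    -- If the character were trivial, all q^m elements would lie in a field with q^(j-i) < q^m
    -- elements.
    have key : ∀ i j : ℕ, i < j → j < m →
        ¬ ∀ w ∈ finSubFin v m, w ^ Fintype.card F ^ i = w ^ Fintype.card F ^ j := by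
      intro i j hij hj h
      have h1 : finSubFin v m ⊆ finSubFin v (j - i) := by
        intro w hw
        rw [mem_finSubFin (by omega), mem_finSub]
        have h2 := h w hw
        have h3 : (w ^ Fintype.card F ^ (j - i) - w) ^ Fintype.card F ^ i = 0 := by
          rw [frobPow_sub F, ← pow_mul, ← pow_add, Nat.sub_add_cancel hij.le, h2, sub_self]
        exact sub_eq_zero.1 (pow_eq_zero_iff (by positivity) |>.1 h3)
      have h4 := Finset.card_le_card h1
      rw [card_finSubFin hm, card_finSubFin (by omega)] at h4
      have := (Nat.pow_le_pow_iff_right (Fintype.one_lt_card (α := F))).1 h4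
      omega
    rcases lt_or_gt_of_ne hst with h | h
    · exact key s t h ht hall
    · exact key t s h hs fun w hw => (hall w hw).symm
  have hw₀0 := (Finset.mem_erase.1 hw₀).1
  have hw₀m := (mem_finSubFin hm).1 (Finset.mem_erase.1 hw₀).2
  have hperm : ∑ w ∈ (finSubFin v m).erase 0, χ w = ∑ w ∈ (finSubFin v m).erase 0, χ (w₀ * w) := by
    symm
    refine Finset.sum_bij' (fun w _ => w₀ * w) (fun w _ => w₀⁻¹ * w) ?_ ?_ ?_ ?_ ?_
    · intro w hw
      rw [Finset.mem_erase, mem_finSubFin hm] at hw ⊢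
      exact ⟨mul_ne_zero hw₀0 hw.1, mul_mem hw₀m hw.2⟩
    · intro w hw
      rw [Finset.mem_erase, mem_finSubFin hm] at hw ⊢
      exact ⟨mul_ne_zero (inv_ne_zero hw₀0) hw.1, mul_mem (inv_mem_finSub hw₀m) hw.2⟩
    · intro w _; exact inv_mul_cancel_left₀ hw₀0 w
    · intro w _; exact mul_inv_cancel_left₀ hw₀0 w
    · intro w _; rfl
  simp only [hmul, ← Finset.mul_sum] at hperm
  have h5 : (χ w₀ - 1) * ∑ w ∈ (finSubFin v m).erase 0, χ w = 0 := by
    rw [sub_mul, one_mul, ← hperm, sub_self]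
  exact (mul_eq_zero.1 h5).resolve_left (sub_ne_zero.2 hχ₀)

open Classical in
lemma sum_pow_mul_inv_pow_self {m : ℕ} (hm : m ≠ 0) (s : ℕ) :
    ∑ w ∈ (finSubFin v m).erase 0, w ^ Fintype.card F ^ s * (w⁻¹) ^ Fintype.card F ^ s = -1 := by
  have h1 : ∀ w ∈ (finSubFin v m).erase 0,
      w ^ Fintype.card F ^ s * (w⁻¹) ^ Fintype.card F ^ s = 1 := by
    intro w hw
    rw [← mul_pow, mul_inv_cancel₀ (Finset.mem_erase.1 hw).1, one_pow]
  rw [Finset.sum_congr rfl h1, Finset.sum_const, Finset.card_erase_of_mem, card_finSubFin hm,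
    nsmul_one, Nat.cast_sub (Nat.one_le_pow _ _ Fintype.card_pos)]
  · have h2 : ((Fintype.card F : ℕ) : Cv v) = 0 := by
      have := congrArg ((algebraMap F[X] (Cv v)).comp C) (FiniteField.cast_card_eq_zero F)
      rwa [map_natCast, map_zero] at this
    rw [Nat.cast_pow, h2, zero_pow hm]
    simp
  · rw [mem_finSubFin hm]
    exact zero_mem _

end FiniteSubfield

/-! ### Torsion points -/

section TorsionPoints

variable {F : Type*} [Field F] [Fintype F] {v : F[X]} [hv : Fact (Irreducible v)]

lemma norm_cBin_Cv_le_one (T : ℕ) (a : F[X]) : ‖cBin F T (algebraMap F[X] (Cv v) a)‖ ≤ 1 := by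
  rw [algebraMap_Cv_eq, ← KvToCv_cBin, norm_KvToCv]
  exact norm_cBin_toKv_le_one v T a

lemma norm_pow_card_pow_le {z : Cv v} (hz : ‖z‖ ≤ 1) (T : ℕ) :
    ‖z ^ Fintype.card F ^ T‖ ≤ ‖z‖ := by
  rw [norm_pow]
  exact pow_le_of_le_one (norm_nonneg _) hz (by positivity)

lemma norm_cAct_le (a : F[X]) {z : Cv v} (hz : ‖z‖ ≤ 1) : ‖cAct a z‖ ≤ ‖z‖ := by
  rw [cAct_eq_sum (algebraMap_Cv_injective v)
    (degree_le_natDegree.trans_lt (by exact_mod_cast Nat.lt_succ_self a.natDegree))]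
  refine IsUltrametricDist.norm_sum_le_of_forall_le_of_nonneg (norm_nonneg _) fun T _ => ?_
  rw [norm_mul]
  exact (mul_le_of_le_one_left (norm_nonneg _) (norm_cBin_Cv_le_one T a)).trans
    (norm_pow_card_pow_le hz T)

variable (hmon : v.Monic)
include hmon

lemma norm_cAct_v_sub_le {z : Cv v} (hz : ‖z‖ ≤ 1) :
    ‖cAct v z - z ^ Fintype.card F ^ v.natDegree‖ ≤ ‖toKv v v‖ * ‖z‖ := by
  rw [cAct_eq_sum (algebraMap_Cv_injective v) (M := v.natDegree + 1)
    (degree_le_natDegree.trans_lt (by exact_mod_cast Nat.lt_succ_self _)), Finset.sum_range_succ,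
    cBin_of_monic (algebraMap_Cv_injective v) hmon rfl, one_mul, add_sub_cancel_right]
  refine IsUltrametricDist.norm_sum_le_of_forall_le_of_nonneg (by positivity) fun T hT => ?_
  rw [norm_mul]
  refine mul_le_mul ?_ (norm_pow_card_pow_le hz T) (norm_nonneg _) (norm_nonneg _)
  rw [algebraMap_Cv_eq, ← KvToCv_cBin, norm_KvToCv]
  exact norm_cBin_le_norm v (Finset.mem_range.1 hT) (norm_toKv_le_one v v)

/-- C_v reduces to the q^d-power map modulo v, because its lower coefficients are divisible by v. -/
lemma norm_cAct_v_pow_sub_lt {z : Cv v} (hz : ‖z‖ ≤ 1) (l : ℕ) :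
    ‖cAct (v ^ l) z - z ^ Fintype.card F ^ (v.natDegree * l)‖ < 1 := by
  induction l with
  | zero => simp [cAct_one]
  | succ l ih =>
    set y := cAct (v ^ l) z
    have hy : ‖y‖ ≤ 1 := (norm_cAct_le _ hz).trans hz
    rw [pow_succ' v, cAct_mul]
    have e : cAct v y - z ^ Fintype.card F ^ (v.natDegree * (l + 1)) =
        (cAct v y - y ^ Fintype.card F ^ v.natDegree) +
          (y - z ^ Fintype.card F ^ (v.natDegree * l)) ^ Fintype.card F ^ v.natDegree := by
      rw [frobPow_sub F, ← pow_mul, ← pow_add, Nat.mul_succ]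
      ring
    rw [e]
    refine (IsUltrametricDist.norm_add_le_max _ _).trans_lt (max_lt ?_ ?_)
    · refine (norm_cAct_v_sub_le hmon hy).trans_lt ?_
      exact (mul_le_of_le_one_right (norm_nonneg _) hy).trans_lt (norm_v_lt_one v)
    · exact (norm_pow_card_pow_le ih.le _).trans_lt ih

lemma norm_cAct_v_lt {z : Cv v} (hz : ‖z‖ < 1) (h0 : z ≠ 0) : ‖cAct v z‖ < ‖z‖ := by
  have hz0 : 0 < ‖z‖ := norm_pos_iff.2 h0
  rw [← sub_add_cancel (cAct v z) (z ^ Fintype.card F ^ v.natDegree)]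
  refine (IsUltrametricDist.norm_add_le_max _ _).trans_lt (max_lt ?_ ?_)
  · refine (norm_cAct_v_sub_le hmon hz.le).trans_lt ?_
    exact mul_lt_of_lt_one_left hz0 (norm_v_lt_one v)
  · rw [norm_pow]
    exact pow_lt_self_of_lt_one₀ hz0 hz (Nat.one_lt_pow hv.out.natDegree_pos.ne' Fintype.one_lt_card)

variable {l : ℕ} (hl : l ≠ 0)
include hl

/-- The reduction map is injective on torsion points. -/
lemma torsion_eq_zero {z : Cv v} (hz : ‖z‖ < 1) (h : cAct (v ^ l - 1) z = 0) : z = 0 := by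
  by_contra h0
  -- On nonzero elements of norm less than 1, C_v strictly lowers the norm, whereas torsion means
  -- C_(v^l)(z) = z.
  have key : ∀ k : ℕ, ‖cAct (v ^ (k + 1)) z‖ < ‖z‖ := by
    intro k
    rw [pow_succ, cAct_mul]
    have h1 := norm_cAct_v_lt hmon hz h0
    exact (norm_cAct_le _ (h1.trans hz).le).trans_lt h1
  obtain ⟨k, rfl⟩ := Nat.exists_eq_succ_of_ne_zero hl
  rw [cAct_sub_left, cAct_one, sub_eq_zero] at h
  exact (key k).ne (by rw [h])

/-! ### The torsion points attached to limits of Carlitz binomial coefficients -/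

omit hmon hl in
variable (v) in
/-- `∑ e_t(x) w ^ (q ^ t)`, where `e_t(x)` is the limit of Carlitz binomial coefficients. -/
def lam (l : ℕ) (x : Kv v) (w : Cv v) : Cv v :=
  ∑ t ∈ Finset.range (v.natDegree * l), KvToCv v (cLim v l t x) * w ^ Fintype.card F ^ t

lemma lam_toKv (a : F[X]) (w : Cv v) : lam v l (toKv v a) w = 0 :=
  Finset.sum_eq_zero fun t _ => by rw [cLim_toKv hmon hl, map_zero, zero_mul]

variable {x : Kv v} (hx : IsFrac v l x) {w : Cv v} (hw : w ∈ finSub v (v.natDegree * l))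
include hx hw

/-- C_θ = θ + τ. Since e_t(x) has period dl in t and w^(q^(dl)) = w, the sum may be shifted by one
index (`hper`); then `cLim_theta_mul` matches it term by term. -/
lemma cAct_X_lam : cAct (X : F[X]) (lam v l x w) = lam v l (toKv v X * x) w := by
  set m := v.natDegree * l with hm
  have hper : ∀ y : Kv v, IsFrac v l y → lam v l y w =
      ∑ t ∈ Finset.range m, KvToCv v (cLim v l (t + 1) y) * w ^ Fintype.card F ^ (t + 1) := by
    intro y hy
    have h1 := Finset.sum_range_succ (fun t => KvToCv v (cLim v l t y) * w ^ Fintype.card F ^ t) m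
    rw [Finset.sum_range_succ'] at h1
    have h2 : cLim v l m y = cLim v l 0 y := by
      have := cLim_add_period hmon hl 0 hy
      rwa [zero_add] at this
    rw [h2, mem_finSub.1 hw, pow_zero, pow_one] at h1
    exact (add_right_cancel h1).symm
  rw [cAct_X, hper _ (hx.mul X)]
  nth_rw 1 [hper x hx]
  have h3 := frobPow_sum F 1 (Finset.range m)
    fun t => KvToCv v (cLim v l t x) * w ^ Fintype.card F ^ t
  rw [pow_one] at h3
  rw [lam, ← hm, h3, Finset.mul_sum, ← Finset.sum_add_distrib]
  refine Finset.sum_congr rfl fun t _ => ?_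
  rw [cLim_theta_mul hmon hl t hx, map_add, map_mul, map_pow, algebraMap_Cv_eq, mul_pow, ← pow_mul,
    ← pow_succ]
  ring

lemma cAct_lam (a : F[X]) : cAct a (lam v l x w) = lam v l (toKv v a * x) w := by
  have hadd : ∀ y z : Kv v, IsFrac v l y → IsFrac v l z →
      lam v l (y + z) w = lam v l y w + lam v l z w := by
    intro y z hy hz
    simp only [lam, cLim_add hmon hl _ hy hz, map_add, add_mul, Finset.sum_add_distrib]
  have hconst : ∀ (c : F) (y : Kv v), IsFrac v l y →
      lam v l (toKv v (C c) * y) w = algebraMap F[X] (Cv v) (C c) * lam v l y w := by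
    intro c y hy
    simp only [lam, cLim_const_mul hmon hl _ c hy, map_mul, Finset.mul_sum, algebraMap_Cv_eq,
      mul_assoc]
  induction a using Polynomial.induction_on with
  | C c => rw [cAct_C, hconst c x hx]
  | add p r hp hr =>
    rw [cAct_add_left, hp, hr, ← hadd _ _ (hx.mul p) (hx.mul r), toKv, toKv, toKv, map_add, add_mul]
  | monomial n c ih =>
    have h' : (C c * X ^ (n + 1) : F[X]) = X * (C c * X ^ n) := by ring
    rw [h', cAct_mul, ih, cAct_X_lam hmon hl (hx.mul _) hw, toKv, toKv, toKv, map_mul _ X, mul_assoc]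

/-- `lam` is A-linear in x and vanishes on A, so a denominator of x kills it. -/
lemma cAct_lam_eq_zero {a c : F[X]} (h : toKv v a * x = toKv v c) : cAct a (lam v l x w) = 0 := by
  rw [cAct_lam hmon hl hx hw, h, lam_toKv hmon hl]

omit hx in
-- The power w^(q^T) depends only on T modulo dl, so the coefficients of C_b can be grouped by class
-- and compared with e_s(x) through `norm_cLim_add_sum_lt_one`.
lemma norm_lam_add_cAct_lt_one (hx1 : ‖x‖ ≤ 1) {b : F[X]}
    (hb : toKv v v ^ l * x = x + toKv v b) : ‖lam v l x w + cAct b w‖ < 1 := by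
  have hm0 : v.natDegree * l ≠ 0 := mul_ne_zero hv.out.natDegree_pos.ne' hl
  have hd : b.degree < (v.natDegree * l * (b.natDegree + 1) : ℕ) := by
    refine degree_le_natDegree.trans_lt ?_
    exact_mod_cast Nat.lt_of_succ_le (Nat.le_mul_of_pos_left _ (Nat.pos_of_ne_zero hm0))
  have hpow : ∀ s j, w ^ Fintype.card F ^ (s + v.natDegree * l * j) = w ^ Fintype.card F ^ s := by
    intro s j
    induction j with
    | zero => rfl
    | succ j ih =>
      rw [Nat.mul_succ, ← add_assoc, add_comm, pow_add, pow_mul, mem_finSub.1 hw, ih]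
  have e : lam v l x w + cAct b w = ∑ s ∈ Finset.range (v.natDegree * l),
      KvToCv v (cLim v l s x + ∑ j ∈ Finset.range (b.natDegree + 1),
        cBin F (s + v.natDegree * l * j) (toKv v b)) * w ^ Fintype.card F ^ s := by
    rw [cAct_eq_sum (algebraMap_Cv_injective v) hd, lam]
    have h1 := prod_range_mul_eq (M := Multiplicative (Cv v)) (fun T => Multiplicative.ofAdd
      (cBin F T (algebraMap F[X] (Cv v) b) * w ^ Fintype.card F ^ T)) (v.natDegree * l)
      (b.natDegree + 1)
    have h2 : ∑ T ∈ Finset.range (v.natDegree * l * (b.natDegree + 1)),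
        cBin F T (algebraMap F[X] (Cv v) b) * w ^ Fintype.card F ^ T =
        ∑ s ∈ Finset.range (v.natDegree * l), ∑ j ∈ Finset.range (b.natDegree + 1),
          cBin F (s + v.natDegree * l * j) (algebraMap F[X] (Cv v) b) *
            w ^ Fintype.card F ^ (s + v.natDegree * l * j) := h1
    rw [h2, ← Finset.sum_add_distrib]
    refine Finset.sum_congr rfl fun s _ => ?_
    rw [map_add, map_sum, add_mul, Finset.sum_mul]
    congr 1
    refine Finset.sum_congr rfl fun j _ => ?_
    rw [hpow, KvToCv_cBin, algebraMap_Cv_eq]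
  rw [e]
  have hne : (Finset.range (v.natDegree * l)).Nonempty := Finset.nonempty_range_iff.2 hm0
  obtain ⟨s, hs, hs'⟩ := IsUltrametricDist.exists_norm_finsetSum_le_of_nonempty hne fun s =>
    KvToCv v (cLim v l s x + ∑ j ∈ Finset.range (b.natDegree + 1),
        cBin F (s + v.natDegree * l * j) (toKv v b)) * w ^ Fintype.card F ^ s
  refine hs'.trans_lt ?_
  rw [norm_mul, norm_KvToCv, norm_pow]
  refine (mul_le_of_le_one_right (norm_nonneg _)
    (pow_le_one₀ (norm_nonneg _) (norm_le_one_of_mem_finSub hm0 hw))).trans_lt ?_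
  exact norm_cLim_add_sum_lt_one hmon hl (Finset.mem_range.1 hs) hx1 hb hd

end TorsionPoints

/-! ### Teichmüller representatives in `k_v` -/

section Teichmuller

variable {F : Type*} [Field F] [Fintype F] (v : F[X]) [hv : Fact (Irreducible v)]

lemma v_dvd_pow_card_pow_sub (a : F[X]) : v ∣ a ^ Fintype.card F ^ v.natDegree - a := by
  have hX : v ∣ X ^ Fintype.card F ^ v.natDegree - X := by
    rw [← Nat.card_eq_fintype_card]
    exact (hv.out.natDegree_dvd_iff_dvd_X_pow_card_pow_sub_X).1 dvd_rfl
  induction a using Polynomial.induction_on' with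
  | add p r hp hr =>
    rw [frobPow_add F]
    have : p ^ Fintype.card F ^ v.natDegree + r ^ Fintype.card F ^ v.natDegree - (p + r) =
      (p ^ Fintype.card F ^ v.natDegree - p) + (r ^ Fintype.card F ^ v.natDegree - r) := by ring
    rw [this]
    exact dvd_add hp hr
  | monomial i c =>
    rw [← C_mul_X_pow_eq_monomial, mul_pow, ← C_pow, FiniteField.pow_card_pow, ← mul_sub, ← pow_mul,
      mul_comm i, pow_mul]
    exact Dvd.dvd.mul_left (hX.trans (sub_dvd_pow_sub_pow _ X i)) _

/-- With Q = q^d and a in A close to c, the powers a^(Q^j) converge, because a^Q is congruent to a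
modulo v. -/
lemma exists_teichmuller {c : Kv v} (hc : ‖c‖ ≤ 1) :
    ∃ t : Kv v, t ^ Fintype.card F ^ v.natDegree = t ∧ ‖c - t‖ < 1 := by
  set Q := Fintype.card F ^ v.natDegree with hQ
  obtain ⟨a, ha⟩ := exists_norm_sub_le v hc 1
  rw [pow_one] at ha
  set A := toKv v a with hA
  set f : ℕ → Kv v := fun j => A ^ Q ^ j with hf
  have hfQ : ∀ j, f (j + 1) = f j ^ Q := fun j => by simp only [hf, pow_succ, pow_mul]
  have hpow : ∀ (j : ℕ) (x : Kv v), x ^ Q ^ j = x ^ Fintype.card F ^ (v.natDegree * j) :=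
    fun j x => by rw [hQ, ← pow_mul]
  have h1 : ‖A ^ Q - A‖ < 1 := by
    have := (norm_toKv_lt_one_iff v _).2 (v_dvd_pow_card_pow_sub v a)
    rwa [toKv, map_sub, map_pow] at this
  have hdiff : ∀ j, ‖f (j + 1) - f j‖ ≤ ‖A ^ Q - A‖ ^ (j + 1) := by
    intro j
    have e : f (j + 1) - f j = (A ^ Q - A) ^ Q ^ j := by
      simp only [hf]
      rw [hpow j (A ^ Q - A), frobPow_sub F, ← hpow, ← hpow, pow_succ', pow_mul A]
    rw [e, norm_pow]
    refine pow_le_pow_of_le_one (norm_nonneg _) h1.le ?_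
    exact Nat.lt_pow_self (Nat.one_lt_pow hv.out.natDegree_pos.ne' Fintype.one_lt_card)
  have hcau : CauchySeq f := by
    refine NonarchimedeanAddGroup.cauchySeq_of_tendsto_sub_nhds_zero ?_
    refine squeeze_zero_norm hdiff ?_
    exact (tendsto_pow_atTop_nhds_zero_of_lt_one (norm_nonneg _) h1).comp (tendsto_add_atTop_nat 1)
  obtain ⟨t, ht⟩ := cauchySeq_tendsto_of_complete hcau
  refine ⟨t, ?_, ?_⟩
  · refine tendsto_nhds_unique (ht.pow Q) ?_
    exact (ht.comp (tendsto_add_atTop_nat 1)).congr hfQ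
  · have h2 : ∀ j, ‖f j - A‖ ≤ ‖A ^ Q - A‖ := by
      intro j
      induction j with
      | zero => simp [hf]
      | succ j ih =>
        rw [← sub_add_sub_cancel _ (f j)]
        refine (IsUltrametricDist.norm_add_le_max _ _).trans (max_le ((hdiff j).trans ?_) ih)
        exact pow_le_of_le_one (norm_nonneg _) h1.le (Nat.succ_ne_zero j)
    have h3 : ‖t - A‖ ≤ ‖A ^ Q - A‖ := le_of_tendsto' (ht.sub_const A).norm h2
    rw [← sub_sub_sub_cancel_right c t A]
    exact (norm_sub_le_max_norm _ _).trans_lt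
      (max_lt (ha.trans_lt (norm_v_lt_one v)) (h3.trans_lt h1))

variable {v} {l : ℕ} (hl : l ≠ 0)
include hl

omit hl in
lemma KvToCv_mem_finSub {t : Kv v} (ht : t ^ Fintype.card F ^ v.natDegree = t) (l : ℕ) :
    KvToCv v t ∈ finSub v (v.natDegree * l) := by
  rw [mem_finSub, ← map_pow]
  congr 1
  rw [pow_mul]
  induction l with
  | zero => simp
  | succ l ih => rw [pow_succ, pow_mul, ih, ht]

/-- Integral elements of the compositum of `k_v` and `𝔽_{q ^ m}` reduce to elements of
`𝔽_{q ^ m}`. -/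
lemma exists_mem_finSub_of_sum (S : Finset (Cv v)) (hS : ∀ w ∈ S, w ∈ finSub v (v.natDegree * l))
    (c : Cv v → Kv v) (h : ‖∑ w ∈ S, KvToCv v (c w) * w‖ ≤ 1) :
    ∃ ζ ∈ finSub v (v.natDegree * l), ‖∑ w ∈ S, KvToCv v (c w) * w - ζ‖ < 1 := by
  classical
  have hm0 : v.natDegree * l ≠ 0 := mul_ne_zero hv.out.natDegree_pos.ne' hl
  have happrox : ∀ (S : Finset (Cv v)), (∀ w ∈ S, w ∈ finSub v (v.natDegree * l)) →
      ∀ (u t : Cv v → Kv v), (∀ w ∈ S, t w ^ Fintype.card F ^ v.natDegree = t w) →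
      (∀ w ∈ S, ‖u w - t w‖ < 1) → ∑ w ∈ S, KvToCv v (t w) * w ∈ finSub v (v.natDegree * l) ∧
      ‖∑ w ∈ S, KvToCv v (u w) * w - ∑ w ∈ S, KvToCv v (t w) * w‖ < 1 := by
    intro S hS u t ht hut
    refine ⟨sum_mem fun w hw => mul_mem (KvToCv_mem_finSub (ht w hw) l) (hS w hw), ?_⟩
    rw [← Finset.sum_sub_distrib]
    rcases S.eq_empty_or_nonempty with rfl | hne
    · simp
    obtain ⟨w, hw, hw'⟩ := IsUltrametricDist.exists_norm_finsetSum_le_of_nonempty hne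
      fun w => KvToCv v (u w) * w - KvToCv v (t w) * w
    refine hw'.trans_lt ?_
    rw [← sub_mul, ← map_sub, norm_mul, norm_KvToCv]
    exact (mul_le_of_le_one_right (norm_nonneg _)
      (norm_le_one_of_mem_finSub hm0 (hS w hw))).trans_lt (hut w hw)
  induction S using Finset.strongInduction generalizing c with
  | H S ih =>
    by_cases hc : ∀ w ∈ S, ‖c w‖ ≤ 1
    · have hex : ∀ w : Cv v, ∃ t : Kv v, w ∈ S →
          t ^ Fintype.card F ^ v.natDegree = t ∧ ‖c w - t‖ < 1 := by
        intro w
        by_cases hw : w ∈ S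
        · obtain ⟨t, ht⟩ := exists_teichmuller v (hc w hw)
          exact ⟨t, fun _ => ht⟩
        · exact ⟨0, fun h => absurd h hw⟩
      choose t ht using hex
      obtain ⟨h1, h2⟩ := happrox S hS c t (fun w hw => (ht w hw).1) fun w hw => (ht w hw).2
      exact ⟨_, h1, h2⟩
    -- Some coefficient is not integral. Dividing by the largest one and reducing gives a relation ∑
    -- t_w w = 0 with t_(w₀) ≠ 0; subtracting a multiple of it removes w₀ from the sum. In the
    -- integral case each coefficient could simply be replaced by its Teichmüller representative.
    · push Not at hc
      obtain ⟨w₁, hw₁, hcw₁⟩ := hc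
      obtain ⟨w₀, hw₀, hmax⟩ := S.exists_max_image (fun w => ‖c w‖) ⟨w₁, hw₁⟩
      have hgt : 1 < ‖c w₀‖ := hcw₁.trans_le (hmax w₁ hw₁)
      have hc0 : c w₀ ≠ 0 := norm_pos_iff.1 (one_pos.trans hgt)
      have hu : ∀ w ∈ S, ‖c w / c w₀‖ ≤ 1 := fun w hw => by
        rw [norm_div]
        exact div_le_one_of_le₀ (hmax w hw) (norm_nonneg _)
      have hex : ∀ w : Cv v, ∃ t : Kv v, w ∈ S →
          t ^ Fintype.card F ^ v.natDegree = t ∧ ‖c w / c w₀ - t‖ < 1 := by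
        intro w
        by_cases hw : w ∈ S
        · obtain ⟨t, ht⟩ := exists_teichmuller v (hu w hw)
          exact ⟨t, fun _ => ht⟩
        · exact ⟨0, fun h => absurd h hw⟩
      choose t ht using hex
      obtain ⟨h1, h2⟩ := happrox S hS (fun w => c w / c w₀) t (fun w hw => (ht w hw).1)
        fun w hw => (ht w hw).2
      have h3 : ‖∑ w ∈ S, KvToCv v (c w / c w₀) * w‖ < 1 := by
        have e : ∑ w ∈ S, KvToCv v (c w / c w₀) * w =
            (∑ w ∈ S, KvToCv v (c w) * w) / KvToCv v (c w₀) := by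
          rw [Finset.sum_div]
          exact Finset.sum_congr rfl fun w _ => by rw [map_div₀]; ring
        rw [e, norm_div, norm_KvToCv]
        exact (div_le_div_of_nonneg_right h (norm_nonneg _)).trans_lt
          ((div_lt_one (one_pos.trans hgt)).2 hgt)
      have h4 : ∑ w ∈ S, KvToCv v (t w) * w = 0 := by
        refine eq_of_mem_finSub_of_norm_lt hm0 h1 (zero_mem _) ?_
        rw [sub_zero, ← sub_sub_cancel (∑ w ∈ S, KvToCv v (c w / c w₀) * w)
          (∑ w ∈ S, KvToCv v (t w) * w)]
        exact (norm_sub_le_max_norm _ _).trans_lt (max_lt h3 h2)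
      have ht0 : t w₀ ≠ 0 := by
        intro h0
        have := (ht w₀ hw₀).2
        rw [h0, div_self hc0, sub_zero, norm_one] at this
        exact this.false
      have h5 : ∑ w ∈ S, KvToCv v (c w) * w =
          ∑ w ∈ S.erase w₀, KvToCv v (c w - c w₀ / t w₀ * t w) * w := by
        have h6 : ∑ w ∈ S, KvToCv v (c w) * w =
            ∑ w ∈ S, KvToCv v (c w - c w₀ / t w₀ * t w) * w := by
          have : ∑ w ∈ S, KvToCv v (c w - c w₀ / t w₀ * t w) * w = ∑ w ∈ S, KvToCv v (c w) * w -
              KvToCv v (c w₀ / t w₀) * ∑ w ∈ S, KvToCv v (t w) * w := by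
            rw [Finset.mul_sum, ← Finset.sum_sub_distrib]
            exact Finset.sum_congr rfl fun w _ => by rw [map_sub, map_mul]; ring
          rw [this, h4, mul_zero, sub_zero]
        rw [h6, ← Finset.add_sum_erase _ _ hw₀, div_mul_cancel₀ _ ht0, sub_self, map_zero, zero_mul,
          zero_add]
      rw [h5] at h ⊢
      exact ih _ (Finset.erase_ssubset hw₀) (fun w hw => hS w (Finset.mem_of_mem_erase hw)) _ h

end Teichmuller

/-! ### All torsion points -/

section AllTorsion

variable {F : Type*} [Field F] [Fintype F] {v : F[X]} [hv : Fact (Irreducible v)]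
variable (hmon : v.Monic) {l : ℕ} (hl : l ≠ 0)
include hmon hl

omit hmon in
lemma inv_eq (h : toKv v (v ^ l - 1) ≠ 0) : toKv v v ^ l * (toKv v (v ^ l - 1))⁻¹ =
    (toKv v (v ^ l - 1))⁻¹ + toKv v 1 := by
  have e : toKv v v ^ l = toKv v (v ^ l - 1) + 1 := by
    simp only [toKv, map_sub, map_pow, map_one]; ring
  rw [e, add_mul, mul_inv_cancel₀ h, one_mul, toKv, toKv, map_one]
  ring

lemma toKv_pow_sub_one_ne_zero : toKv v (v ^ l - 1) ≠ 0 :=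
  (map_ne_zero_iff _ (toKv_injective v)).2 (pow_sub_one_ne_zero' hmon hl)

lemma isFrac_inv : IsFrac v l (toKv v (v ^ l - 1))⁻¹ := by
  refine ⟨?_, 1, inv_eq hl (toKv_pow_sub_one_ne_zero hmon hl)⟩
  rw [norm_inv, norm_pow_sub_one hl, inv_one]

lemma norm_lam_inv_add_lt_one {w : Cv v} (hw : w ∈ finSub v (v.natDegree * l)) :
    ‖lam v l (toKv v (v ^ l - 1))⁻¹ w + w‖ < 1 := by
  have := norm_lam_add_cAct_lt_one hmon hl hw (isFrac_inv hmon hl).1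
    (inv_eq hl (toKv_pow_sub_one_ne_zero hmon hl))
  rwa [cAct_one] at this

lemma lam_inv_injOn : Set.InjOn (lam v l (toKv v (v ^ l - 1))⁻¹) (finSub v (v.natDegree * l)) := by
  intro w hw w' hw' h
  have hm0 : v.natDegree * l ≠ 0 := mul_ne_zero hv.out.natDegree_pos.ne' hl
  refine eq_of_mem_finSub_of_norm_lt hm0 hw hw' ?_
  rw [← add_sub_add_left_eq_sub w w' (lam v l (toKv v (v ^ l - 1))⁻¹ w)]
  nth_rw 2 [h]
  exact (norm_sub_le_max_norm _ _).trans_lt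
    (max_lt (norm_lam_inv_add_lt_one hmon hl hw) (norm_lam_inv_add_lt_one hmon hl hw'))

lemma cAct_lam_inv {w : Cv v} (hw : w ∈ finSub v (v.natDegree * l)) :
    cAct (v ^ l - 1) (lam v l (toKv v (v ^ l - 1))⁻¹ w) = 0 := by
  refine cAct_lam_eq_zero hmon hl (isFrac_inv hmon hl) hw (c := 1) ?_
  rw [mul_inv_cancel₀ (toKv_pow_sub_one_ne_zero hmon hl), toKv, map_one]

/-- For x = 1/(v^l - 1) the point λ_x(w) reduces to -w, so these are q^(dl) distinct torsion points,
as many as `card_torsion_le` allows. -/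
lemma exists_lam_eq {z : Cv v} (hz : cAct (v ^ l - 1) z = 0) :
    ∃ w ∈ finSub v (v.natDegree * l), lam v l (toKv v (v ^ l - 1))⁻¹ w = z := by
  classical
  have hm0 : v.natDegree * l ≠ 0 := mul_ne_zero hv.out.natDegree_pos.ne' hl
  by_contra! hcon
  set S := (finSubFin v (v.natDegree * l)).image (lam v l (toKv v (v ^ l - 1))⁻¹) with hS
  have hzS : z ∉ S := by
    rw [hS, Finset.mem_image]
    rintro ⟨w, hw, h⟩
    exact hcon w ((mem_finSubFin hm0).1 hw) h
  have hcard : S.card = Fintype.card F ^ (v.natDegree * l) := by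
    rw [hS, Finset.card_image_of_injOn, card_finSubFin hm0]
    intro w hw w' hw' h
    exact lam_inv_injOn hmon hl ((mem_finSubFin hm0).1 hw) ((mem_finSubFin hm0).1 hw') h
  have h1 := card_torsion_le (pow_sub_one_ne_zero' hmon hl) (insert z S) (fun y hy => by
    rcases Finset.mem_insert.1 hy with rfl | hy
    · exact hz
    · obtain ⟨w, hw, rfl⟩ := Finset.mem_image.1 hy
      exact cAct_lam_inv hmon hl ((mem_finSubFin hm0).1 hw))
  rw [Finset.card_insert_of_notMem hzS, hcard, (monic_pow_sub_one hmon hl).2] at h1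
  omega

/-- The annihilator of the `n`-torsion points is `(n)`. -/
lemma dvd_of_torsion {n : F[X]} (hn : n.Monic) (hdvd : n ∣ v ^ l - 1) {a : F[X]}
    (h : ∀ z : Cv v, cAct n z = 0 → cAct a z = 0) : n ∣ a := by
  classical
  have hm0 : v.natDegree * l ≠ 0 := mul_ne_zero hv.out.natDegree_pos.ne' hl
  obtain ⟨k, hk⟩ := hdvd
  by_contra hna
  have hr0 : a %ₘ n ≠ 0 := fun h0 => hna ((modByMonic_eq_zero_iff_dvd hn).1 h0)
  have hk0 : k ≠ 0 := by
    rintro rfl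
    exact pow_sub_one_ne_zero' hmon hl (by rw [hk, mul_zero])
  have hr : ∀ z : Cv v, cAct n z = 0 → cAct (a %ₘ n) z = 0 := by
    intro z hz
    have h1 : a %ₘ n = a - (a /ₘ n) * n := by
      rw [mul_comm]; exact eq_sub_of_add_eq (modByMonic_add_div a n)
    rw [h1, cAct_sub_left, h z hz, cAct_mul, hz, cAct_zero, sub_zero]
  -- If the remainder r of a modulo n were nonzero, r k would kill all q^(dl) points of (v^l -
  -- 1)-torsion although its degree is less than dl.
  have h2 := card_torsion_le (mul_ne_zero hr0 hk0)
    ((finSubFin v (v.natDegree * l)).image (lam v l (toKv v (v ^ l - 1))⁻¹)) (fun y hy => by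
      obtain ⟨w, hw, rfl⟩ := Finset.mem_image.1 hy
      rw [cAct_mul]
      refine hr _ ?_
      rw [← cAct_mul, ← hk]
      exact cAct_lam_inv hmon hl ((mem_finSubFin hm0).1 hw))
  rw [Finset.card_image_of_injOn, card_finSubFin hm0] at h2
  · have h3 := (Nat.pow_le_pow_iff_right (Fintype.one_lt_card (α := F))).1 h2
    rw [natDegree_mul hr0 hk0] at h3
    have h4 : n.natDegree + k.natDegree = v.natDegree * l := by
      rw [← natDegree_mul hn.ne_zero hk0, ← hk, (monic_pow_sub_one hmon hl).2]
    have h5 : (a %ₘ n).natDegree < n.natDegree := by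
      refine natDegree_modByMonic_lt a hn ?_
      rintro rfl
      exact hna (one_dvd a)
    omega
  · intro w hw w' hw' h
    exact lam_inv_injOn hmon hl ((mem_finSubFin hm0).1 hw) ((mem_finSubFin hm0).1 hw') h

lemma torsion_of_dvd {n : F[X]} (hdvd : n ∣ v ^ l - 1) {z : Cv v} (hz : cAct n z = 0) :
    cAct (v ^ l - 1) z = 0 := by
  obtain ⟨k, hk⟩ := hdvd
  rw [hk, mul_comm, cAct_mul, hz, cAct_zero]

omit hmon hl in
lemma isIntegral_torsion {n : F[X]} (hn : n.Monic) {z : Cv v} (hz : cAct n z = 0) :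
    IsIntegral F[X] z :=
  ⟨carlitz n, (carlitz_monic hn).1, hz⟩

/-- Every torsion point is some λ(w), so K_n lies in the k_v-algebra generated by F_(q^(dl)). This
algebra is the k_v-span of the finite field, which is closed under multiplication, and
`exists_mem_finSub_of_sum` applies. -/
lemma exists_mem_finSub_of_mem_cycField {n : F[X]} (hn : n.Monic) (hdvd : n ∣ v ^ l - 1) {y : Cv v}
    (hy : y ∈ cycField v n) (hy1 : ‖y‖ ≤ 1) :
    ∃ ζ ∈ finSub v (v.natDegree * l), ‖y - ζ‖ < 1 := by
  have hm0 : v.natDegree * l ≠ 0 := mul_ne_zero hv.out.natDegree_pos.ne' hl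
  have hV : y ∈ Algebra.adjoin (Kv v) (finSub v (v.natDegree * l) : Set (Cv v)) := by
    have h1 : y ∈ (cycField v n).toSubalgebra := hy
    rw [cycField, IntermediateField.adjoin_toSubalgebra_of_isAlgebraic] at h1
    · clear hy hy1
      induction h1 using Algebra.adjoin_induction with
      | mem z hz =>
        obtain ⟨w, hw, rfl⟩ := exists_lam_eq hmon hl (torsion_of_dvd hmon hl hdvd hz)
        refine sum_mem fun t _ => ?_
        exact mul_mem (Subalgebra.algebraMap_mem _ (cLim v l t (toKv v (v ^ l - 1))⁻¹))
          (pow_mem (Algebra.subset_adjoin hw) _)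
      | algebraMap r => exact Subalgebra.algebraMap_mem _ (algebraMap (RatFunc F) (Kv v) r)
      | add a b _ _ ha hb => exact add_mem ha hb
      | mul a b _ _ ha hb => exact mul_mem ha hb
    · intro z hz
      exact ((isIntegral_torsion hn hz).tower_top (A := RatFunc F)).isAlgebraic
  rw [← Subalgebra.mem_toSubmodule, Algebra.adjoin_eq_span] at hV
  have hcl : (Submonoid.closure (finSub v (v.natDegree * l) : Set (Cv v)) : Set (Cv v)) =
      finSubFin v (v.natDegree * l) := by
    ext z
    rw [Finset.mem_coe, mem_finSubFin hm0]
    exact SetLike.ext_iff.1 (Submonoid.closure_eq (finSub v (v.natDegree * l)).toSubmonoid) z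
  rw [hcl, Submodule.mem_span_finset] at hV
  obtain ⟨c, -, rfl⟩ := hV
  exact exists_mem_finSub_of_sum hl _ (fun w hw => (mem_finSubFin hm0).1 hw) c hy1

end AllTorsion

/-! ### Finite domains -/

/-- The cardinality is q^f, where f is the dimension over F. Every element is fixed by the q^f-power
map, in particular the image of θ, so v divides X^(q^f) - X and d ∣ f. -/
lemma exists_card_eq_of_finite_domain {F : Type*} [Field F] [Fintype F] {v : F[X]}
    (hv : Irreducible v) {κ : Type*} [CommRing κ] [IsDomain κ] [Finite κ] [Algebra F[X] κ]
    (h : ∀ f : F[X], algebraMap F[X] κ f = 0 ↔ v ∣ f) :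
    ∃ k : ℕ, k ≠ 0 ∧ Nat.card κ = Fintype.card F ^ (v.natDegree * k) ∧
      ∀ z : κ, z ^ Fintype.card F ^ (v.natDegree * k) = z := by
  classical
  have _ : Fintype κ := Fintype.ofFinite κ
  let _ : Algebra F κ := ((algebraMap F[X] κ).comp C).toAlgebra
  have hcard := Module.card_eq_pow_finrank (K := F) (V := κ)
  have hfrob : ∀ z : κ, z ^ Fintype.card F ^ Module.finrank F κ = z := by
    intro z
    let _ : Field κ := Fintype.fieldOfDomain κ
    rw [← hcard]
    by_cases hz : z = 0
    · rw [hz, zero_pow Fintype.card_ne_zero]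
    · have h1 := pow_card_eq_one (x := Units.mk0 z hz)
      have h2 : z ^ (Fintype.card κ - 1) = 1 := by
        have h3 := congrArg Units.val h1
        rw [Fintype.card_units] at h3
        exact h3
      calc z ^ Fintype.card κ = z ^ (Fintype.card κ - 1 + 1) := by
            rw [Nat.sub_add_cancel Fintype.card_pos]
        _ = z := by rw [pow_succ, h2, one_mul]
  have hdr : v.natDegree ∣ Module.finrank F κ := by
    refine hv.natDegree_dvd_of_dvd_X_pow_card_pow_sub_X ?_
    rw [Nat.card_eq_fintype_card (α := F), ← h, map_sub, map_pow, hfrob, sub_self]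
  obtain ⟨k, hk⟩ := hdr
  rw [hk] at hcard hfrob
  refine ⟨k, ?_, by rw [Nat.card_eq_fintype_card, hcard], hfrob⟩
  rintro rfl
  rw [mul_zero, pow_zero] at hcard
  exact (Fintype.one_lt_card (α := κ)).ne' hcard

lemma finsum_units_eq_sum {κ L : Type*} [CommRing κ] [Finite κ] [Field L] [DecidableEq L]
    {t : κ → L} (hinj : Function.Injective t) (h1 : t 1 = 1)
    (hmul : ∀ z w, t (z * w) = t z * t w) {S : Finset L} (hS : ∀ w, w ∈ S ↔ ∃ z, t z = w)
    (hinv : ∀ w ∈ S, w⁻¹ ∈ S) {M : Type*} [AddCommMonoid M] (f : L → M) :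
    ∑ᶠ z : κˣ, f (t z) = ∑ w ∈ S.erase 0, f w := by
  have _ : Fintype κˣ := Fintype.ofFinite κˣ
  rw [finsum_eq_sum_of_fintype]
  refine Finset.sum_bij (fun z _ => t z) (fun z _ => ?_) (fun z _ w _ h => Units.ext (hinj h))
    (fun w hw => ?_) fun _ _ => rfl
  · rw [Finset.mem_erase, hS]
    refine ⟨fun h => ?_, z, rfl⟩
    have h2 := hmul z (z⁻¹ : κˣ)
    rw [Units.mul_inv, h1, h, zero_mul] at h2
    exact one_ne_zero h2
  · rw [Finset.mem_erase] at hw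
    obtain ⟨z, hz⟩ := (hS w).1 hw.2
    obtain ⟨z', hz'⟩ := (hS _).1 (hinv w hw.2)
    have h2 : z * z' = 1 := hinj (by rw [hmul, hz, hz', h1, mul_inv_cancel₀ hw.1])
    exact ⟨Units.mkOfMulEqOne z z' h2, Finset.mem_univ _, hz⟩

/-! ### The residue field of `O_n` at `𝔓` -/

section Residue

variable {F : Type*} [Field F] [Fintype F] (v : F[X]) [hv : Fact (Irreducible v)]

/-- The inclusion of `O_n` into `ℂ_v`. -/
def cycCoe (n : F[X]) : cycInt v n →ₐ[F[X]] Cv v :=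
  ((cycField v n).val.restrictScalars F[X]).comp (cycInt v n).val

instance (n : F[X]) : CommRing (cycInt v n ⧸ primeAbove v n) := Ideal.Quotient.commRing _

lemma cycCoe_injective (n : F[X]) : Function.Injective (cycCoe v n) :=
  Subtype.val_injective.comp Subtype.val_injective

lemma norm_cycCoe_le_one {n : F[X]} (a : cycInt v n) : ‖cycCoe v n a‖ ≤ 1 :=
  norm_le_one_of_isIntegral v (a.2.map ((cycField v n).val.restrictScalars F[X]))

variable {v}

lemma mem_primeAbove {n : F[X]} {a : cycInt v n} : a ∈ primeAbove v n ↔ ‖cycCoe v n a‖ < 1 :=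
  Iff.rfl

lemma mk_eq_mk_iff {n : F[X]} {a b : cycInt v n} :
    Ideal.Quotient.mk (primeAbove v n) a = Ideal.Quotient.mk (primeAbove v n) b ↔
      ‖cycCoe v n a - cycCoe v n b‖ < 1 := by
  rw [Ideal.Quotient.eq, mem_primeAbove, map_sub]

lemma primeAbove_isPrime (n : F[X]) : (primeAbove v n).IsPrime := by
  refine Ideal.isPrime_iff.2 ⟨?_, fun {a b} hab => ?_⟩
  · rw [Ne, Ideal.eq_top_iff_one, mem_primeAbove, map_one, norm_one]
    exact lt_irrefl _
  · rw [mem_primeAbove, map_mul, norm_mul] at hab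
    rw [mem_primeAbove, mem_primeAbove]
    by_contra! hcon
    have h1 := le_antisymm (norm_cycCoe_le_one v a) hcon.1
    have h2 := le_antisymm (norm_cycCoe_le_one v b) hcon.2
    rw [h1, h2, one_mul] at hab
    exact hab.false

lemma algebraMap_quot_eq_zero_iff {n : F[X]} (f : F[X]) :
    algebraMap F[X] (cycInt v n ⧸ primeAbove v n) f = 0 ↔ v ∣ f := by
  rw [← norm_toKv_lt_one_iff, ← norm_algebraMap_Cv, ← (cycCoe v n).commutes, ← mem_primeAbove,
    ← Ideal.Quotient.eq_zero_iff_mem]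
  rfl

/-- A torsion point of the Carlitz module, as an element of `O_n`. -/
def torsInt {n : F[X]} (hn : n.Monic) {z : Cv v} (hz : cAct n z = 0) : cycInt v n :=
  ⟨⟨z, IntermediateField.subset_adjoin _ _ hz⟩, by
    have h := isIntegral_torsion hn hz
    exact (isIntegral_algHom_iff ((cycField v n).val.restrictScalars F[X])
      Subtype.val_injective).1 h⟩

lemma cycCoe_torsInt {n : F[X]} (hn : n.Monic) {z : Cv v} (hz : cAct n z = 0) :
    cycCoe v n (torsInt hn hz) = z := rfl

variable (hmon : v.Monic) {l : ℕ} (hl : l ≠ 0) {n : F[X]} (hn : n.Monic) (hdvd : n ∣ v ^ l - 1)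
include hmon hl hn hdvd

/-- The condition in the definition of `teich` can be met, by `exists_mem_finSub_of_mem_cycField`.
-/
lemma teich_spec (z : cycInt v n ⧸ primeAbove v n) :
    teich v n (v.natDegree * l) z ^ Fintype.card F ^ (v.natDegree * l) =
      teich v n (v.natDegree * l) z ∧
    ∀ a : cycInt v n, Ideal.Quotient.mk (primeAbove v n) a = z →
        ‖(teich v n (v.natDegree * l) z : Cv v) - cycCoe v n a‖ < 1 := by
  refine Classical.epsilon_spec (p := fun ζ : compField v n (v.natDegree * l) =>
    ζ ^ Fintype.card F ^ (v.natDegree * l) = ζ ∧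
      ∀ a : cycInt v n, Ideal.Quotient.mk (primeAbove v n) a = z →
        ‖(ζ : Cv v) - cycCoe v n a‖ < 1) ?_
  obtain ⟨a₀, rfl⟩ := Ideal.Quotient.mk_surjective z
  obtain ⟨ζ, hζ, hζ'⟩ := exists_mem_finSub_of_mem_cycField hmon hl hn hdvd
    (y := cycCoe v n a₀) a₀.1.2 (norm_cycCoe_le_one v a₀)
  have hmem : ζ ∈ compField v n (v.natDegree * l) :=
    (le_sup_right : constField v (v.natDegree * l) ≤ compField v n (v.natDegree * l))
      (IntermediateField.subset_adjoin _ _ (mem_finSub.1 hζ))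
  refine ⟨⟨ζ, hmem⟩, Subtype.ext (mem_finSub.1 hζ), fun a ha => ?_⟩
  rw [mk_eq_mk_iff] at ha
  change ‖ζ - cycCoe v n a‖ < 1
  rw [← sub_add_sub_cancel ζ (cycCoe v n a₀)]
  refine (IsUltrametricDist.norm_add_le_max _ _).trans_lt (max_lt ?_ ?_)
  · rwa [norm_sub_rev]
  · rwa [norm_sub_rev]

omit hmon hl hn hdvd in
variable (v n l) in
/-- The Teichmüller character with values in `ℂ_v`. -/
def teichCv (z : cycInt v n ⧸ primeAbove v n) : Cv v := teich v n (v.natDegree * l) z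

lemma teichCv_mem (z : cycInt v n ⧸ primeAbove v n) :
    teichCv v l n z ∈ finSub v (v.natDegree * l) :=
  congrArg Subtype.val (teich_spec hmon hl hn hdvd z).1

lemma norm_teichCv_sub_lt (a : cycInt v n) :
    ‖teichCv v l n (Ideal.Quotient.mk (primeAbove v n) a) - cycCoe v n a‖ < 1 :=
  (teich_spec hmon hl hn hdvd _).2 a rfl

lemma teichCv_mk_eq_iff (a : cycInt v n) {ζ : Cv v} (hζ : ζ ∈ finSub v (v.natDegree * l)) :
    teichCv v l n (Ideal.Quotient.mk (primeAbove v n) a) = ζ ↔ ‖ζ - cycCoe v n a‖ < 1 := by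
  have hm0 : v.natDegree * l ≠ 0 := mul_ne_zero hv.out.natDegree_pos.ne' hl
  have h1 := norm_teichCv_sub_lt hmon hl hn hdvd a
  constructor
  · rintro rfl
    exact h1
  · intro h
    refine eq_of_mem_finSub_of_norm_lt hm0 (teichCv_mem hmon hl hn hdvd _) hζ ?_
    rw [← sub_sub_sub_cancel_right _ _ (cycCoe v n a)]
    exact (norm_sub_le_max_norm _ _).trans_lt (max_lt h1 h)

lemma teichCv_injective : Function.Injective (teichCv v l n) := by
  intro z w h
  obtain ⟨a, rfl⟩ := Ideal.Quotient.mk_surjective z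
  obtain ⟨b, rfl⟩ := Ideal.Quotient.mk_surjective w
  rw [mk_eq_mk_iff]
  have h1 := norm_teichCv_sub_lt hmon hl hn hdvd a
  have h2 := norm_teichCv_sub_lt hmon hl hn hdvd b
  rw [h] at h1
  rw [← sub_sub_sub_cancel_left _ _ (teichCv v l n (Ideal.Quotient.mk (primeAbove v n) b))]
  exact (norm_sub_le_max_norm _ _).trans_lt (max_lt h2 h1)

lemma teichCv_one : teichCv v l n (Ideal.Quotient.mk (primeAbove v n) 1) = 1 := by
  rw [teichCv_mk_eq_iff hmon hl hn hdvd _ (one_mem _), map_one, sub_self, norm_zero]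
  exact one_pos

lemma teichCv_mul (z w : cycInt v n ⧸ primeAbove v n) :
    teichCv v l n (z * w) = teichCv v l n z * teichCv v l n w := by
  have hm0 : v.natDegree * l ≠ 0 := mul_ne_zero hv.out.natDegree_pos.ne' hl
  obtain ⟨a, rfl⟩ := Ideal.Quotient.mk_surjective z
  obtain ⟨b, rfl⟩ := Ideal.Quotient.mk_surjective w
  have h1 := norm_teichCv_sub_lt hmon hl hn hdvd a
  have h2 := norm_teichCv_sub_lt hmon hl hn hdvd b
  rw [← map_mul, teichCv_mk_eq_iff hmon hl hn hdvd _
    (mul_mem (teichCv_mem hmon hl hn hdvd _) (teichCv_mem hmon hl hn hdvd _)), map_mul]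
  set A := teichCv v l n (Ideal.Quotient.mk (primeAbove v n) a)
  set B := teichCv v l n (Ideal.Quotient.mk (primeAbove v n) b)
  have hA : ‖A‖ ≤ 1 := norm_le_one_of_mem_finSub hm0 (teichCv_mem hmon hl hn hdvd _)
  have e : A * B - cycCoe v n a * cycCoe v n b =
      A * (B - cycCoe v n b) + (A - cycCoe v n a) * cycCoe v n b := by ring
  rw [e]
  refine (IsUltrametricDist.norm_add_le_max _ _).trans_lt (max_lt ?_ ?_)
  · rw [norm_mul]
    exact (mul_le_of_le_one_left (norm_nonneg _) hA).trans_lt h2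
  · rw [norm_mul]
    exact (mul_le_of_le_one_right (norm_nonneg _) (norm_cycCoe_le_one v b)).trans_lt h1

lemma finite_quot : Finite (cycInt v n ⧸ primeAbove v n) := by
  have hm0 : v.natDegree * l ≠ 0 := mul_ne_zero hv.out.natDegree_pos.ne' hl
  have h : Function.Injective (fun z => (⟨teichCv v l n z, (mem_finSubFin hm0).2
      (teichCv_mem hmon hl hn hdvd z)⟩ : finSubFin v (v.natDegree * l))) := fun z w h =>
    teichCv_injective hmon hl hn hdvd (by simpa only [Subtype.mk.injEq] using h)
  exact Finite.of_injective _ h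

/-- If `l` divides every `k > 0` with `n ∣ v ^ k - 1`, the residue field has at least
`q ^ (d l)` elements. -/
lemma card_quot_ge (hord : ∀ k : ℕ, n ∣ v ^ k - 1 → l ∣ k) :
    Fintype.card F ^ (v.natDegree * l) ≤ Nat.card (cycInt v n ⧸ primeAbove v n) := by
  have := primeAbove_isPrime (v := v) n
  have := finite_quot hmon hl hn hdvd
  have : IsDomain (cycInt v n ⧸ primeAbove v n) := Ideal.Quotient.isDomain _
  obtain ⟨k, hk0, hcard, hfrob⟩ := exists_card_eq_of_finite_domain hv.out
    (κ := cycInt v n ⧸ primeAbove v n) algebraMap_quot_eq_zero_iff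
  -- If the residue field has q^(dk) elements, C_(v^k - 1) reduces to zero on n-torsion points. Its
  -- values there are torsion points, so they vanish; hence n ∣ v^k - 1 and l ∣ k.
  have hkill : ∀ z : Cv v, cAct n z = 0 → cAct (v ^ k - 1) z = 0 := by
    intro z hz
    have h1 := hfrob (Ideal.Quotient.mk (primeAbove v n) (torsInt hn hz))
    rw [← map_pow, mk_eq_mk_iff, map_pow, cycCoe_torsInt] at h1
    have hz1 : ‖z‖ ≤ 1 := norm_cycCoe_le_one v (torsInt hn hz)
    have h2 := norm_cAct_v_pow_sub_lt hmon hz1 k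
    refine torsion_eq_zero hmon hl (z := cAct (v ^ k - 1) z) ?_ ?_
    · rw [cAct_sub_left, cAct_one, ← sub_add_sub_cancel _ (z ^ Fintype.card F ^ (v.natDegree * k))]
      exact (IsUltrametricDist.norm_add_le_max _ _).trans_lt (max_lt h2 h1)
    · refine torsion_of_dvd hmon hl hdvd ?_
      rw [← cAct_mul, mul_comm, cAct_mul, hz, cAct_zero]
  have hlk := hord k (dvd_of_torsion hmon hl hn hdvd hkill)
  rw [hcard]
  exact Nat.pow_le_pow_right Fintype.card_pos (Nat.mul_le_mul_left _ (Nat.le_of_dvd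
    (Nat.pos_of_ne_zero hk0) hlk))

lemma teichCv_surj (hord : ∀ k : ℕ, n ∣ v ^ k - 1 → l ∣ k) {w : Cv v}
    (hw : w ∈ finSub v (v.natDegree * l)) : ∃ z, teichCv v l n z = w := by
  classical
  have hm0 : v.natDegree * l ≠ 0 := mul_ne_zero hv.out.natDegree_pos.ne' hl
  have := finite_quot hmon hl hn hdvd
  let _ : Fintype (cycInt v n ⧸ primeAbove v n) := Fintype.ofFinite _
  have h1 : Finset.univ.image (teichCv v l n) = finSubFin v (v.natDegree * l) := by
    refine Finset.eq_of_subset_of_card_le (fun w hw => ?_) ?_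
    · obtain ⟨z, -, rfl⟩ := Finset.mem_image.1 hw
      exact (mem_finSubFin hm0).2 (teichCv_mem hmon hl hn hdvd z)
    · rw [Finset.card_image_of_injective _ (teichCv_injective hmon hl hn hdvd), card_finSubFin hm0,
        Finset.card_univ, ← Nat.card_eq_fintype_card (α := cycInt v n ⧸ primeAbove v n)]
      exact card_quot_ge hmon hl hn hdvd hord
  have h2 := (mem_finSubFin hm0).2 hw
  rw [← h1, Finset.mem_image] at h2
  obtain ⟨z, -, hz⟩ := h2
  exact ⟨z, hz⟩

/-! ### Evaluation of the Gauss sums -/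

/-- With w the Teichmüller representative of z, -λ_x(w) is an n-torsion point reducing to C_B(z).
Injectivity of reduction on torsion makes it the only one, hence the value of ω. -/
lemma omega_eq {x : Kv v} (hx1 : ‖x‖ ≤ 1) {B : F[X]} (hB : toKv v v ^ l * x = x + toKv v B)
    {c : F[X]} (hc : toKv v n * x = toKv v c) (z : cycInt v n ⧸ primeAbove v n) :
    cycCoe v n (omega v n (primeAbove v n) (aeval z (carlitz B))) =
      -lam v l x (teichCv v l n z) := by
  obtain ⟨a, rfl⟩ := Ideal.Quotient.mk_surjective z
  set w := teichCv v l n (Ideal.Quotient.mk (primeAbove v n) a) with hw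
  have hwm : w ∈ finSub v (v.natDegree * l) := teichCv_mem hmon hl hn hdvd _
  have hm0 : v.natDegree * l ≠ 0 := mul_ne_zero hv.out.natDegree_pos.ne' hl
  have htors : cAct n (-lam v l x w) = 0 := by
    rw [cAct_neg, cAct_lam_eq_zero hmon hl ⟨hx1, B, hB⟩ hwm hc, neg_zero]
  have hmem : torsInt hn htors ∈ {t : cycInt v n | aeval t (carlitz n) = 0} := by
    change cAct n (torsInt hn htors) = 0
    apply cycCoe_injective v n
    rw [map_cAct, cycCoe_torsInt, htors, map_zero]
  have hred : aeval (Ideal.Quotient.mk (primeAbove v n) a) (carlitz B) =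
      Ideal.Quotient.mk (primeAbove v n) (cAct B a) :=
    (map_cAct (Ideal.Quotient.mkₐ F[X] (primeAbove v n)) B a).symm
  have hmk : Ideal.Quotient.mk (primeAbove v n) (torsInt hn htors) =
      aeval (Ideal.Quotient.mk (primeAbove v n) a) (carlitz B) := by
    rw [hred, mk_eq_mk_iff, cycCoe_torsInt, map_cAct]
    have h1 := norm_lam_add_cAct_lt_one hmon hl hwm hx1 hB
    have h2 := norm_teichCv_sub_lt hmon hl hn hdvd a
    have e : -lam v l x w - cAct B (cycCoe v n a) =
        cAct B (w - cycCoe v n a) - (lam v l x w + cAct B w) := by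
      rw [cAct_sub]; ring
    rw [e]
    exact (norm_sub_le_max_norm _ _).trans_lt (max_lt ((norm_cAct_le B h2.le).trans_lt h2) h1)
  have hex : ∃ t ∈ {t : cycInt v n | aeval t (carlitz n) = 0},
      Ideal.Quotient.mk (primeAbove v n) t =
        aeval (Ideal.Quotient.mk (primeAbove v n) a) (carlitz B) := ⟨_, hmem, hmk⟩
  have ho1 := Function.invFunOn_mem hex
  have ho2 := Function.invFunOn_eq hex
  change aeval (omega v n (primeAbove v n) _) (carlitz n) = 0 at ho1
  change Ideal.Quotient.mk (primeAbove v n) (omega v n (primeAbove v n) _) = _ at ho2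
  replace ho2 := ho2.trans hmk.symm
  rw [mk_eq_mk_iff, cycCoe_torsInt] at ho2
  refine sub_eq_zero.1 (torsion_eq_zero hmon hl ho2 ?_)
  refine torsion_of_dvd hmon hl hdvd ?_
  rw [cAct_sub, htors, sub_zero, ← map_cAct]
  have ho3 : cAct n (omega v n (primeAbove v n)
    (aeval (Ideal.Quotient.mk (primeAbove v n) a) (carlitz B))) = 0 := ho1
  rw [ho3, map_zero]

/-- τ^s fixes ω and raises ψ to the power q^s. After inserting `omega_eq`, the sum over z becomes
-∑_t e_t(x) ∑_w w^(q^s) w^(-q^t), in which only t = s survives, with inner sum -1. The hypothesis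
`hord` ensures that w runs through all of F_(q^(dl)). -/
lemma coe_tauQ_pow_gaussSum (hord : ∀ k : ℕ, n ∣ v ^ k - 1 → l ∣ k)
    (τ : compField v n (v.natDegree * l) ≃ₐ[RatFunc F] compField v n (v.natDegree * l))
    (hτ : (∀ t : cycField v n, τ (cycToComp v n _ t) = cycToComp v n _ t) ∧
      ∀ ζ : compField v n (v.natDegree * l), ζ ^ Fintype.card F ^ (v.natDegree * l) = ζ →
        τ ζ = ζ ^ Fintype.card F)
    {x : Kv v} (hx1 : ‖x‖ ≤ 1) {B : F[X]} (hB : toKv v v ^ l * x = x + toKv v B)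
    {c : F[X]} (hc : toKv v n * x = toKv v c) {s : ℕ} (hs : s < v.natDegree * l) :
    (((τ ^ s) (1 + ∑ᶠ z : (cycInt v n ⧸ primeAbove v n)ˣ,
      cycToComp v n _ (omega v n (primeAbove v n)
        (aeval ((z⁻¹ : (cycInt v n ⧸ primeAbove v n)ˣ) : cycInt v n ⧸ primeAbove v n)
          (carlitz B))) * teich v n (v.natDegree * l) (z : cycInt v n ⧸ primeAbove v n)) :
        compField v n (v.natDegree * l)) : Cv v) = 1 + KvToCv v (cLim v l s x) := by
  classical
  have hm0 : v.natDegree * l ≠ 0 := mul_ne_zero hv.out.natDegree_pos.ne' hl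
  have := finite_quot hmon hl hn hdvd
  have hτ1 : ∀ (s : ℕ) (t : cycField v n), (τ ^ s) (cycToComp v n _ t) = cycToComp v n _ t := by
    intro s t
    induction s with
    | zero => rfl
    | succ s ih => rw [pow_succ, AlgEquiv.mul_apply, hτ.1, ih]
  have hτ2 : ∀ (s : ℕ) (ζ : compField v n (v.natDegree * l)),
      ζ ^ Fintype.card F ^ (v.natDegree * l) = ζ → (τ ^ s) ζ = ζ ^ Fintype.card F ^ s := by
    intro s ζ hζ
    induction s with
    | zero => simp
    | succ s ih =>
      rw [pow_succ, AlgEquiv.mul_apply, hτ.2 ζ hζ, map_pow, ih, ← pow_mul, ← pow_succ]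
  have hcoe : ∀ u : compField v n (v.natDegree * l),
      (u : Cv v) = (compField v n (v.natDegree * l)).val u := fun _ => rfl
  rw [map_add, map_one, hcoe, map_add, map_one]
  congr 1
  let g : compField v n (v.natDegree * l) →+ Cv v :=
    ((compField v n (v.natDegree * l)).val.toRingHom.comp (τ ^ s : _ ≃ₐ[RatFunc F] _).toRingHom)
  refine (map_finsum g (Set.toFinite _)).trans ?_
  have hterm : ∀ z : (cycInt v n ⧸ primeAbove v n)ˣ,
      (compField v n (v.natDegree * l)).val ((τ ^ s) (cycToComp v n _ (omega v n (primeAbove v n)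
        (aeval ((z⁻¹ : (cycInt v n ⧸ primeAbove v n)ˣ) : cycInt v n ⧸ primeAbove v n)
          (carlitz B))) * teich v n (v.natDegree * l) (z : cycInt v n ⧸ primeAbove v n))) =
      -(lam v l x (teichCv v l n (z : cycInt v n ⧸ primeAbove v n))⁻¹ *
        teichCv v l n (z : cycInt v n ⧸ primeAbove v n) ^ Fintype.card F ^ s) := by
    intro z
    rw [map_mul, hτ1, hτ2 s _ (teich_spec hmon hl hn hdvd _).1, map_mul, map_pow]
    have h1 := omega_eq hmon hl hn hdvd hx1 hB hc
      ((z⁻¹ : (cycInt v n ⧸ primeAbove v n)ˣ) : cycInt v n ⧸ primeAbove v n)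
    have h2 : teichCv v l n ((z⁻¹ : (cycInt v n ⧸ primeAbove v n)ˣ) : cycInt v n ⧸ primeAbove v n) =
        (teichCv v l n (z : cycInt v n ⧸ primeAbove v n))⁻¹ := by
      refine eq_inv_of_mul_eq_one_left ?_
      rw [← teichCv_mul hmon hl hn hdvd, Units.inv_mul]
      exact teichCv_one hmon hl hn hdvd
    rw [h2] at h1
    rw [neg_mul_eq_neg_mul, ← h1]
    rfl
  refine (finsum_congr hterm).trans ?_
  have hS : ∀ w, w ∈ finSubFin v (v.natDegree * l) ↔ ∃ z, teichCv v l n z = w := fun w => by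
    rw [mem_finSubFin hm0]
    exact ⟨teichCv_surj hmon hl hn hdvd hord, fun ⟨z, hz⟩ =>
      hz ▸ teichCv_mem hmon hl hn hdvd z⟩
  rw [finsum_units_eq_sum (teichCv_injective hmon hl hn hdvd)
    (teichCv_one hmon hl hn hdvd) (teichCv_mul hmon hl hn hdvd) hS
    (fun w hw => (mem_finSubFin hm0).2 (inv_mem_finSub ((mem_finSubFin hm0).1 hw)))
    fun w => -(lam v l x w⁻¹ * w ^ Fintype.card F ^ s), Finset.sum_neg_distrib]
  have hexp : ∀ w : Cv v, lam v l x w⁻¹ * w ^ Fintype.card F ^ s =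
      ∑ t ∈ Finset.range (v.natDegree * l), KvToCv v (cLim v l t x) *
        (w ^ Fintype.card F ^ s * w⁻¹ ^ Fintype.card F ^ t) := by
    intro w
    rw [lam, Finset.sum_mul]
    exact Finset.sum_congr rfl fun t _ => by ring
  rw [Finset.sum_congr rfl fun w _ => hexp w, Finset.sum_comm]
  rw [Finset.sum_eq_single_of_mem s (Finset.mem_range.2 hs)]
  · rw [← Finset.mul_sum, sum_pow_mul_inv_pow_self hm0, mul_neg, mul_one, neg_neg]
  · intro t ht hts
    rw [← Finset.mul_sum, sum_pow_mul_inv_pow_eq_zero hm0 hs (Finset.mem_range.1 ht) hts.symm,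
      mul_zero]

end Residue

/-! ### The completion of `k` at a place above infinity

Torsion points of the Carlitz module are constructed in `F((u))`, where `θ = -u ^ (1 - q)`. -/

section Infinity

variable (F : Type*) [Field F] [Fintype F]

/-- The field `F((u))`, regarded as a `k`-algebra through `θ = -u ^ (1 - q)`. -/
def InfField := LaurentSeries F

instance : Field (InfField F) := inferInstanceAs (Field (LaurentSeries F))

/-- Power series, as elements of `F((u))`. -/
def psToInf : PowerSeries F →+* InfField F := HahnSeries.ofPowerSeries ℤ F

/-- The uniformizer `u`. -/
def infU : InfField F := psToInf F PowerSeries.X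

instance : Algebra F[X] (InfField F) :=
  (eval₂RingHom ((psToInf F).comp PowerSeries.C) (-(infU F ^ (Fintype.card F - 1)))⁻¹).toAlgebra

lemma psToInf_injective : Function.Injective (psToInf F) := HahnSeries.ofPowerSeries_injective

lemma infU_ne_zero : infU F ≠ 0 :=
  (map_ne_zero_iff _ (psToInf_injective F)).2 PowerSeries.X_ne_zero

lemma algebraMap_inf_C (c : F) :
    algebraMap F[X] (InfField F) (C c) = psToInf F (PowerSeries.C c) :=
  eval₂_C _ _

lemma algebraMap_inf_X :
    algebraMap F[X] (InfField F) X = (-(infU F ^ (Fintype.card F - 1)))⁻¹ :=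
  eval₂_X _ _

/-- θ has a pole: reversing f turns f(θ) = 0 into an identity of power series in u whose constant
term is the leading coefficient of f. -/
lemma algebraMap_inf_injective : Function.Injective (algebraMap F[X] (InfField F)) := by
  rw [injective_iff_map_eq_zero]
  intro f hf
  change eval₂ ((psToInf F).comp PowerSeries.C) _ f = 0 at hf
  have hne : (-(infU F ^ (Fintype.card F - 1)))⁻¹ ≠ 0 :=
    inv_ne_zero (neg_ne_zero.2 (pow_ne_zero _ (infU_ne_zero F)))
  let _ := invertibleOfNonzero hne
  rw [← eval₂_reverse_eq_zero_iff, invOf_eq_inv, inv_inv] at hf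
  have h1 : -(infU F ^ (Fintype.card F - 1)) =
      psToInf F (-(PowerSeries.X ^ (Fintype.card F - 1))) := by
    rw [map_neg, map_pow]; rfl
  rw [h1, ← hom_eval₂, map_eq_zero_iff _ (psToInf_injective F)] at hf
  have h2 := congrArg PowerSeries.constantCoeff hf
  have hq : Fintype.card F - 1 ≠ 0 := (Nat.sub_pos_of_lt Fintype.one_lt_card).ne'
  rw [hom_eval₂, map_neg, map_pow, PowerSeries.constantCoeff_X, zero_pow hq, neg_zero, eval₂_at_zero,
    map_zero, coeff_zero_reverse] at h2
  simpa using h2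

instance : Algebra (RatFunc F) (InfField F) :=
  (IsFractionRing.lift (algebraMap_inf_injective F)).toAlgebra

instance : IsScalarTower F[X] (RatFunc F) (InfField F) :=
  IsScalarTower.of_algebraMap_eq fun f =>
    (IsFractionRing.lift_algebraMap (algebraMap_inf_injective F) f).symm

variable {F}

/-- The only elements of `F((u))` that are algebraic over `F` are the constants. -/
lemma exists_eq_const_of_pow_eq {f : InfField F} {m : ℕ} (hm : m ≠ 0)
    (hf : f ^ Fintype.card F ^ m = f) : ∃ c : F, f = algebraMap F[X] (InfField F) (C c) := by
  set c : F := HahnSeries.coeff (f : LaurentSeries F) 0 with hc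
  refine ⟨c, ?_⟩
  set g : InfField F := f - algebraMap F[X] (InfField F) (C c) with hg
  have hgq : g ^ Fintype.card F ^ m = g := by rw [hg, frobPow_sub F, hf, frobPow_const]
  by_contra hne
  have hg0 : g ≠ 0 := sub_ne_zero.2 hne
  -- A nonzero g with g^(q^m) = g has order 0, but the coefficient of g at 0 has been subtracted.
  have h1 : HahnSeries.order (g ^ Fintype.card F ^ m : LaurentSeries F) =
      Fintype.card F ^ m • HahnSeries.order (g : LaurentSeries F) := HahnSeries.order_pow _ _
  have h1' : HahnSeries.order (g : LaurentSeries F) =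
      Fintype.card F ^ m • HahnSeries.order (g : LaurentSeries F) := by
    rw [← h1]; exact congrArg (HahnSeries.order (Γ := ℤ) (R := F)) hgq.symm
  have h2 : HahnSeries.order (g : LaurentSeries F) = 0 := by
    have h3 : (1 : ℤ) < (Fintype.card F ^ m : ℕ) := by
      exact_mod_cast Nat.one_lt_pow hm Fintype.one_lt_card
    rw [nsmul_eq_mul] at h1'
    rcases lt_trichotomy (HahnSeries.order (g : LaurentSeries F)) 0 with h | h | h
    · nlinarith
    · exact h
    · nlinarith
  have h4 : HahnSeries.coeff (g : LaurentSeries F) (HahnSeries.order (g : LaurentSeries F)) ≠ 0 :=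
    fun h => hg0 (HahnSeries.coeff_order_eq_zero.1 h)
  rw [h2] at h4
  apply h4
  have h5 : HahnSeries.coeff (g : LaurentSeries F) 0 =
      HahnSeries.coeff (f : LaurentSeries F) 0 -
      HahnSeries.coeff (psToInf F (PowerSeries.C c) : LaurentSeries F) 0 := by
    rw [hg, algebraMap_inf_C]; rfl
  have h6 : HahnSeries.coeff (psToInf F (PowerSeries.C c) : LaurentSeries F) 0 = c := by
    have h7 := HahnSeries.ofPowerSeries_apply_coeff (Γ := ℤ) (PowerSeries.C c) 0
    rw [PowerSeries.coeff_zero_C] at h7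
    exact h7
  rw [h5, h6, hc, sub_self]

/-- w(u)^q = w(u^q) because the coefficients lie in F; truncation reduces this to polynomials. -/
lemma coeff_pow_card (w : PowerSeries F) (j : ℕ) :
    PowerSeries.coeff j (w ^ Fintype.card F) =
      if Fintype.card F ∣ j then PowerSeries.coeff (j / Fintype.card F) w else 0 := by
  have h1 := PowerSeries.trunc_trunc_pow w (j + 1) (Fintype.card F)
  have h2 := congrArg (fun g : F[X] => g.coeff j) h1
  simp only [PowerSeries.coeff_trunc, Nat.lt_succ_self, if_true] at h2
  rw [← h2, ← Polynomial.coe_pow, Polynomial.coeff_coe, ← FiniteField.expand_card,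
    coeff_expand Fintype.card_pos]
  split_ifs with h
  · rw [PowerSeries.coeff_trunc, if_pos (Nat.lt_succ_of_le (Nat.div_le_self _ _))]
  · rfl

variable (F) in
/-- The coefficients of the solution `P = ∑ P_j u ^ j` of `P - P(u ^ q) = -θ u ^ (q - 1) P` with
`P_0 = 1`. -/
def genCoeff (j : ℕ) : F[X] :=
  if h : j = 0 ∨ Fintype.card F ≤ 1 then 1 else
    (if Fintype.card F ∣ j then genCoeff (j / Fintype.card F) else 0) -
      if Fintype.card F - 1 ≤ j then X * genCoeff (j - (Fintype.card F - 1)) else 0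
termination_by j
decreasing_by
  · exact Nat.div_lt_self (by omega) (by omega)
  · omega

lemma genCoeff_zero : genCoeff F 0 = 1 := by rw [genCoeff, dif_pos (Or.inl rfl)]

/-- The power series `∑ f (P_j a) u ^ j` attached to a linear functional `f`. -/
def torsSeries (f : F[X] →ₗ[F] F) (a : F[X]) : PowerSeries F :=
  PowerSeries.mk fun j => f (genCoeff F j * a)

/-- The functional is applied to the recursion for the P_j. Its values lie in F, so the q-th power
of the series is the substitution of u^q for u. -/
lemma torsSeries_sub_pow (f : F[X] →ₗ[F] F) (a : F[X]) :
    torsSeries f a - torsSeries f a ^ Fintype.card F =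
      -(PowerSeries.X ^ (Fintype.card F - 1) * torsSeries f (X * a)) := by
  ext j
  rw [map_sub, coeff_pow_card, map_neg, PowerSeries.coeff_X_pow_mul', torsSeries, torsSeries,
    PowerSeries.coeff_mk, PowerSeries.coeff_mk, PowerSeries.coeff_mk]
  have hq : 0 < Fintype.card F - 1 := Nat.sub_pos_of_lt Fintype.one_lt_card
  by_cases hj : j = 0
  · subst hj
    rw [if_pos (dvd_zero _), Nat.zero_div, sub_self, if_neg hq.not_ge, neg_zero]
  · conv_lhs => rw [genCoeff, dif_neg (not_or.2 ⟨hj, Fintype.one_lt_card.not_ge⟩), sub_mul, map_sub]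
    have e : X * genCoeff F (j - (Fintype.card F - 1)) * a =
      genCoeff F (j - (Fintype.card F - 1)) * (X * a) := by ring
    split_ifs <;> simp [e]

/-- Write S_a for the series of a. As S_a^q = S_a + u^(q-1) S_(θa) and θ = -u^(1-q), the terms
u^(-q) S_a cancel in C_θ(u⁻¹ S_a), leaving u⁻¹ S_(θa). A functional vanishing on the multiples of n
thus yields an n-torsion point. -/
lemma cAct_torsSeries (f : F[X] →ₗ[F] F) (b : F[X]) :
    cAct b ((infU F)⁻¹ * psToInf F (torsSeries f 1)) = (infU F)⁻¹ * psToInf F (torsSeries f b) := by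
  have hC : ∀ (c : F) (a : F[X]), torsSeries f (C c * a) = PowerSeries.C c * torsSeries f a := by
    intro c a
    ext j
    rw [PowerSeries.coeff_C_mul, torsSeries, torsSeries, PowerSeries.coeff_mk,
      PowerSeries.coeff_mk, mul_left_comm, ← smul_eq_C_mul, map_smul, smul_eq_mul]
  have aux : ∀ {K : Type _} [Field K] {u : K} (_ : u ≠ 0) (r : ℕ) (A B : K),
      (-(u ^ r))⁻¹ * (u⁻¹ * A) + u⁻¹ ^ (r + 1) * (A + u ^ r * B) = u⁻¹ * B := by
    intro K _ u hu r A B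
    rw [inv_pow]
    field_simp
    ring
  have hX : ∀ a : F[X], cAct (X : F[X]) ((infU F)⁻¹ * psToInf F (torsSeries f a)) =
      (infU F)⁻¹ * psToInf F (torsSeries f (X * a)) := by
    intro a
    have h1 : torsSeries f a ^ Fintype.card F = torsSeries f a +
        PowerSeries.X ^ (Fintype.card F - 1) * torsSeries f (X * a) := by
      rw [← sub_eq_iff_eq_add', ← neg_sub, torsSeries_sub_pow, neg_neg]
    have h2 : psToInf F (PowerSeries.X) = infU F := rfl
    obtain ⟨r, hr⟩ : ∃ r, Fintype.card F = r + 1 :=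
      ⟨_, (Nat.succ_pred_eq_of_pos Fintype.card_pos).symm⟩
    rw [cAct_X, algebraMap_inf_X, mul_pow, ← map_pow, h1, map_add, map_mul, map_pow, h2]
    rw [hr, Nat.add_sub_cancel]
    exact aux (infU_ne_zero F) r _ _
  induction b using Polynomial.induction_on with
  | C c =>
    have h := hC c 1
    rw [mul_one] at h
    rw [cAct_C, h, map_mul, algebraMap_inf_C]; ring
  | add p q hp hq =>
    have h : torsSeries f (p + q) = torsSeries f p + torsSeries f q := by
      ext j; simp [torsSeries, mul_add]
    rw [cAct_add_left, hp, hq, h, map_add, mul_add]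
  | monomial n c ih =>
    have e : C c * X ^ (n + 1) = X * (C c * X ^ n) := by ring
    rw [e, cAct_X_mul, ih, hX]

/-- The polynomial `C_n(z)` splits over `F((u))`. -/
lemma carlitz_splits {n : F[X]} (hn : n.Monic) :
    ((carlitz n).map (algebraMap F[X] (InfField F))).Splits := by
  classical
  have hc := carlitz_monic hn
  have hmon : ((carlitz n).map (algebraMap F[X] (InfField F))).Monic := hc.1.map _
  have : Module.Finite F (AdjoinRoot n) := (AdjoinRoot.powerBasis' hn).finite
  have : Finite (Module.Dual F (AdjoinRoot n)) := Module.finite_of_finite F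
  have _ : Fintype (Module.Dual F (AdjoinRoot n)) := Fintype.ofFinite _
  have hcard : Fintype.card (Module.Dual F (AdjoinRoot n)) = Fintype.card F ^ n.natDegree := by
    rw [Module.card_eq_pow_finrank (K := F), Subspace.dual_finrank_eq,
      (AdjoinRoot.powerBasis' hn).finrank, AdjoinRoot.powerBasis'_dim]
  -- Each functional μ on A/n gives a root of C_n. It is determined by its root, since μ(b) is the
  -- constant term of u C_b(z μ). There are q^(deg n) functionals, as many as the degree of C_n.
  let z : Module.Dual F (AdjoinRoot n) → InfField F := fun μ =>
    (infU F)⁻¹ * psToInf F (torsSeries (μ ∘ₗ (AdjoinRoot.mkₐ n).toLinearMap.restrictScalars F) 1)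
  have hinj : Function.Injective z := by
    intro μ μ' h
    refine LinearMap.ext fun b' => ?_
    obtain ⟨b, rfl⟩ := AdjoinRoot.mk_surjective b'
    have h1 := congrArg (cAct b) h
    simp only [z, cAct_torsSeries] at h1
    have h2 := psToInf_injective F (mul_left_cancel₀ (inv_ne_zero (infU_ne_zero F)) h1)
    have h3 := congrArg (PowerSeries.coeff 0) h2
    simpa [torsSeries, genCoeff_zero] using h3
  rw [splits_iff_card_roots]
  refine le_antisymm (card_roots' _) ?_
  rw [hc.1.natDegree_map, hc.2, ← hcard, ← Finset.card_univ, ← Finset.card_image_of_injective _ hinj]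
  refine (Finset.card_le_card fun y hy => ?_).trans (Multiset.toFinset_card_le _)
  obtain ⟨μ, -, rfl⟩ := Finset.mem_image.1 hy
  rw [Multiset.mem_toFinset, mem_roots hmon.ne_zero, IsRoot.def, eval_map_algebraMap]
  change cAct n (z μ) = 0
  simp only [z, cAct_torsSeries]
  have h0 : torsSeries (μ ∘ₗ (AdjoinRoot.mkₐ n).toLinearMap.restrictScalars F) n = 0 := by
    ext j
    rw [torsSeries, PowerSeries.coeff_mk, map_zero]
    change μ (AdjoinRoot.mk n (genCoeff F j * n)) = 0
    rw [map_mul, AdjoinRoot.mk_self, mul_zero, map_zero]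
  rw [h0, map_zero, mul_zero]

end Infinity

/-! ### The automorphism `τ_q` -/

lemma exists_algHom_adjoin_simple {K L : Type*} [Field K] [Field L] [Algebra K L] {ζ ξ : L}
    (h : IsIntegral K ζ) (hξ : aeval ξ (minpoly K ζ) = 0) :
    ∃ φ : IntermediateField.adjoin K {ζ} →ₐ[K] L,
      φ (IntermediateField.AdjoinSimple.gen K ζ) = ξ :=
  ⟨(IntermediateField.algHomAdjoinIntegralEquiv K h).symm
      ⟨ξ, mem_aroots.2 ⟨minpoly.ne_zero h, hξ⟩⟩,
    IntermediateField.algHomAdjoinIntegralEquiv_symm_apply_gen _ h _⟩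

section Tau

variable {F : Type*} [Field F] [Fintype F] {v : F[X]} [hv : Fact (Irreducible v)]

lemma isIntegral_of_pow_eq {m : ℕ} (hm : m ≠ 0) {z : Cv v} (hz : z ^ Fintype.card F ^ m = z)
    (K : Type*) [Field K] [Algebra K (Cv v)] : IsIntegral K z := by
  refine ⟨X ^ Fintype.card F ^ m - X, monic_X_pow_sub ?_, ?_⟩
  · rw [degree_X]
    exact_mod_cast Nat.one_lt_pow hm Fintype.one_lt_card
  · rw [eval₂_sub, eval₂_pow, eval₂_X, hz, sub_self]

lemma isIntegral_of_mem_compField {n : F[X]} (hn : n.Monic) {m : ℕ} (hm : m ≠ 0) {z : Cv v}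
    (hz : z ∈ compField v n m) : IsIntegral (RatFunc F) z := by
  rw [compField, cycField, constField, ← IntermediateField.adjoin_union] at hz
  have h := IntermediateField.isAlgebraic_adjoin (K := RatFunc F) (L := Cv v)
    (S := {z : Cv v | aeval z (carlitz n) = 0} ∪ {z : Cv v | z ^ Fintype.card F ^ m = z}) (by
      rintro y (hy | hy)
      · exact (isIntegral_torsion hn hy).tower_top
      · exact isIntegral_of_pow_eq hm hy _)
  exact ((h.isAlgebraic ⟨z, hz⟩).isIntegral).map (IntermediateField.val _)

/-- The field `K_n` has no constants besides those in `F`. -/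
lemma exists_eq_const_of_mem_cycField {n : F[X]} (hn : n.Monic) {m : ℕ} (hm : m ≠ 0)
    {y : cycField v n} (hy : y ^ Fintype.card F ^ m = y) :
    ∃ c : F, y = algebraMap F[X] (cycField v n) (C c) := by
  have hK : ∀ s ∈ {z : Cv v | aeval z (carlitz n) = 0}, IsIntegral (RatFunc F) s ∧
      ((minpoly (RatFunc F) s).map (algebraMap (RatFunc F) (InfField F))).Splits := by
    intro s hs
    refine ⟨(isIntegral_torsion hn hs).tower_top, (carlitz_splits hn).of_dvd
      ((carlitz_monic hn).1.map _).ne_zero ?_⟩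
    rw [IsScalarTower.algebraMap_eq F[X] (RatFunc F) (InfField F), ← Polynomial.map_map]
    refine Polynomial.map_dvd _ (minpoly.dvd _ _ ?_)
    rw [aeval_map_algebraMap]
    exact hs
  have hσ : Nonempty (cycField v n →ₐ[RatFunc F] InfField F) :=
    IntermediateField.nonempty_algHom_adjoin_of_splits hK
  obtain ⟨σ⟩ := hσ
  have h1 : σ y ^ Fintype.card F ^ m = σ y := by rw [← map_pow, hy]
  obtain ⟨c, hc⟩ := exists_eq_const_of_pow_eq hm h1
  refine ⟨c, σ.injective ?_⟩
  change σ y = σ (algebraMap F[X] (cycField v n) (C c))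
  rw [hc, IsScalarTower.algebraMap_apply F[X] (RatFunc F) (InfField F), ← σ.commutes]
  rfl

lemma exists_finSub_generator (v : F[X]) [hv : Fact (Irreducible v)] {m : ℕ} (hm : m ≠ 0) :
    ∃ ζ : Cv v, ζ ^ Fintype.card F ^ m = ζ ∧
      ∀ η : Cv v, η ^ Fintype.card F ^ m = η → η = 0 ∨ ∃ i : ℤ, η = ζ ^ i := by
  have hQ : 1 < Fintype.card F ^ m := Nat.one_lt_pow hm Fintype.one_lt_card
  have : NeZero (Fintype.card F ^ m - 1) := ⟨by omega⟩
  obtain ⟨g, hg⟩ := IsCyclic.exists_generator (α := rootsOfUnity (Fintype.card F ^ m - 1) (Cv v))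
  refine ⟨(g : (Cv v)ˣ), ?_, fun η hη => ?_⟩
  · have h1 := congrArg Units.val ((mem_rootsOfUnity _ _).1 g.2)
    rw [Units.val_pow_eq_pow_val, Units.val_one] at h1
    calc ((g : (Cv v)ˣ) : Cv v) ^ Fintype.card F ^ m
        = ((g : (Cv v)ˣ) : Cv v) ^ (Fintype.card F ^ m - 1) * ((g : (Cv v)ˣ) : Cv v) := by
          rw [← pow_succ, Nat.sub_add_cancel hQ.le]
      _ = _ := by rw [h1, one_mul]
  · by_cases h0 : η = 0
    · exact Or.inl h0
    right
    have h1 : Units.mk0 η h0 ∈ rootsOfUnity (Fintype.card F ^ m - 1) (Cv v) := by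
      rw [mem_rootsOfUnity]
      ext
      rw [Units.val_pow_eq_pow_val, Units.val_one, Units.val_mk0]
      refine mul_right_cancel₀ h0 ?_
      rw [← pow_succ, Nat.sub_add_cancel hQ.le, hη, one_mul]
    obtain ⟨i, hi⟩ := hg ⟨_, h1⟩
    refine ⟨i, ?_⟩
    have h2 := congrArg (fun u : rootsOfUnity (Fintype.card F ^ m - 1) (Cv v) =>
      ((u : (Cv v)ˣ) : Cv v)) hi
    simpa using h2.symm

/-- The minimal polynomial over `K_n` of an element of a finite field has coefficients in `F`. -/
lemma aeval_minpoly_pow_card {n : F[X]} (hn : n.Monic) {m : ℕ} (hm : m ≠ 0) {ζ : Cv v}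
    (hζ : ζ ^ Fintype.card F ^ m = ζ) :
    aeval (ζ ^ Fintype.card F) (minpoly (cycField v n) ζ) = 0 := by
  have hint : IsIntegral (cycField v n) ζ := isIntegral_of_pow_eq hm hζ _
  set P := minpoly (cycField v n) ζ with hP
  have hmon : P.Monic := minpoly.monic hint
  have hfrob : ∀ k : ℕ, aeval (ζ ^ Fintype.card F ^ k)
      (P.map (frobHom F (cycField v n) ^ k)) = 0 := by
    intro k
    have h1 : (algebraMap (cycField v n) (Cv v)).comp (frobHom F (cycField v n) ^ k) =
        (frobHom F (Cv v) ^ k).comp (algebraMap (cycField v n) (Cv v)) := by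
      ext y
      rw [RingHom.comp_apply, RingHom.comp_apply, frobHom_pow_apply, frobHom_pow_apply, map_pow]
    rw [aeval_def, eval₂_map, h1, ← frobHom_pow_apply, ← hom_eval₂, ← aeval_def, hP,
      minpoly.aeval, map_zero]
  -- The case k = m shows that the coefficients of P are fixed by the q^m-power map, hence are
  -- constants of K_n and lie in F. The case k = 1 then says that ζ^q is a root of P itself.
  have h1 := hfrob m
  rw [hζ] at h1
  have h2 : P.map (frobHom F (cycField v n) ^ m) = P := by
    refine (eq_of_monic_of_dvd_of_natDegree_le hmon (hmon.map _) (minpoly.dvd _ _ h1) ?_)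
    exact natDegree_map_le
  have h3 : P.map (frobHom F (cycField v n) ^ 1) = P := by
    ext i
    have h4 := congrArg (fun R : (cycField v n)[X] => R.coeff i) h2
    simp only [coeff_map, frobHom_pow_apply] at h4 ⊢
    obtain ⟨c, hc⟩ := exists_eq_const_of_mem_cycField hn hm h4
    rw [hc, frobPow_const]
  have h5 := hfrob 1
  rwa [h3, pow_one] at h5

/-- Let ζ generate the multiplicative group of F_(q^m). By `aeval_minpoly_pow_card` the assignment ζ
↦ ζ^q extends to a K_n-embedding of K_n(ζ). It maps the compositum into itself, and an endomorphism
of an algebraic extension is bijective. -/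
lemma exists_tauQ {n : F[X]} (hn : n.Monic) {m : ℕ} (hm : m ≠ 0) :
    ∃ τ : compField v n m ≃ₐ[RatFunc F] compField v n m,
      (∀ t : cycField v n, τ (cycToComp v n m t) = cycToComp v n m t) ∧
        ∀ ζ : compField v n m, ζ ^ Fintype.card F ^ m = ζ → τ ζ = ζ ^ Fintype.card F := by
  obtain ⟨ζ, hζ, hgen⟩ := exists_finSub_generator v hm
  have hint : IsIntegral (cycField v n) ζ := isIntegral_of_pow_eq hm hζ _
  let N : IntermediateField (cycField v n) (Cv v) := IntermediateField.adjoin (cycField v n) {ζ}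
  obtain ⟨φ, hφ⟩ : ∃ φ : N →ₐ[cycField v n] Cv v,
      φ (IntermediateField.AdjoinSimple.gen _ ζ) = ζ ^ Fintype.card F :=
    exists_algHom_adjoin_simple hint (aeval_minpoly_pow_card hn hm hζ)
  have hζN : ζ ∈ N := IntermediateField.mem_adjoin_simple_self _ _
  have hφζ : φ ⟨ζ, hζN⟩ = ζ ^ Fintype.card F := hφ
  have hφη : ∀ (η : Cv v) (hη : η ∈ N), η ^ Fintype.card F ^ m = η →
      φ ⟨η, hη⟩ = η ^ Fintype.card F := by
    intro η hη hη'
    rcases hgen η hη' with rfl | ⟨i, rfl⟩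
    · rw [zero_pow Fintype.card_ne_zero]
      exact map_zero φ
    · have h1 : (⟨ζ ^ i, hη⟩ : N) = ⟨ζ, hζN⟩ ^ i := rfl
      rw [h1, map_zpow₀, hφζ, ← zpow_natCast, ← zpow_natCast, ← zpow_mul, ← zpow_mul, mul_comm]
  have hle : compField v n m ≤ N.restrictScalars (RatFunc F) := by
    refine sup_le (fun y hy => ?_) (IntermediateField.adjoin_le_iff.2 fun η hη => ?_)
    · exact N.algebraMap_mem ⟨y, hy⟩
    · rcases hgen η hη with rfl | ⟨i, rfl⟩
      · exact zero_mem N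
      · exact zpow_mem hζN i
  let ψ : compField v n m →ₐ[RatFunc F] Cv v :=
    (φ.restrictScalars (RatFunc F)).comp (IntermediateField.inclusion hle)
  have hψ1 : ∀ (y : Cv v) (hy : y ∈ compField v n m), y ∈ cycField v n → ψ ⟨y, hy⟩ = y :=
    fun y hy hy' => φ.commutes ⟨y, hy'⟩
  have hψ2 : ∀ (η : Cv v) (hη : η ∈ compField v n m), η ^ Fintype.card F ^ m = η →
      ψ ⟨η, hη⟩ = η ^ Fintype.card F := fun η hη => hφη η (hle hη)
  have hψmem : ∀ (y : Cv v) (hy : y ∈ compField v n m), ψ ⟨y, hy⟩ ∈ compField v n m := by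
    have hun : compField v n m = IntermediateField.adjoin (RatFunc F)
      ({z : Cv v | aeval z (carlitz n) = 0} ∪ {z : Cv v | z ^ Fintype.card F ^ m = z}) := by
      rw [IntermediateField.adjoin_union]; rfl
    intro y hy
    have hy' := hy
    rw [hun] at hy'
    have key : ∃ hy : y ∈ compField v n m, ψ ⟨y, hy⟩ ∈ compField v n m := by
      refine IntermediateField.adjoin_induction (F := RatFunc F)
        (p := fun y _ => ∃ hy : y ∈ compField v n m, ψ ⟨y, hy⟩ ∈ compField v n m)
        ?_ ?_ ?_ ?_ ?_ hy'
      · intro z hz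
        have hzc : z ∈ compField v n m := by
          rw [hun]; exact IntermediateField.subset_adjoin _ _ hz
        refine ⟨hzc, ?_⟩
        rcases hz with hz | hz
        · rw [hψ1 z hzc (IntermediateField.subset_adjoin _ _ hz)]; exact hzc
        · rw [hψ2 z hzc hz]; exact pow_mem hzc _
      · intro x
        refine ⟨IntermediateField.algebraMap_mem _ x, ?_⟩
        have h1 := ψ.commutes x
        exact h1.symm ▸ IntermediateField.algebraMap_mem _ x
      · rintro x y - - ⟨hx, hx'⟩ ⟨hy, hy'⟩
        refine ⟨add_mem hx hy, ?_⟩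
        have h1 := map_add ψ ⟨x, hx⟩ ⟨y, hy⟩
        exact h1.symm ▸ add_mem hx' hy'
      · rintro x - ⟨hx, hx'⟩
        refine ⟨inv_mem hx, ?_⟩
        have h1 := map_inv₀ ψ ⟨x, hx⟩
        exact h1.symm ▸ inv_mem hx'
      · rintro x y - - ⟨hx, hx'⟩ ⟨hy, hy'⟩
        refine ⟨mul_mem hx hy, ?_⟩
        have h1 := map_mul ψ ⟨x, hx⟩ ⟨y, hy⟩
        exact h1.symm ▸ mul_mem hx' hy'
    exact key.2
  let χ : compField v n m →ₐ[RatFunc F] compField v n m :=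
    ψ.codRestrict (compField v n m).toSubalgebra fun y => hψmem y.1 y.2
  have halg : Algebra.IsAlgebraic (RatFunc F) (compField v n m) := ⟨fun y =>
    ((isIntegral_algHom_iff (compField v n m).val Subtype.val_injective).1
      (isIntegral_of_mem_compField hn hm y.2)).isAlgebraic⟩
  refine ⟨AlgEquiv.ofBijective χ (Algebra.IsAlgebraic.algHom_bijective χ), fun t => ?_,
    fun η hη => ?_⟩
  · exact Subtype.ext (hψ1 t.1 _ t.2)
  · exact Subtype.ext (hψ2 η.1 η.2 (congrArg Subtype.val hη))

lemma tauQ_spec {n : F[X]} (hn : n.Monic) {m : ℕ} (hm : m ≠ 0) :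
    (∀ t : cycField v n, tauQ v n m (cycToComp v n m t) = cycToComp v n m t) ∧
      ∀ ζ : compField v n m, ζ ^ Fintype.card F ^ m = ζ → tauQ v n m ζ = ζ ^ Fintype.card F :=
  Classical.epsilon_spec (exists_tauQ hn hm)

end Tau

/-! ### The factors of the arithmetic gamma function -/

section ProdMonic

variable {F : Type*} [Field F] [Fintype F] {L : Type*} [Field L] [Algebra F[X] L]

/-- By the product formula, the inverse of the product of the monics of degree T is the coefficient
of X^(q^T) in E_T; the recursion for `cBinPoly` relates these coefficients. -/
lemma prod_monicFin_succ (hinj : Function.Injective (algebraMap F[X] L)) (T : ℕ) :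
    ∏ a ∈ monicFin F (T + 1), algebraMap F[X] L a =
      (algebraMap F[X] L X ^ Fintype.card F ^ (T + 1) - algebraMap F[X] L X) *
        (∏ a ∈ monicFin F T, algebraMap F[X] L a) ^ Fintype.card F := by
  have : Infinite L := Infinite.of_injective _ hinj
  have key : ∀ T : ℕ, (∏ a ∈ monicFin F T, algebraMap F[X] L a)⁻¹ =
      (cBinPoly F L T).coeff (Fintype.card F ^ T) := by
    intro T
    have h1 : ∏ a ∈ monicFin F T, (1 + C (algebraMap F[X] L a)⁻¹ * X) = 1 + cBinPoly F L T := by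
      refine Polynomial.funext fun z => ?_
      rw [eval_prod, eval_add, eval_one, eval_cBinPoly, ← prod_one_add_div hinj]
      exact Finset.prod_congr rfl fun a _ => by simp [div_eq_inv_mul]
    have h2 := coeff_prod_of_natDegree_le (monicFin F T)
      (fun a => 1 + C (algebraMap F[X] L a)⁻¹ * X) 1 fun a _ =>
        (natDegree_add_le _ _).trans (by
          simpa using (natDegree_C_mul_le (algebraMap F[X] L a)⁻¹ X).trans natDegree_X_le)
    rw [h1, card_monicFin, mul_one, coeff_add, coeff_one,
      if_neg (pow_pos Fintype.card_pos T).ne', zero_add] at h2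
    rw [h2, ← Finset.prod_inv_distrib]
    refine Finset.prod_congr rfl fun a _ => ?_
    simp [coeff_one]
  rw [← inv_inj, mul_inv, ← inv_pow, key, key, cBinPoly, coeff_C_mul, coeff_sub, pow_succ' _ T,
    coeff_pow_of_natDegree_le (natDegree_cBinPoly_le T),
    coeff_eq_zero_of_natDegree_lt (n := Fintype.card F * Fintype.card F ^ T), sub_zero]
  refine (natDegree_cBinPoly_le T).trans_lt ?_
  exact lt_mul_of_one_lt_left (pow_pos Fintype.card_pos T) Fintype.one_lt_card

end ProdMonic

section Ari

variable {F : Type*} [Field F] [Fintype F] {v : F[X]} [hv : Fact (Irreducible v)]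

variable (v) in
/-- The element `θ ^ (q ^ t) - θ` of `k_v`. -/
def bracket (t : ℕ) : Kv v := toKv v X ^ Fintype.card F ^ t - toKv v X

lemma bracket_succ_ne_zero (t : ℕ) : bracket v (t + 1) ≠ 0 :=
  theta_pow_sub_ne_zero (toKv_injective v) t

lemma prod_toKv_ne_zero (t : ℕ) : ∏ a ∈ monicFin F t, toKv v a ≠ 0 :=
  Finset.prod_ne_zero_iff.2 fun _ ha =>
    (map_ne_zero_iff _ (toKv_injective v)).2 (mem_monicFin.1 ha).1.ne_zero

/-- The multiples of v among the monics of degree t + d are the v b with b monic of degree t: this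
is `prod_coflat_add` at Y = 0. -/
lemma ariFactor_mul (hmon : v.Monic) (t : ℕ) :
    ariFactor v (t + v.natDegree) *
        (toKv v v ^ Fintype.card F ^ t * ∏ a ∈ monicFin F t, toKv v a) =
      -∏ a ∈ monicFin F (t + v.natDegree), toKv v a := by
  have h0 := prod_coflat_add (v := v) hmon (Y := 0) (Y' := 0) (c := 0) (by simp) (by
    rw [degree_zero]; exact WithBot.bot_lt_coe _) (by simp [toKv]) t
  simp only [zero_add] at h0
  rw [Finset.prod_mul_distrib, Finset.prod_const, card_monicFin] at h0
  rw [← h0, ariFactor_eq, neg_mul, ← Finset.prod_mul_distrib]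
  simp only [flatV_mul_coflat]

/-- Let D_t be the product of the monics of degree t. Combine `ariFactor_mul` with D_(t+1) =
(θ^(q^(t+1)) - θ) D_t^q: the powers of v match, and the sign survives because (-1)^q = -1 in F. -/
lemma ariFactor_succ (hmon : v.Monic) (t : ℕ) :
    ariFactor v (t + 1 + v.natDegree) * bracket v (t + 1) =
      ariFactor v (t + v.natDegree) ^ Fintype.card F * bracket v (t + 1 + v.natDegree) := by
  have h1 := ariFactor_mul hmon t
  have h2 := ariFactor_mul hmon (t + 1)
  have hs : t + 1 + v.natDegree = t + v.natDegree + 1 := by ring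
  have hq0 : (0 : Kv v) ^ Fintype.card F = 0 := zero_pow Fintype.card_ne_zero
  have hneg : ∀ x : Kv v, (-x) ^ Fintype.card F = -x ^ Fintype.card F := fun x => by
    rw [← zero_sub, frob_sub (F := F), hq0, zero_sub]
  rw [prod_monicFin_succ (toKv_injective v), hs, prod_monicFin_succ (toKv_injective v)] at h2
  have h3 := congrArg (· ^ Fintype.card F) h1
  simp only [hneg, mul_pow, ← pow_mul, ← pow_succ] at h3
  have hne : toKv v v ^ Fintype.card F ^ (t + 1) *
      (∏ a ∈ monicFin F t, toKv v a) ^ Fintype.card F ≠ 0 :=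
    mul_ne_zero (pow_ne_zero _ (norm_pos_iff.1 (norm_v_pos v)))
      (pow_ne_zero _ (prod_toKv_ne_zero t))
  refine mul_right_cancel₀ hne ?_
  rw [hs]
  unfold bracket
  linear_combination h2 -
    (toKv v X ^ Fintype.card F ^ (t + v.natDegree + 1) - toKv v X) * h3

/-- X^(q^(t+1)) - X has derivative -1, so v divides it at most once. -/
lemma norm_v_le_norm_bracket (t : ℕ) : ‖toKv v v‖ ≤ ‖bracket v (t + 1)‖ := by
  have e : bracket v (t + 1) = toKv v (X ^ Fintype.card F ^ (t + 1) - X) := by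
    simp [bracket, toKv]
  rw [e]
  by_cases h : v ∣ (X ^ Fintype.card F ^ (t + 1) - X : F[X])
  · obtain ⟨g, hg⟩ := h
    have hvg : ¬ v ∣ g := by
      rintro ⟨g', rfl⟩
      have h1 := congrArg derivative hg
      have hq : ((Fintype.card F : ℕ) : F) = 0 := FiniteField.cast_card_eq_zero F
      have h2 : derivative (X ^ Fintype.card F ^ (t + 1) - X : F[X]) = -1 := by
        rw [derivative_sub, derivative_X_pow, derivative_X, Nat.cast_pow, hq,
          zero_pow (Nat.succ_ne_zero t), C_0, zero_mul, zero_sub]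
      rw [h2, derivative_mul, derivative_mul] at h1
      refine hv.out.not_isUnit (isUnit_of_dvd_one (?_ : v ∣ 1))
      rw [← dvd_neg, h1]
      exact ⟨derivative v * g' + (derivative v * g' + v * derivative g'), by ring⟩
    have h3 : toKv v (v * g) = toKv v v * toKv v g := map_mul _ _ _
    rw [hg, h3, norm_mul, (norm_toKv_eq_one_iff v g).2 hvg, mul_one]
  · rw [(norm_toKv_eq_one_iff v _).2 h]
    exact (norm_v_lt_one v).le

/-- The difference is the q^t-th power of θ^(q^d) - θ, which is divisible by v. -/
lemma norm_bracket_add_sub_le (t : ℕ) :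
    ‖bracket v (t + v.natDegree) - bracket v t‖ ≤ ‖toKv v v‖ ^ Fintype.card F ^ t := by
  have e : bracket v (t + v.natDegree) - bracket v t =
      (toKv v (X ^ Fintype.card F ^ v.natDegree - X)) ^ Fintype.card F ^ t := by
    rw [toKv, map_sub, map_pow, frobPow_sub F, ← pow_mul, ← pow_add, add_comm v.natDegree]
    simp only [bracket]
    ring
  rw [e, norm_pow]
  obtain ⟨g, hg⟩ := v_dvd_pow_card_pow_sub v (X : F[X])
  refine pow_le_pow_left₀ (norm_nonneg _) ?_ _
  have h3 : toKv v (v * g) = toKv v v * toKv v g := map_mul _ _ _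
  rw [hg, h3, norm_mul]
  exact mul_le_of_le_one_right (norm_nonneg _) (norm_toKv_le_one v g)

/-- Wilson's theorem modulo `v`. -/
lemma norm_ariFactor_natDegree_sub_one_lt (hmon : v.Monic) :
    ‖ariFactor v v.natDegree - 1‖ < 1 := by
  classical
  have : Module.Finite F (AdjoinRoot v) := (AdjoinRoot.powerBasis' hmon).finite
  have : Finite (AdjoinRoot v) := Module.finite_of_finite F
  let _ : Fintype (AdjoinRoot v) := Fintype.ofFinite _
  have hmk : ∀ a : F[X], AdjoinRoot.mk v a = 0 ↔ v ∣ a := fun a => AdjoinRoot.mk_eq_zero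
  set P : F[X] := ∏ a ∈ (monicFin F v.natDegree).filter fun a => ¬ v ∣ a, a with hP
  have h1 : ariFactor v v.natDegree = -toKv v P := by
    rw [ariFactor_eq, hP, toKv, map_prod, Finset.prod_filter]
    congr 1
    refine Finset.prod_congr rfl fun a _ => ?_
    split_ifs with h
    · exact flatV_of_norm_ne_one v fun h' => (norm_toKv_eq_one_iff v a).1 h' h
    · exact flatV_of_norm_eq_one v ((norm_toKv_eq_one_iff v a).2 h)
  have h2 : AdjoinRoot.mk v P = -1 := by
    have h3 := congrArg Units.val (FiniteField.prod_univ_units_id_eq_neg_one (K := AdjoinRoot v))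
    rw [Units.coe_prod, Units.val_neg, Units.val_one] at h3
    rw [← h3, hP, map_prod]
    -- Each nonzero residue class contains exactly one monic polynomial of degree d, namely v + (f
    -- mod v).
    refine Finset.prod_bij (fun a ha => Units.mk0 (AdjoinRoot.mk v a)
      fun h => (Finset.mem_filter.1 ha).2 ((hmk a).1 h)) (fun a _ => Finset.mem_univ _)
      (fun a ha b hb h => ?_) (fun u _ => ?_) fun a _ => rfl
    · have h4 : AdjoinRoot.mk v a = AdjoinRoot.mk v b := congrArg Units.val h
      rw [AdjoinRoot.mk_eq_mk] at h4
      have ha' := mem_monicFin.1 (Finset.mem_filter.1 ha).1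
      have hb' := mem_monicFin.1 (Finset.mem_filter.1 hb).1
      by_contra hne
      have hdeg : (a - b).degree < v.degree := by
        have h5 := degree_sub_lt_left (p := a) (q := b) (by
          rw [degree_eq_natDegree ha'.1.ne_zero, degree_eq_natDegree hb'.1.ne_zero, ha'.2, hb'.2])
          ha'.1.ne_zero (by rw [ha'.1, hb'.1])
        rwa [degree_eq_natDegree ha'.1.ne_zero, ha'.2, ← degree_eq_natDegree hmon.ne_zero] at h5
      exact absurd (degree_le_of_dvd h4 (sub_ne_zero.2 hne)) hdeg.not_ge
    · obtain ⟨f, hf⟩ := AdjoinRoot.mk_surjective (u : AdjoinRoot v)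
      have hlt := degree_modByMonic_lt f hmon
      have hm : AdjoinRoot.mk v (v + f %ₘ v) = u := by
        rw [← hf, AdjoinRoot.mk_eq_mk, modByMonic_eq_sub_mul_div]
        exact ⟨1 - f /ₘ v, by ring⟩
      refine ⟨v + f %ₘ v, ?_, Units.ext hm⟩
      rw [Finset.mem_filter, mem_monicFin, ← hmk, hm]
      refine ⟨⟨hmon.add_of_left hlt, ?_⟩, u.ne_zero⟩
      exact natDegree_eq_of_degree_eq (degree_add_eq_left_of_degree_lt hlt)
  rw [h1, ← norm_neg]
  have e : -(-toKv v P - 1) = toKv v (P + 1) := by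
    have h3 : toKv v (P + 1) = toKv v P + 1 := by
      have := map_add (algebraMap F[X] (Kv v)) P 1
      rwa [map_one] at this
    rw [h3]; ring
  rw [e, norm_toKv_lt_one_iff, ← hmk, map_add, map_one, h2, neg_add_cancel]

/-- By `ariFactor_succ`, passing to the next factor is raising to the q-th power and multiplying by
a quotient ρ of brackets that is close to 1. -/
lemma norm_ariFactor_succ_sub_one_le (hmon : v.Monic) (t : ℕ) :
    ‖ariFactor v (t + 1 + v.natDegree) - 1‖ ≤
      max (‖ariFactor v (t + v.natDegree) - 1‖ ^ Fintype.card F) (‖toKv v v‖ ^ (t + 1)) := by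
  set ρ := bracket v (t + 1 + v.natDegree) / bracket v (t + 1) with hρ
  have h1 : ariFactor v (t + 1 + v.natDegree) = ariFactor v (t + v.natDegree) ^ Fintype.card F * ρ := by
    rw [hρ, ← mul_div_assoc, ← ariFactor_succ hmon, mul_div_cancel_right₀ _ (bracket_succ_ne_zero t)]
  have hρ1 : ‖ρ - 1‖ ≤ ‖toKv v v‖ ^ (t + 1) := by
    have hb := norm_v_le_norm_bracket (v := v) t
    have hb0 := (norm_v_pos v).trans_le hb
    rw [hρ, div_sub_one (bracket_succ_ne_zero t), norm_div, div_le_iff₀ hb0]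
    refine (norm_bracket_add_sub_le (t + 1)).trans ?_
    calc ‖toKv v v‖ ^ Fintype.card F ^ (t + 1) ≤ ‖toKv v v‖ ^ (t + 1 + 1) :=
          pow_le_pow_of_le_one (norm_nonneg _) (norm_v_lt_one v).le
            (Nat.lt_pow_self Fintype.one_lt_card)
      _ = ‖toKv v v‖ ^ (t + 1) * ‖toKv v v‖ := pow_succ _ _
      _ ≤ _ := by gcongr
  have e : ariFactor v (t + 1 + v.natDegree) - 1 =
      ariFactor v (t + v.natDegree) ^ Fintype.card F * (ρ - 1) +
        (ariFactor v (t + v.natDegree) - 1) ^ Fintype.card F := by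
    rw [h1, frob_sub (F := F), one_pow]; ring
  rw [e]
  refine (IsUltrametricDist.norm_add_le_max _ _).trans (max_le ?_ ?_)
  · rw [norm_mul, norm_pow, norm_ariFactor, one_pow, one_mul]
    exact hρ1.trans (le_max_right _ _)
  · rw [norm_pow]
    exact le_max_left _ _

lemma tendsto_ariFactor (hmon : v.Monic) : Tendsto (ariFactor v) atTop (𝓝 1) := by
  set c := max ‖ariFactor v v.natDegree - 1‖ ‖toKv v v‖ with hc
  have hc1 : c < 1 := max_lt (norm_ariFactor_natDegree_sub_one_lt hmon) (norm_v_lt_one v)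
  have hc0 : 0 ≤ c := (norm_nonneg _).trans (le_max_right _ _)
  -- The second bound supplies the extra factor c in each step; c^0 = 1 alone would not start the
  -- induction.
  have key : ∀ k : ℕ, ‖ariFactor v (k + v.natDegree) - 1‖ ≤ c ^ k ∧
      ‖ariFactor v (k + v.natDegree) - 1‖ ≤ c := by
    intro k
    induction k with
    | zero =>
      rw [zero_add, pow_zero]
      exact ⟨(norm_ariFactor_natDegree_sub_one_lt hmon).le, le_max_left _ _⟩
    | succ k ih =>
      have h1 := norm_ariFactor_succ_sub_one_le hmon k
      have h2 : ‖ariFactor v (k + v.natDegree) - 1‖ ^ Fintype.card F ≤ c ^ (k + 1) := by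
        calc ‖ariFactor v (k + v.natDegree) - 1‖ ^ Fintype.card F
            ≤ ‖ariFactor v (k + v.natDegree) - 1‖ ^ 2 :=
              pow_le_pow_of_le_one (norm_nonneg _) (ih.2.trans hc1.le) Fintype.one_lt_card
          _ = ‖ariFactor v (k + v.natDegree) - 1‖ * ‖ariFactor v (k + v.natDegree) - 1‖ := sq _
          _ ≤ c ^ k * c := mul_le_mul ih.1 ih.2 (norm_nonneg _) (pow_nonneg hc0 _)
          _ = _ := (pow_succ _ _).symm
      have h3 : ‖ariFactor v (k + 1 + v.natDegree) - 1‖ ≤ c ^ (k + 1) :=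
        h1.trans (max_le h2 (pow_le_pow_left₀ (norm_nonneg _) (le_max_right _ _) _))
      refine ⟨h3, h3.trans ?_⟩
      exact pow_le_of_le_one hc0 hc1.le (Nat.succ_ne_zero k)
  rw [← tendsto_add_atTop_iff_nat v.natDegree, tendsto_iff_norm_sub_tendsto_zero]
  exact squeeze_zero (fun _ => norm_nonneg _) (fun k => (key k).1)
    (tendsto_pow_atTop_nhds_zero_of_lt_one hc0 hc1)

/-! ### Algebraicity of the arithmetic gamma values -/

lemma progProd_eq_mul {f : ℕ → Kv v} (hf : ∀ i, ‖f i‖ = 1) (h : Tendsto f atTop (𝓝 1)) {m : ℕ}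
    (hm : m ≠ 0) (s : ℕ) : progProd f m s = f s * progProd f m (s + m) := by
  refine tendsto_nhds_unique
    ((tendsto_add_atTop_iff_nat 1).2 (tendsto_progProd hf h hm s)) ?_
  refine ((tendsto_progProd hf h hm (s + m)).const_mul (f s)).congr fun J => ?_
  rw [Finset.prod_range_succ', mul_zero, add_zero, mul_comm]
  congr 1
  exact Finset.prod_congr rfl fun j _ => by rw [mul_add, mul_one, add_assoc, add_comm m]

lemma isAlgebraic_toKv (a : F[X]) : IsAlgebraic (RatFunc F) (toKv v a) := by
  rw [toKv_eq]; exact isAlgebraic_algebraMap _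

lemma isAlgebraic_flatV_toKv (a : F[X]) : IsAlgebraic (RatFunc F) (flatV v (toKv v a)) := by
  rw [toKv_eq, flatV_algebraMap]; exact isAlgebraic_algebraMap _

lemma isAlgebraic_prod {K L ι : Type*} [Field K] [Field L] [Algebra K L] (s : Finset ι) (f : ι → L)
    (h : ∀ i ∈ s, IsAlgebraic K (f i)) : IsAlgebraic K (∏ i ∈ s, f i) := by
  classical
  induction s using Finset.induction_on with
  | empty => exact isAlgebraic_one
  | insert i s hi ih =>
    rw [Finset.prod_insert hi]
    exact (h i (Finset.mem_insert_self i s)).mul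
      (ih fun j hj => h j (Finset.mem_insert_of_mem hj))

lemma isAlgebraic_ariFactor (t : ℕ) : IsAlgebraic (RatFunc F) (ariFactor v t) := by
  rw [ariFactor_eq]
  exact (isAlgebraic_prod _ _ fun a _ => isAlgebraic_flatV_toKv a).neg

lemma prod_ariFactor_succ (hmon : v.Monic) (t J : ℕ) :
    (∏ j ∈ Finset.range J, ariFactor v (t + 1 + v.natDegree + v.natDegree * j)) *
        bracket v (t + 1) =
      (∏ j ∈ Finset.range J, ariFactor v (t + v.natDegree + v.natDegree * j)) ^ Fintype.card F *
        bracket v (t + 1 + v.natDegree * J) := by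
  induction J with
  | zero => simp
  | succ J ih =>
    have h := ariFactor_succ hmon (t + v.natDegree * J)
    rw [Finset.prod_range_succ, Finset.prod_range_succ, mul_pow]
    have e1 : t + v.natDegree * J + 1 + v.natDegree = t + 1 + v.natDegree + v.natDegree * J := by
      ring
    have e2 : t + v.natDegree * J + 1 = t + 1 + v.natDegree * J := by ring
    have e3 : t + v.natDegree * J + v.natDegree = t + v.natDegree + v.natDegree * J := by ring
    have e4 : t + 1 + v.natDegree * (J + 1) = t + 1 + v.natDegree + v.natDegree * J := by ring
    rw [e1, e2, e3] at h
    rw [e4]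
    linear_combination ariFactor v (t + 1 + v.natDegree + v.natDegree * J) * ih +
      (∏ j ∈ Finset.range J, ariFactor v (t + v.natDegree + v.natDegree * j)) ^ Fintype.card F * h

/-- When `ariFactor_succ` is multiplied along a progression modulo d, the brackets telescope to a
limit L. L + θ is the limit of θ^(q^(t+1+dJ)), which is fixed by the q^d-power map, so L is
algebraic. It is nonzero as a quotient of nonzero products. -/
lemma progProd_ariFactor_pow_card (hmon : v.Monic) (t : ℕ) :
    ∃ c : Kv v, c ≠ 0 ∧ IsAlgebraic (RatFunc F) c ∧
      progProd (ariFactor v) v.natDegree (t + v.natDegree) ^ Fintype.card F =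
        c * progProd (ariFactor v) v.natDegree (t + 1 + v.natDegree) := by
  have hd : v.natDegree ≠ 0 := hv.out.natDegree_pos.ne'
  have hA := tendsto_ariFactor hmon
  have hn : ∀ i, ‖ariFactor v i‖ = 1 := norm_ariFactor v
  set W := progProd (ariFactor v) v.natDegree (t + v.natDegree) with hW
  set W' := progProd (ariFactor v) v.natDegree (t + 1 + v.natDegree) with hW'
  have hW0 : W ≠ 0 := progProd_ne_zero hn hA hd _
  have hW0' : W' ≠ 0 := progProd_ne_zero hn hA hd _
  set L := W' * bracket v (t + 1) / W ^ Fintype.card F with hL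
  have hL0 : L ≠ 0 := div_ne_zero (mul_ne_zero hW0' (bracket_succ_ne_zero t)) (pow_ne_zero _ hW0)
  have hlim : Tendsto (fun J => bracket v (t + 1 + v.natDegree * J)) atTop (𝓝 L) := by
    refine (((tendsto_progProd hn hA hd (t + 1 + v.natDegree)).mul_const (bracket v (t + 1))).div
      ((tendsto_progProd hn hA hd (t + v.natDegree)).pow (Fintype.card F))
      (pow_ne_zero _ hW0)).congr fun J => ?_
    rw [Pi.div_apply, prod_ariFactor_succ hmon, mul_div_cancel_left₀]
    refine pow_ne_zero _ (Finset.prod_ne_zero_iff.2 fun j _ => ?_)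
    rw [← norm_ne_zero_iff, hn]
    exact one_ne_zero
  have hθ : Tendsto (fun J => toKv v X ^ Fintype.card F ^ (t + 1 + v.natDegree * J)) atTop
      (𝓝 (L + toKv v X)) := by
    refine (hlim.add_const (toKv v X)).congr fun J => ?_
    rw [bracket, sub_add_cancel]
  have hfix : (L + toKv v X) ^ Fintype.card F ^ v.natDegree = L + toKv v X := by
    refine tendsto_nhds_unique (hθ.pow _) ?_
    refine ((tendsto_add_atTop_iff_nat 1).2 hθ).congr fun J => ?_
    rw [← pow_mul, ← pow_add]
    congr 2
    ring
  have hLalg : IsAlgebraic (RatFunc F) L := by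
    have h1 : IsAlgebraic (RatFunc F) (L + toKv v X) := by
      refine ⟨(X ^ Fintype.card F ^ v.natDegree - X : (RatFunc F)[X]), ?_, by simp [hfix]⟩
      refine (monic_X_pow_sub ?_).ne_zero
      rw [degree_X]
      exact_mod_cast Nat.one_lt_pow hd Fintype.one_lt_card
    have h2 := h1.sub (isAlgebraic_toKv X)
    rwa [add_sub_cancel_right] at h2
  refine ⟨bracket v (t + 1) / L, div_ne_zero (bracket_succ_ne_zero t) hL0, ?_, ?_⟩
  · rw [div_eq_mul_inv]
    exact (((isAlgebraic_toKv (v := v) X).pow _).sub (isAlgebraic_toKv X)).mul hLalg.inv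
  · rw [hL]
    have := bracket_succ_ne_zero (v := v) t
    field_simp

/-- After d steps of `progProd_ariFactor_pow_card` the class modulo d is the same again, so W^(q^d)
is an algebraic multiple of W, and W^(q^d - 1) is algebraic. -/
lemma isAlgebraic_progProd_ariFactor (hmon : v.Monic) (s : ℕ) :
    IsAlgebraic (RatFunc F) (progProd (ariFactor v) v.natDegree s) := by
  have hd : v.natDegree ≠ 0 := hv.out.natDegree_pos.ne'
  have hA := tendsto_ariFactor hmon
  have hn : ∀ i, ‖ariFactor v i‖ = 1 := norm_ariFactor v
  rw [progProd_eq_mul hn hA hd]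
  refine (isAlgebraic_ariFactor s).mul ?_
  have hiter : ∀ k : ℕ, ∃ c : Kv v, c ≠ 0 ∧ IsAlgebraic (RatFunc F) c ∧
      progProd (ariFactor v) v.natDegree (s + v.natDegree) ^ Fintype.card F ^ k =
        c * progProd (ariFactor v) v.natDegree (s + k + v.natDegree) := by
    intro k
    induction k with
    | zero => exact ⟨1, one_ne_zero, isAlgebraic_one, by simp⟩
    | succ k ih =>
      obtain ⟨c, hc0, hc, h⟩ := ih
      obtain ⟨c', hc0', hc', h'⟩ := progProd_ariFactor_pow_card hmon (s + k)
      refine ⟨c ^ Fintype.card F * c', mul_ne_zero (pow_ne_zero _ hc0) hc0', (hc.pow _).mul hc', ?_⟩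
      rw [pow_succ, pow_mul, h, mul_pow, h', ← add_assoc, mul_assoc]
  obtain ⟨c, hc0, hc, h⟩ := hiter v.natDegree
  set W := progProd (ariFactor v) v.natDegree (s + v.natDegree) with hW
  have hW0 : W ≠ 0 := progProd_ne_zero hn hA hd _
  have h1 : W = ariFactor v (s + v.natDegree) *
      progProd (ariFactor v) v.natDegree (s + v.natDegree + v.natDegree) :=
    progProd_eq_mul hn hA hd _
  have hA0 : ariFactor v (s + v.natDegree) ≠ 0 := by
    rw [← norm_ne_zero_iff, hn]; exact one_ne_zero
  have hQ : 1 < Fintype.card F ^ v.natDegree := Nat.one_lt_pow hd Fintype.one_lt_card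
  have h2 : W ^ (Fintype.card F ^ v.natDegree - 1) = c / ariFactor v (s + v.natDegree) := by
    refine mul_right_cancel₀ hW0 ?_
    rw [← pow_succ, Nat.sub_add_cancel hQ.le, h]
    conv_rhs => rw [h1]
    field_simp
  refine IsAlgebraic.of_pow (n := Fintype.card F ^ v.natDegree - 1) (by omega) ?_
  rw [h2, div_eq_mul_inv]
  exact hc.mul (isAlgebraic_ariFactor _).inv

end Ari

/-! ### Gross–Koblitz–Thakur formulas in `k_v` -/

section Formula

variable {F : Type*} [Field F] [Fintype F] {v : F[X]} [hv : Fact (Irreducible v)]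
variable (hmon : v.Monic) {l : ℕ} (hl : l ≠ 0) {x : RatFunc F} (hx : IsTors v l x)
  {xd : ℕ → F[X]} (hxd : ∀ i < l, (xd i).degree < v.natDegree)
  (hxs : fracInf x = ∑ i ∈ Finset.range l, toK (xd i) * toK v ^ i / (toK v ^ l - 1))

/-- The product `∏_j ∏_{a ∈ A_{+, s + d l j}} a^♭ / (⟨v ^ i x⟩ + a)^♭`. -/
def geoProg (v : F[X]) [Fact (Irreducible v)] (l : ℕ) (x : RatFunc F) (i s : ℕ) : Kv v :=
  progProd (geoFactor v (fracKv v i x)) (v.natDegree * l) s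

open Classical in
/-- The number `δ_{x, i}` for `s = d i + deg x_i`, and `1` for all other `s`. -/
def deltaDigit (v : F[X]) (l : ℕ) (xd : ℕ → F[X]) (x : RatFunc F) (s : ℕ) : RatFunc F :=
  if xd (s / v.natDegree) ∈ monicFin F (s % v.natDegree) then
    toK v * fracX v (l - s / v.natDegree - 1) x
  else 1

include hmon hl hx hxd hxs

omit hxd in
-- It is a proper fraction plus the nonzero polynomial x_i, and these cannot cancel.
lemma toK_mul_fracX_ne_zero (hxd : ∀ i < l, (xd i).degree < v.natDegree) {i : ℕ} (hi : i < l)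
    (h0 : xd i ≠ 0) : toK v * fracX v (l - i - 1) x ≠ 0 := by
  rw [v_mul_fracX_eq hmon hl hx hxd hxs hi]
  have hN := pow_sub_one_ne_zero' hmon hl
  obtain ⟨r, hr, hr'⟩ := exists_fracX_eq hmon hl hx (l - i - 1 + 1)
  rw [hr']
  intro h
  have h1 : r + xd i * (v ^ l - 1) = 0 := by
    apply toK_injective
    have h2 := toK_ne_zero hN
    rw [div_add' _ _ _ h2, div_eq_zero_iff, or_iff_left h2] at h
    rw [map_add, map_mul, map_zero]
    exact h
  have h2 : (xd i * (v ^ l - 1)).degree = r.degree := by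
    rw [← neg_eq_of_add_eq_zero_right h1, degree_neg]
  have h3 : (v ^ l - 1).degree ≤ (xd i * (v ^ l - 1)).degree := by
    rw [mul_comm]; exact degree_le_mul_left _ h0
  exact absurd (h3.trans h2.le) hr.not_ge

lemma delta_ne_zero {i : ℕ} (hi : i < l) : delta v l xd x i ≠ 0 := by
  unfold delta
  split_ifs with h
  · exact toK_mul_fracX_ne_zero hmon hl hx hxs hxd hi h.ne_zero
  · exact one_ne_zero

lemma deltaDigit_ne_zero {s : ℕ} (hs : s < v.natDegree * l) : deltaDigit v l xd x s ≠ 0 := by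
  unfold deltaDigit
  split_ifs with h
  · exact toK_mul_fracX_ne_zero hmon hl hx hxs hxd (Nat.div_lt_of_lt_mul hs)
      (mem_monicFin.1 h).1.ne_zero
  · exact one_ne_zero

omit hmon hl hx hxs in
lemma prod_deltaDigit_pow (c : ℕ → ℕ) :
    ∏ s ∈ Finset.range (v.natDegree * l), deltaDigit v l xd x s ^ c s =
      ∏ i ∈ Finset.range l, delta v l xd x i ^ c (v.natDegree * i + (xd i).natDegree) := by
  classical
  have hd : 0 < v.natDegree := hv.out.natDegree_pos
  rw [prod_range_mul_eq, Finset.prod_comm]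
  refine Finset.prod_congr rfl fun i hi => ?_
  have hterm : ∀ s ∈ Finset.range v.natDegree, deltaDigit v l xd x (s + v.natDegree * i) =
      if xd i ∈ monicFin F s then toK v * fracX v (l - i - 1) x else 1 := by
    intro s hs
    have hs' := Finset.mem_range.1 hs
    rw [deltaDigit, Nat.add_mul_div_left _ _ hd, Nat.div_eq_of_lt hs', zero_add,
      Nat.add_mul_mod_self_left, Nat.mod_eq_of_lt hs']
  rw [Finset.prod_congr rfl fun s hs => by rw [hterm s hs]]
  unfold delta
  by_cases h : (xd i).Monic
  · have hdeg : (xd i).natDegree < v.natDegree := by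
      have h1 := hxd i (Finset.mem_range.1 hi)
      rwa [degree_eq_natDegree h.ne_zero, Nat.cast_lt] at h1
    rw [Finset.prod_eq_single_of_mem _ (Finset.mem_range.2 hdeg), if_pos h,
      if_pos (mem_monicFin.2 ⟨h, rfl⟩), add_comm]
    intro s _ hs
    rw [if_neg fun h' => hs (mem_monicFin.1 h').2.symm, one_pow]
  · rw [if_neg h, one_pow]
    exact Finset.prod_eq_one fun s _ => by
      rw [if_neg fun h' => h (mem_monicFin.1 h').1, one_pow]

/-- `prod_progProd_mul_one_add_cLim` for s = s₀ + d s₁, with the product reindexed by i = k + l - s₁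
modulo l so that i names the argument ⟨v^i x⟩. -/
lemma prod_geoProg_mul_one_add_cLim {s : ℕ} (hs : s < v.natDegree * l) :
    (∏ i ∈ Finset.range l, geoProg v l x i ((s + v.natDegree * i) % (v.natDegree * l))) *
        (1 + cLim v l s (fracKv v 0 x)) =
      algebraMap (RatFunc F) (Kv v) (deltaDigit v l xd x s) := by
  have hd : 0 < v.natDegree := hv.out.natDegree_pos
  have hs₁ : s / v.natDegree < l := Nat.div_lt_of_lt_mul hs
  have key := prod_progProd_mul_one_add_cLim hmon hl hx hxd hxs (Nat.mod_lt s hd) hs₁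
  rw [Nat.mod_add_div] at key
  unfold deltaDigit
  rw [← key]
  congr 1
  have h1 := prod_shift hs₁.le (Nat.pos_of_ne_zero hl) fun i k =>
    geoProg v l x i (s % v.natDegree + v.natDegree * k)
  refine Eq.trans (Finset.prod_congr rfl fun i _ => ?_) (h1.trans (Finset.prod_congr rfl fun k _ => ?_))
  · congr 1
    have e : s + v.natDegree * i =
        s % v.natDegree + v.natDegree * (i + s / v.natDegree) := by
      rw [mul_add, ← add_assoc, add_right_comm, Nat.mod_add_div]
    rw [Nat.mod_mul, e, Nat.add_mul_mod_self_left, Nat.mod_mod, Nat.add_mul_div_left _ _ hd,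
      Nat.div_eq_of_lt (Nat.mod_lt s hd), zero_add]
  · rw [geoProg, fracKv, fracX_mod hmon hl hx]

omit hxd hxs in
lemma geoProg_ne_zero (i s : ℕ) : geoProg v l x i s ≠ 0 :=
  progProd_ne_zero (norm_geoFactor v _) (tendsto_geoFactor_fracKv hmon hl hx i)
    (mul_ne_zero hv.out.natDegree_pos.ne' hl) s

/-- Solve the preceding identity for 1 + e_s, raise it to the power c_s and collect the factors by
i. The substitution t = s + d i modulo dl shifts the exponents cyclically by d i, as multiplication
by |v^i| shifts the digits of y. -/
lemma prod_one_add_cLim_pow (c : ℕ → ℕ) :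
    ∏ s ∈ Finset.range (v.natDegree * l), (1 + cLim v l s (fracKv v 0 x)) ^ c s =
      algebraMap (RatFunc F) (Kv v) (∏ i ∈ Finset.range l,
        delta v l xd x i ^ c (v.natDegree * i + (xd i).natDegree)) *
      ∏ i ∈ Finset.range l, (∏ t ∈ Finset.range (v.natDegree * l), geoProg v l x i t ^
        c ((t + (v.natDegree * l - v.natDegree * i)) % (v.natDegree * l)))⁻¹ := by
  have hm : v.natDegree * l ≠ 0 := mul_ne_zero hv.out.natDegree_pos.ne' hl
  have hterm : ∀ s ∈ Finset.range (v.natDegree * l), (1 + cLim v l s (fracKv v 0 x)) ^ c s =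
      algebraMap (RatFunc F) (Kv v) (deltaDigit v l xd x s ^ c s) * ∏ i ∈ Finset.range l,
        (geoProg v l x i ((s + v.natDegree * i) % (v.natDegree * l)) ^ c s)⁻¹ := by
    intro s hs
    have h1 := prod_geoProg_mul_one_add_cLim hmon hl hx hxd hxs (Finset.mem_range.1 hs)
    have h2 : ∏ i ∈ Finset.range l, geoProg v l x i ((s + v.natDegree * i) % (v.natDegree * l))
        ≠ 0 := Finset.prod_ne_zero_iff.2 fun i _ => geoProg_ne_zero hmon hl hx i _
    rw [Finset.prod_inv_distrib, Finset.prod_pow, ← div_eq_mul_inv, map_pow, ← h1, mul_pow,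
      mul_div_cancel_left₀ _ (pow_ne_zero _ h2)]
  rw [Finset.prod_congr rfl hterm, Finset.prod_mul_distrib, ← map_prod, prod_deltaDigit_pow hxd,
    Finset.prod_comm]
  congr 1
  refine Finset.prod_congr rfl fun i hi => ?_
  have hi' : v.natDegree * i ≤ v.natDegree * l :=
    Nat.mul_le_mul_left _ (Finset.mem_range.1 hi).le
  rw [← Finset.prod_inv_distrib]
  exact prod_shift hi' (Nat.pos_of_ne_zero hm) fun s t => (geoProg v l x i t ^ c s)⁻¹

omit hxd hxs in
lemma piGeo_eq_prod_geoProg (i : ℕ) : piGeo v (fracKv v i x) =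
    ∏ t ∈ Finset.range (v.natDegree * l), geoProg v l x i t :=
  infProd_eq_prod_progProd (norm_geoFactor v _) (tendsto_geoFactor_fracKv hmon hl hx i)
    (mul_ne_zero hv.out.natDegree_pos.ne' hl)

variable {p : ℕ} [Fact p.Prime] [CharP F p]

omit hxd hxs in
lemma piGeo₂_eq_prod_geoProg (i : ℕ) {w : ℤ_[p]} {c : ℕ → ℕ}
    (hw : ∀ t, padicDigit (Fintype.card F) w t = c (t % (v.natDegree * l))) :
    piGeo₂ v (fracKv v i x) w =
      ∏ t ∈ Finset.range (v.natDegree * l), geoProg v l x i t ^ c t := by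
  have hm : v.natDegree * l ≠ 0 := mul_ne_zero hv.out.natDegree_pos.ne' hl
  have h1 := infProd_pow_eq (norm_geoFactor v (fracKv v i x)) (tendsto_geoFactor_fracKv hmon hl hx i)
    hm (fun t => c (t % (v.natDegree * l))) fun s _ j => by rw [Nat.add_mul_mod_self_left]
  have h2 : piGeo₂ v (fracKv v i x) w =
      infProd fun t => geoFactor v (fracKv v i x) t ^ c (t % (v.natDegree * l)) := by
    simp only [← hw]; rfl
  rw [h2, h1]
  exact Finset.prod_congr rfl fun t ht => by rw [Nat.mod_eq_of_lt (Finset.mem_range.1 ht)]; rfl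

omit hmon hl hx hxd hxs [Fact p.Prime] [CharP F p] hv in
lemma absInf_toK_pow (hmon : v.Monic) (i : ℕ) :
    absInf (toK v ^ i) = (Fintype.card F : ℚ) ^ (v.natDegree * i) := by
  have h0 : toK v ^ i ≠ 0 := pow_ne_zero _ (toK_ne_zero hmon.ne_zero)
  rw [absInf, if_neg h0, ← toK_pow, RatFunc.intDegree_polynomial, hmon.natDegree_pow, mul_comm,
    zpow_natCast]

variable {y : ℚ} {yd : ℕ → ℕ} (hyd : ∀ s < v.natDegree * l, yd s < Fintype.card F)
  (hy : Int.fract y = ∑ s ∈ Finset.range (v.natDegree * l),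
    (yd s : ℚ) * (Fintype.card F : ℚ) ^ s / ((Fintype.card F : ℚ) ^ (v.natDegree * l) - 1))
include hyd hy

omit hx hxd hxs in
lemma fracY_eq {i : ℕ} (hi : i < l) : fracY v i y =
    ((∑ s ∈ Finset.range (v.natDegree * l),
      yd ((s + (v.natDegree * l - v.natDegree * i)) % (v.natDegree * l)) * Fintype.card F ^ s : ℕ) : ℚ)
      / ((Fintype.card F : ℚ) ^ (v.natDegree * l) - 1) := by
  rw [fracY, absInf_toK_pow hmon]
  exact fract_pow_mul Fintype.one_lt_card (mul_ne_zero hv.out.natDegree_pos.ne' hl) hyd hy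
    (Nat.mul_le_mul_left _ hi.le)

omit hxd hxs in
-- -⟨q^(di) y⟩ is -N/(q^(dl) - 1), whose q-adic digits repeat the cyclically shifted digits of y.
lemma piGeo₂_neg_fracY {i : ℕ} (hi : i < l) :
    piGeo₂ v (fracKv v i x) (ratToPadicInt p (-fracY v i y)) =
      ∏ t ∈ Finset.range (v.natDegree * l), geoProg v l x i t ^
        yd ((t + (v.natDegree * l - v.natDegree * i)) % (v.natDegree * l)) := by
  have hm : v.natDegree * l ≠ 0 := mul_ne_zero hv.out.natDegree_pos.ne' hl
  refine piGeo₂_eq_prod_geoProg hmon hl hx i (padicDigit_periodic hm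
    (c := fun t => yd ((t + (v.natDegree * l - v.natDegree * i)) % (v.natDegree * l)))
    (fun t _ => hyd _ (Nat.mod_lt _ (Nat.pos_of_ne_zero hm))) ?_)
  have h1 := card_pow_sub_one_mul_ratToPadicInt (F := F) (p := p) hm
    (-(∑ s ∈ Finset.range (v.natDegree * l),
      yd ((s + (v.natDegree * l - v.natDegree * i)) % (v.natDegree * l)) * Fintype.card F ^ s : ℕ))
  rw [fracY_eq hmon hl hyd hy hi, ← neg_div]
  rw [Int.cast_neg, Int.cast_natCast, Int.cast_neg, Int.cast_natCast] at h1
  exact h1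

omit hxd hxs in
-- The digits of the two second arguments add up to q - 1 in every place. This reflection replaces
-- -y by y - 1 on the way from Π to Γ.
lemma piGeo₂_fracY_sub_one {i : ℕ} (hi : i < l) :
    piGeo₂ v (fracKv v i x) (ratToPadicInt p (fracY v i y) - 1) *
      piGeo₂ v (fracKv v i x) (ratToPadicInt p (-fracY v i y)) =
      piGeo v (fracKv v i x) ^ (Fintype.card F - 1) := by
  have hm : v.natDegree * l ≠ 0 := mul_ne_zero hv.out.natDegree_pos.ne' hl
  have hlt : ∀ t, yd ((t + (v.natDegree * l - v.natDegree * i)) % (v.natDegree * l)) <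
    Fintype.card F := fun t => hyd _ (Nat.mod_lt _ (Nat.pos_of_ne_zero hm))
  have h1 := card_pow_sub_one_mul_ratToPadicInt (F := F) (p := p) hm
    (∑ s ∈ Finset.range (v.natDegree * l),
      yd ((s + (v.natDegree * l - v.natDegree * i)) % (v.natDegree * l)) * Fintype.card F ^ s : ℕ)
  rw [Int.cast_natCast, Int.cast_natCast, ← fracY_eq hmon hl hyd hy hi] at h1
  have h2 := padicDigit_neg_sub_one (w := -ratToPadicInt p (fracY v i y)) hm
    (c := fun t => yd ((t + (v.natDegree * l - v.natDegree * i)) % (v.natDegree * l)))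
    (fun t _ => hlt t) (by rw [mul_neg, h1])
  rw [neg_neg] at h2
  rw [piGeo₂_neg_fracY hmon hl hx hyd hy hi, piGeo_eq_prod_geoProg hmon hl hx,
    piGeo₂_eq_prod_geoProg hmon hl hx i (c := fun t => Fintype.card F - 1 -
      yd ((t + (v.natDegree * l - v.natDegree * i)) % (v.natDegree * l))) h2,
    ← Finset.prod_mul_distrib, ← Finset.prod_pow]
  refine Finset.prod_congr rfl fun t _ => ?_
  rw [← pow_add, Nat.sub_add_cancel (Nat.le_sub_one_of_lt (hlt t))]

end Formula

/-! ### The order of `v` modulo `n` -/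

section Order

variable {F : Type*} [Field F] {v n : F[X]}

lemma dvd_pow_sub_one_iff [Fintype F] (k : ℕ) : n ∣ v ^ k - 1 ↔ ordMod v n ∣ k := by
  rw [ordMod, orderOf_dvd_iff_pow_eq_one, ← map_pow, ← map_one (Ideal.Quotient.mk _),
    Ideal.Quotient.eq, Ideal.mem_span_singleton]

lemma ordMod_ne_zero [Fintype F] (hn : n.Monic) (h : IsCoprime n v) : ordMod v n ≠ 0 := by
  have : Module.Finite F (AdjoinRoot n) := (AdjoinRoot.powerBasis' hn).finite
  have hfin : Finite (AdjoinRoot n) := Module.finite_of_finite F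
  have : Finite (F[X] ⧸ Ideal.span {n}) := hfin
  obtain ⟨a, b, hab⟩ := h
  have hu : Ideal.Quotient.mk (Ideal.span {n}) v * Ideal.Quotient.mk (Ideal.span {n}) b = 1 := by
    rw [← map_mul, ← map_one (Ideal.Quotient.mk _), Ideal.Quotient.eq, Ideal.mem_span_singleton]
    exact ⟨-a, by linear_combination hab⟩
  have h1 : ordMod v n = orderOf (Units.mkOfMulEqOne _ _ hu) := by
    rw [← orderOf_units]; rfl
  rw [h1]
  exact (orderOf_pos _).ne'

end Order

/-! ### Gross–Koblitz–Thakur formulas in ℂ_v -/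

section Main

variable {F : Type*} [Field F] [Fintype F] {v : F[X]} [hv : Fact (Irreducible v)]
variable (hmon : v.Monic) {n : F[X]} (hn : n.Monic) (hcop : IsCoprime n v) {a : F[X]}
  {x : RatFunc F} (hxa : x = toK a / toK n)
include hmon hn hcop hxa

lemma isTors_ordMod : IsTors v (ordMod v n) x := by
  obtain ⟨k, hk⟩ := (dvd_pow_sub_one_iff (v := v) (n := n) _).2 dvd_rfl
  have h1 := toK_ne_zero hn.ne_zero
  refine ⟨a * k, ?_⟩
  rw [hxa, ← toK_pow, ← toK_one, ← toK_sub, hk, toK_mul, toK_mul]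
  field_simp

/-! ### The conjugates of the geometric Gauss sums -/

lemma coe_tauQ_pow_geoGauss {s : ℕ} (hs : s < dl v n) :
    (((tauQ v n (dl v n) ^ s) (geoGauss v n x) : compField v n (dl v n)) : Cv v) =
      KvToCv v (1 + cLim v (ordMod v n) s (fracKv v 0 x)) := by
  have hl := ordMod_ne_zero hn hcop
  have hdvd := (dvd_pow_sub_one_iff (v := v) (n := n) _).2 dvd_rfl
  have hm : dl v n ≠ 0 := mul_ne_zero hv.out.natDegree_pos.ne' hl
  obtain ⟨B, hB⟩ := isTors_ordMod hmon hn hcop hxa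
  have hnv : ‖toKv v n‖ = 1 := by
    rw [norm_toKv_eq_one_iff]
    intro h
    exact hv.out.not_isUnit (hcop.isUnit_of_dvd' h dvd_rfl)
  set X := algebraMap (RatFunc F) (Kv v) x with hX
  have hc : toKv v n * X = toKv v a := by
    have h1 := toK_ne_zero hn.ne_zero
    rw [hX, toKv_eq, toKv_eq, ← map_mul, hxa, mul_div_cancel₀ _ h1]
  have hX1 : ‖X‖ ≤ 1 := by
    have h2 := congrArg norm hc
    rw [norm_mul, hnv, one_mul] at h2
    rw [h2]
    exact norm_toKv_le_one v a
  have hB' : toKv v v ^ ordMod v n * X = X + toKv v B := by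
    rw [hX, toKv_eq, toKv_eq, ← map_pow, ← map_mul, ← map_add, ← hB]
    congr 1
    ring
  have h1 := coe_tauQ_pow_gaussSum hmon hl hn hdvd (fun k hk => (dvd_pow_sub_one_iff k).1 hk)
    (tauQ v n (dl v n)) (tauQ_spec hn hm) hX1 hB' hc hs
  -- x and ⟨x⟩ differ by a polynomial, on which the limits vanish.
  have h2 : cLim v (ordMod v n) s X = cLim v (ordMod v n) s (fracKv v 0 x) := by
    obtain ⟨b, hb⟩ := fracInf_add_toK (toK v ^ 0 * x)
    have h3 : X = fracKv v 0 x + toKv v b := by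
      rw [hX, toKv_eq, fracKv, fracX, ← map_add, ← hb, pow_zero, one_mul]
    rw [h3, cLim_add hmon hl s (isFrac_fracKv hmon hl ⟨B, hB⟩ 0) (IsFrac.toKv _ b),
      cLim_toKv hmon hl, add_zero]
  rw [h2] at h1
  rw [map_add, map_one, ← h1]
  unfold geoGauss gaussSum
  rw [hB, RatFunc.num_algebraMap]

lemma coe_gaussMonomial : (gaussMonomial v n x : Cv v) =
    KvToCv v (∏ s ∈ Finset.range (dl v n), (1 + cLim v (ordMod v n) s (fracKv v 0 x))) := by
  have h1 : (gaussMonomial v n x : Cv v) = ∏ s ∈ Finset.range (dl v n),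
      (((tauQ v n (dl v n) ^ s) (geoGauss v n x) : compField v n (dl v n)) : Cv v) :=
    map_prod (compField v n (dl v n)).val _ _
  rw [h1, map_prod]
  exact Finset.prod_congr rfl fun s hs =>
    coe_tauQ_pow_geoGauss hmon hn hcop hxa (Finset.mem_range.1 hs)

lemma coe_gaussMonomial₂ (y : ℚ) : (gaussMonomial₂ v n x y : Cv v) =
    KvToCv v (∏ s ∈ Finset.range (dl v n), (1 + cLim v (ordMod v n) s (fracKv v 0 x)) ^
      fracDigit (Fintype.card F) (dl v n) y s) := by
  have h1 : (gaussMonomial₂ v n x y : Cv v) = ∏ s ∈ Finset.range (dl v n),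
      (((tauQ v n (dl v n) ^ s) (geoGauss v n x) : compField v n (dl v n)) : Cv v) ^
        fracDigit (Fintype.card F) (dl v n) y s := by
    have h2 := map_prod (compField v n (dl v n)).val
      (fun s => ((tauQ v n (dl v n) ^ s) (geoGauss v n x)) ^
        fracDigit (Fintype.card F) (dl v n) y s) (Finset.range (dl v n))
    refine h2.trans (Finset.prod_congr rfl fun s _ => ?_)
    exact map_pow (compField v n (dl v n)).val _ _
  rw [h1, map_prod]
  refine Finset.prod_congr rfl fun s hs => ?_
  rw [coe_tauQ_pow_geoGauss hmon hn hcop hxa (Finset.mem_range.1 hs), map_pow]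

omit hxa in
lemma isAlgebraic_coe_compField (z : compField v n (dl v n)) :
    IsAlgebraic (RatFunc F) (z : Cv v) :=
  (isIntegral_of_mem_compField hn (mul_ne_zero hv.out.natDegree_pos.ne' (ordMod_ne_zero hn hcop))
    z.2).isAlgebraic

/-! ### The Gross–Koblitz–Thakur formulas -/

variable {xd : ℕ → F[X]} (hxd : ∀ i < ordMod v n, (xd i).degree < v.natDegree)
  (hxs : fracInf x = ∑ i ∈ Finset.range (ordMod v n),
    toK (xd i) * toK v ^ i / (toK v ^ ordMod v n - 1))
include hxd hxs

lemma gaussMonomial_eq_piGeo : (gaussMonomial v n x : Cv v) =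
    algebraMap (RatFunc F) (Cv v) (∏ i ∈ Finset.range (ordMod v n),
      delta v (ordMod v n) xd x i) *
    algebraMap (Kv v) (Cv v) (∏ i ∈ Finset.range (ordMod v n),
      (piGeo v (fracKv v i x))⁻¹) := by
  have hl := ordMod_ne_zero hn hcop
  have hx := isTors_ordMod hmon hn hcop hxa
  have h1 := prod_one_add_cLim_pow hmon hl hx hxd hxs fun _ => 1
  simp only [pow_one] at h1
  rw [coe_gaussMonomial hmon hn hcop hxa, h1, map_mul]
  simp only [piGeo_eq_prod_geoProg hmon hl hx]
  rfl

lemma gaussMonomial_eq_gammaGeo : (gaussMonomial v n x : Cv v) =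
    algebraMap (RatFunc F) (Cv v) (∏ i ∈ Finset.range (ordMod v n),
      delta v (ordMod v n) xd x i / flat ((place v).valuation (RatFunc F)) (fracX v i x)) *
    algebraMap (Kv v) (Cv v) (∏ i ∈ Finset.range (ordMod v n),
      (gammaGeo v (fracKv v i x))⁻¹) := by
  rw [gaussMonomial_eq_piGeo hmon hn hcop hxa hxd hxs]
  change KvToCv v (algebraMap (RatFunc F) (Kv v) _) * KvToCv v _ =
    KvToCv v (algebraMap (RatFunc F) (Kv v) _) * KvToCv v _
  rw [← map_mul, ← map_mul]
  congr 1
  rw [map_prod, map_prod, ← Finset.prod_mul_distrib, ← Finset.prod_mul_distrib]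
  refine Finset.prod_congr rfl fun i _ => ?_
  have h1 := flatV_ne_zero v (fracKv v i x)
  rw [map_div₀, ← flatV_algebraMap, gammaGeo, mul_inv, inv_inv]
  field_simp

variable {p : ℕ} [Fact p.Prime] [CharP F p] {y : ℚ} {yd : ℕ → ℕ}
  (hyd : ∀ s < dl v n, yd s < Fintype.card F)
  (hy : Int.fract y = ∑ s ∈ Finset.range (dl v n),
    (yd s : ℚ) * (Fintype.card F : ℚ) ^ s / ((Fintype.card F : ℚ) ^ dl v n - 1))
include hyd hy

lemma gaussMonomial₂_eq_piGeo₂ : (gaussMonomial₂ v n x y : Cv v) =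
    algebraMap (RatFunc F) (Cv v) (∏ i ∈ Finset.range (ordMod v n),
      delta v (ordMod v n) xd x i ^ yd (v.natDegree * i + (xd i).natDegree)) *
    algebraMap (Kv v) (Cv v) (∏ i ∈ Finset.range (ordMod v n),
      (piGeo₂ v (fracKv v i x) (ratToPadicInt p (-fracY v i y)))⁻¹) := by
  have hl := ordMod_ne_zero hn hcop
  have hm : dl v n ≠ 0 := mul_ne_zero hv.out.natDegree_pos.ne' hl
  have hx := isTors_ordMod hmon hn hcop hxa
  have h1 := prod_one_add_cLim_pow hmon hl hx hxd hxs yd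
  rw [coe_gaussMonomial₂ hmon hn hcop hxa, Finset.prod_congr rfl fun s hs => by
    rw [fracDigit_eq Fintype.one_lt_card hm hyd hy (Finset.mem_range.1 hs)], h1, map_mul]
  congr 1
  change KvToCv v _ = KvToCv v _
  congr 1
  refine Finset.prod_congr rfl fun i hi => ?_
  rw [piGeo₂_neg_fracY hmon hl hx hyd hy (Finset.mem_range.1 hi)]

/-- By the one-variable formula, G(x)/∏ δ is the inverse of the product of the Π(⟨v^i x⟩). Its (q -
1)-th power is what `piGeo₂_fracY_sub_one` needs to exchange the inverse of Π at -⟨|v^i| y⟩ for Π at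
⟨|v^i| y⟩ - 1. -/
lemma gaussMonomial₂_eq_gammaGeo₂ : (gaussMonomial₂ v n x y : Cv v) =
    algebraMap (RatFunc F) (Cv v) (∏ i ∈ Finset.range (ordMod v n),
      delta v (ordMod v n) xd x i ^ yd (v.natDegree * i + (xd i).natDegree) *
        flat ((place v).valuation (RatFunc F)) (fracX v i x)) *
    ((gaussMonomial v n x : Cv v) /
      algebraMap (RatFunc F) (Cv v) (∏ i ∈ Finset.range (ordMod v n),
        delta v (ordMod v n) xd x i)) ^ (Fintype.card F - 1) *
    algebraMap (Kv v) (Cv v) (∏ i ∈ Finset.range (ordMod v n),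
      gammaGeo₂ v (fracKv v i x) (ratToPadicInt p (fracY v i y))) := by
  have hl := ordMod_ne_zero hn hcop
  have hx := isTors_ordMod hmon hn hcop hxa
  have hδ : algebraMap (RatFunc F) (Cv v) (∏ i ∈ Finset.range (ordMod v n),
      delta v (ordMod v n) xd x i) ≠ 0 := by
    rw [_root_.map_ne_zero]
    exact Finset.prod_ne_zero_iff.2 fun i hi =>
      delta_ne_zero hmon hl hx hxd hxs (Finset.mem_range.1 hi)
  rw [gaussMonomial₂_eq_piGeo₂ (p := p) hmon hn hcop hxa hxd hxs hyd hy,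
    gaussMonomial_eq_piGeo hmon hn hcop hxa hxd hxs, mul_div_cancel_left₀ _ hδ]
  change KvToCv v (algebraMap (RatFunc F) (Kv v) _) * KvToCv v _ =
    KvToCv v (algebraMap (RatFunc F) (Kv v) _) * KvToCv v _ ^ _ * KvToCv v _
  rw [← map_mul, ← map_pow, ← map_mul, ← map_mul]
  congr 1
  rw [map_prod, map_prod, ← Finset.prod_pow, ← Finset.prod_mul_distrib,
    ← Finset.prod_mul_distrib, ← Finset.prod_mul_distrib]
  refine Finset.prod_congr rfl fun i hi => ?_
  have h1 := flatV_ne_zero v (fracKv v i x)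
  have h2 := piGeo₂_fracY_sub_one (p := p) hmon hl hx hyd hy (Finset.mem_range.1 hi)
  have h3 : piGeo v (fracKv v i x) ^ (Fintype.card F - 1) ≠ 0 := by
    rw [piGeo_eq_prod_geoProg hmon hl hx]
    exact pow_ne_zero _ (Finset.prod_ne_zero_iff.2 fun t _ => geoProg_ne_zero hmon hl hx i t)
  rw [map_mul, ← flatV_algebraMap, gammaGeo₂, inv_pow, ← h2]
  rw [← h2] at h3
  have h4 := left_ne_zero_of_mul h3
  have h5 := right_ne_zero_of_mul h3
  field_simp

end Main

/-! ### Algebraicity of the gamma values at a/(v - 1) -/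

section Algebraic

variable {F : Type*} [Field F] [Fintype F] {v : F[X]} [hv : Fact (Irreducible v)]

/-! ### Algebraicity of infinite products with eventually periodic exponents -/

section InfProd

variable {f : ℕ → Kv v} (hf : ∀ i, ‖f i‖ = 1) (h : Tendsto f atTop (𝓝 1))
include hf h

lemma infProd_eq_prod_mul (N : ℕ) :
    infProd f = (∏ t ∈ Finset.range N, f t) * infProd fun t => f (N + t) := by
  have h1 := tendsto_infProd (fun t => hf (N + t))
    (h.comp (tendsto_atTop_mono (fun t => Nat.le_add_left t N) tendsto_id))
  refine tendsto_nhds_unique (((tendsto_infProd hf h).comp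
    (tendsto_atTop_mono (fun t => Nat.le_add_left t N) tendsto_id)).congr fun J => ?_)
    (h1.const_mul _)
  exact Finset.prod_range_add _ _ _

variable {m : ℕ} (hm : m ≠ 0) (hfa : ∀ i, IsAlgebraic (RatFunc F) (f i))
include hm hfa

lemma isAlgebraic_progProd_of_add {s : ℕ} (k : ℕ)
    (hs : IsAlgebraic (RatFunc F) (progProd f m (s + m * k))) :
    IsAlgebraic (RatFunc F) (progProd f m s) := by
  induction k with
  | zero => exact hs
  | succ k ih =>
    refine ih ?_
    rw [progProd_eq_mul hf h hm]
    exact (hfa _).mul (by rwa [add_assoc, ← Nat.mul_succ])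

lemma isAlgebraic_progProd_add {s : ℕ} (k : ℕ) (hs : IsAlgebraic (RatFunc F) (progProd f m s)) :
    IsAlgebraic (RatFunc F) (progProd f m (s + m * k)) := by
  induction k with
  | zero => exact hs
  | succ k ih =>
    have h0 : f (s + m * k) ≠ 0 := by
      rw [← norm_ne_zero_iff, hf]; exact one_ne_zero
    have h1 : progProd f m (s + m * (k + 1)) =
        (f (s + m * k))⁻¹ * progProd f m (s + m * k) := by
      rw [progProd_eq_mul hf h hm (s + m * k), inv_mul_cancel_left₀ h0, Nat.mul_succ, add_assoc]
    rw [h1]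
    exact (hfa _).inv.mul ih

lemma isAlgebraic_infProd_pow (hp : ∀ s < m, IsAlgebraic (RatFunc F) (progProd f m s))
    {c : ℕ → ℕ} {n₀ : ℕ} (hc : ∀ t ≥ n₀, c (t + m) = c t) :
    IsAlgebraic (RatFunc F) (infProd fun t => f t ^ c t) := by
  -- Cutting at a multiple of m beyond n₀ leaves periodic exponents and keeps the residue classes
  -- modulo m.
  have hN : n₀ ≤ m * n₀ := Nat.le_mul_of_pos_left _ (Nat.pos_of_ne_zero hm)
  rw [infProd_eq_prod_mul (f := fun t => f t ^ c t) (fun t => by rw [norm_pow, hf, one_pow])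
    (tendsto_pow_one hf h c) (m * n₀)]
  refine (isAlgebraic_prod _ _ fun t _ => (hfa t).pow _).mul ?_
  have hper : ∀ s < m, ∀ j, c (m * n₀ + (s + m * j)) = c (m * n₀ + s) := by
    intro s _ j
    induction j with
    | zero => rfl
    | succ j ih =>
      refine Eq.trans ?_ ih
      have e : m * n₀ + (s + m * (j + 1)) = m * n₀ + (s + m * j) + m := by ring
      rw [e]
      exact hc _ (hN.trans (Nat.le_add_right _ _))
  rw [infProd_pow_eq (f := fun t => f (m * n₀ + t)) (fun t => hf _)
    (h.comp (tendsto_atTop_mono (fun t => Nat.le_add_left t (m * n₀)) tendsto_id)) hm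
    (fun t => c (m * n₀ + t)) hper]
  refine isAlgebraic_prod _ _ fun s hs => ?_
  have e : progProd (fun t => f (m * n₀ + t)) m s = progProd f m (s + m * n₀) := by
    refine congrArg infProd (funext fun j => congrArg f ?_)
    ring
  simp only [e]
  exact (isAlgebraic_progProd_add hf h hm hfa n₀ (hp s (Finset.mem_range.1 hs))).pow _

end InfProd

/-! ### Algebraicity of the gamma values -/

lemma isAlgebraic_flatV (x : RatFunc F) :
    IsAlgebraic (RatFunc F) (flatV v (algebraMap (RatFunc F) (Kv v) x)) := by
  rw [flatV_algebraMap]; exact isAlgebraic_algebraMap _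

lemma isAlgebraic_geoFactor (x : RatFunc F) (t : ℕ) :
    IsAlgebraic (RatFunc F) (geoFactor v (algebraMap (RatFunc F) (Kv v) x) t) := by
  rw [geoFactor_eq]
  refine isAlgebraic_prod _ _ fun a _ => ?_
  rw [div_eq_mul_inv, toKv_eq, ← map_add]
  exact (isAlgebraic_flatV _).mul (isAlgebraic_flatV _).inv

lemma geoFactor_add_toKv (X : Kv v) {b : F[X]} {t : ℕ} (hb : b.degree < t) :
    geoFactor v (X + toKv v b) t = geoFactor v X t := by
  rw [geoFactor_eq, geoFactor_eq, Finset.prod_div_distrib, Finset.prod_div_distrib]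
  congr 1
  rw [← prod_monicFin_add (fun a => flatV v (X + toKv v a)) hb]
  refine Finset.prod_congr rfl fun a _ => ?_
  have e : toKv v (a + b) = toKv v a + toKv v b := map_add (algebraMap F[X] (Kv v)) a b
  rw [e]
  congr 1
  ring

variable (hmon : v.Monic)
include hmon

/-- For n = v - 1 the order of v is 1, so `prod_geoProg_mul_one_add_cLim` contains a single partial
product. It equals δ/(1 + e_s), and 1 + e_s is a conjugate of a Gauss sum, nonzero because δ is. -/
lemma isAlgebraic_progProd_fracKv (a : F[X]) {s : ℕ} (hs : s < v.natDegree) :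
    IsAlgebraic (RatFunc F)
      (progProd (geoFactor v (fracKv v 0 (toK a / (toK v - 1)))) v.natDegree s) := by
  have hn : (v - 1).Monic := by
    have := (monic_pow_sub_one hmon one_ne_zero).1
    rwa [pow_one] at this
  have hcop : IsCoprime (v - 1) v := ⟨-1, 1, by ring⟩
  have hl : ordMod v (v - 1) = 1 := by
    rw [← Nat.dvd_one, ← dvd_pow_sub_one_iff, pow_one]
  set x := toK a / (toK v - 1) with hxdef
  have hxa : x = toK a / toK (v - 1) := by rw [hxdef, toK_sub, toK_one]
  have hx := isTors_ordMod hmon hn hcop hxa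
  rw [hl] at hx
  obtain ⟨r, hr, hr'⟩ := exists_fracX_eq hmon one_ne_zero hx 0
  rw [degree_pow_sub_one hmon one_ne_zero, mul_one] at hr
  have hxs : fracInf x = ∑ i ∈ Finset.range 1,
      toK ((fun _ => r) i) * toK v ^ i / (toK v ^ 1 - 1) := by
    rw [Finset.sum_range_one, pow_zero, mul_one]
    rw [fracX, pow_zero, one_mul, toK_sub, toK_pow, toK_one] at hr'
    exact hr'
  have hs' : s < v.natDegree * 1 := by rwa [mul_one]
  have h1 := prod_geoProg_mul_one_add_cLim hmon one_ne_zero hx (fun _ _ => hr) hxs hs'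
  have h2 := deltaDigit_ne_zero hmon one_ne_zero hx (fun _ _ => hr) hxs hs'
  have h3 : IsAlgebraic (RatFunc F) (1 + cLim v 1 s (fracKv v 0 x)) := by
    have h4 := coe_tauQ_pow_geoGauss hmon hn hcop hxa (s := s) (by rw [dl, hl]; exact hs')
    rw [hl] at h4
    have h5 := isAlgebraic_coe_compField hmon hn hcop
      ((tauQ v (v - 1) (dl v (v - 1)) ^ s) (geoGauss v (v - 1) x))
    rw [h4] at h5
    exact (isAlgebraic_algebraMap_iff (algebraMap (Kv v) (Cv v)).injective).1 h5
  rw [Finset.prod_range_one, mul_zero, add_zero, Nat.mod_eq_of_lt hs', geoProg, mul_one] at h1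
  have h6 : 1 + cLim v 1 s (fracKv v 0 x) ≠ 0 := by
    intro h
    rw [h, mul_zero] at h1
    exact h2 ((map_eq_zero _).1 h1.symm)
  rw [eq_div_of_mul_eq h6 h1, div_eq_mul_inv]
  exact (isAlgebraic_algebraMap _).mul h3.inv

lemma norm_algebraMap_div_le_one (a : F[X]) :
    ‖algebraMap (RatFunc F) (Kv v) (toK a / (toK v - 1))‖ ≤ 1 := by
  have h := norm_pow_sub_one (v := v) one_ne_zero
  rw [pow_one] at h
  rw [← toK_one, ← toK_sub, map_div₀, ← toKv_eq, ← toKv_eq, norm_div, h, div_one]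
  exact norm_toKv_le_one v a

/-- x and ⟨x⟩ differ by a polynomial b, and their factors agree in degrees above deg b. The finitely
many remaining factors are in k. -/
lemma isAlgebraic_progProd_geoFactor (a : F[X]) {s : ℕ} (hs : s < v.natDegree) :
    IsAlgebraic (RatFunc F)
      (progProd (geoFactor v (algebraMap (RatFunc F) (Kv v) (toK a / (toK v - 1))))
        v.natDegree s) := by
  have hd : v.natDegree ≠ 0 := hv.out.natDegree_pos.ne'
  have hX1 := norm_algebraMap_div_le_one hmon a
  have hfr := isAlgebraic_progProd_fracKv hmon a hs
  set x := toK a / (toK v - 1) with hx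
  obtain ⟨b, hb⟩ := fracInf_add_toK (toK v ^ 0 * x)
  have h3 : algebraMap (RatFunc F) (Kv v) x = fracKv v 0 x + toKv v b := by
    rw [toKv_eq, fracKv, fracX, ← map_add, ← hb, pow_zero, one_mul]
  have hY1 : ‖fracKv v 0 x‖ ≤ 1 := by
    rw [eq_sub_of_add_eq h3.symm]
    exact (norm_sub_le_max_norm _ _).trans (max_le hX1 (norm_toKv_le_one v b))
  refine isAlgebraic_progProd_of_add (norm_geoFactor v _) (tendsto_geoFactor v hX1) hd
    (isAlgebraic_geoFactor x) (b.natDegree + 1) ?_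
  have e : progProd (geoFactor v (algebraMap (RatFunc F) (Kv v) x)) v.natDegree
      (s + v.natDegree * (b.natDegree + 1)) =
      progProd (geoFactor v (fracKv v 0 x)) v.natDegree (s + v.natDegree * (b.natDegree + 1)) := by
    unfold progProd
    congr 1
    funext j
    rw [h3]
    refine geoFactor_add_toKv _ (degree_le_natDegree.trans_lt ?_)
    have h4 : b.natDegree + 1 ≤ v.natDegree * (b.natDegree + 1) :=
      Nat.le_mul_of_pos_left _ hv.out.natDegree_pos
    exact_mod_cast (by omega : b.natDegree <
      s + v.natDegree * (b.natDegree + 1) + v.natDegree * j)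
  rw [e]
  exact isAlgebraic_progProd_add (norm_geoFactor v _) (tendsto_geoFactor v hY1) hd
    (isAlgebraic_geoFactor _) _ hfr

lemma isAlgebraic_gammaGeo (a : F[X]) : IsAlgebraic (RatFunc F)
    (gammaGeo v (algebraMap (RatFunc F) (Kv v) (toK a / (toK v - 1)))) := by
  refine (isAlgebraic_flatV _).inv.mul ?_
  have h := isAlgebraic_infProd_pow (norm_geoFactor v _)
    (tendsto_geoFactor v (norm_algebraMap_div_le_one hmon a)) hv.out.natDegree_pos.ne'
    (isAlgebraic_geoFactor _) (fun s hs => isAlgebraic_progProd_geoFactor hmon a hs)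
    (c := fun _ => 1) (n₀ := 0) fun _ _ => rfl
  simp only [pow_one] at h
  exact h

variable {p : ℕ} [Fact p.Prime] [CharP F p]

omit hmon in
lemma padicDigit_ratToPadicInt_sub_one (F : Type*) [Field F] [Fintype F] [CharP F p] {m : ℕ}
    (hm : m ≠ 0) (r : ℤ) :
    ∃ n₀, ∀ t ≥ n₀, padicDigit (Fintype.card F)
        (ratToPadicInt p ((r : ℚ) / ((Fintype.card F : ℚ) ^ m - 1)) - 1) (t + m) =
      padicDigit (Fintype.card F)
        (ratToPadicInt p ((r : ℚ) / ((Fintype.card F : ℚ) ^ m - 1)) - 1) t := by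
  refine padicDigit_eventually_periodic (F := F) hm (r := r - ((Fintype.card F : ℤ) ^ m - 1)) ?_
  rw [mul_sub, card_pow_sub_one_mul_ratToPadicInt hm]
  push_cast
  ring

lemma isAlgebraic_gammaGeo₂ (a : F[X]) (r : ℤ) : IsAlgebraic (RatFunc F)
    (gammaGeo₂ v (algebraMap (RatFunc F) (Kv v) (toK a / (toK v - 1)))
      (ratToPadicInt p ((r : ℚ) / ((Fintype.card F : ℚ) ^ v.natDegree - 1)))) := by
  have hd : v.natDegree ≠ 0 := hv.out.natDegree_pos.ne'
  obtain ⟨n₀, hn₀⟩ := padicDigit_ratToPadicInt_sub_one (p := p) F hd r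
  exact (isAlgebraic_flatV _).inv.mul (isAlgebraic_infProd_pow (norm_geoFactor v _)
    (tendsto_geoFactor v (norm_algebraMap_div_le_one hmon a)) hd
    (isAlgebraic_geoFactor _) (fun s hs => isAlgebraic_progProd_geoFactor hmon a hs) hn₀)

lemma isAlgebraic_gammaAri (r : ℤ) : IsAlgebraic (RatFunc F)
    (gammaAri v (ratToPadicInt p ((r : ℚ) / ((Fintype.card F : ℚ) ^ v.natDegree - 1)))) := by
  have hd : v.natDegree ≠ 0 := hv.out.natDegree_pos.ne'
  obtain ⟨n₀, hn₀⟩ := padicDigit_ratToPadicInt_sub_one (p := p) F hd r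
  exact isAlgebraic_infProd_pow (norm_ariFactor v) (tendsto_ariFactor hmon) hd
    isAlgebraic_ariFactor (fun s _ => isAlgebraic_progProd_ariFactor hmon s) hn₀

end Algebraic

end GeoGauss

end

theorem mainTheorem1 {F : Type*} [Field F] [Fintype F] (p : ℕ) [Fact p.Prime] [CharP F p]
    (v : F[X]) [Fact (Irreducible v)] (hv : v.Monic) :
    (∀ n : F[X], n.Monic → IsCoprime n v →
      ∀ x : RatFunc F,
        (∃ a : F[X], x = toK a / toK n) →
      ∀ xd : ℕ → F[X],
        (∀ i < ordMod v n, (xd i).degree < v.natDegree) →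
        fracInf x = ∑ i ∈ Finset.range (ordMod v n),
          toK (xd i) * toK v ^ i /
            (toK v ^ ordMod v n - 1) →
        (∀ y : ℚ, (∃ r : ℤ, y = r / ((Fintype.card F : ℚ) ^ dl v n - 1)) →
          ∀ yd : ℕ → ℕ,
            (∀ s < dl v n, yd s < Fintype.card F) →
            Int.fract y = ∑ s ∈ Finset.range (dl v n),
              (yd s : ℚ) * (Fintype.card F : ℚ) ^ s / ((Fintype.card F : ℚ) ^ dl v n - 1) →
            (gaussMonomial₂ v n x y : Cv v) =
                algebraMap (RatFunc F) (Cv v) (∏ i ∈ Finset.range (ordMod v n),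
                  delta v (ordMod v n) xd x i ^ yd (v.natDegree * i + (xd i).natDegree)) *
                algebraMap (Kv v) (Cv v) (∏ i ∈ Finset.range (ordMod v n),
                  (piGeo₂ v
                    (algebraMap (RatFunc F) (Kv v)
                      (fracX v i x))
                    (ratToPadicInt p
                      (-fracY v i y)))⁻¹) ∧
            (gaussMonomial₂ v n x y : Cv v) =
                algebraMap (RatFunc F) (Cv v) (∏ i ∈ Finset.range (ordMod v n),
                  delta v (ordMod v n) xd x i ^ yd (v.natDegree * i + (xd i).natDegree) *
                  flat ((place v).valuation (RatFunc F))
                    (fracX v i x)) *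
                ((gaussMonomial v n x : Cv v) /
                  algebraMap (RatFunc F) (Cv v) (∏ i ∈ Finset.range (ordMod v n),
                    delta v (ordMod v n) xd x i)) ^ (Fintype.card F - 1) *
                algebraMap (Kv v) (Cv v) (∏ i ∈ Finset.range (ordMod v n),
                  gammaGeo₂ v
                    (algebraMap (RatFunc F) (Kv v)
                      (fracX v i x))
                    (ratToPadicInt p
                      (fracY v i y)))) ∧
        (gaussMonomial v n x : Cv v) =
            algebraMap (RatFunc F) (Cv v) (∏ i ∈ Finset.range (ordMod v n),
              delta v (ordMod v n) xd x i) *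
            algebraMap (Kv v) (Cv v) (∏ i ∈ Finset.range (ordMod v n),
              (piGeo v (algebraMap (RatFunc F) (Kv v)
                (fracX v i x)))⁻¹) ∧
        (gaussMonomial v n x : Cv v) =
            algebraMap (RatFunc F) (Cv v) (∏ i ∈ Finset.range (ordMod v n),
              delta v (ordMod v n) xd x i /
              flat ((place v).valuation (RatFunc F))
                (fracX v i x)) *
            algebraMap (Kv v) (Cv v) (∏ i ∈ Finset.range (ordMod v n),
              (gammaGeo v (algebraMap (RatFunc F) (Kv v)
                (fracX v i x)))⁻¹) ∧
        IsAlgebraic (RatFunc F) (gaussMonomial v n x : Cv v)) ∧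
    (∀ (a : F[X]) (r : ℤ),
      IsAlgebraic (RatFunc F)
        (gammaGeo v (algebraMap (RatFunc F) (Kv v)
          (toK a / (toK v - 1)))) ∧
      IsAlgebraic (RatFunc F)
        (gammaGeo₂ v (algebraMap (RatFunc F) (Kv v)
          (toK a / (toK v - 1)))
          (ratToPadicInt p ((r : ℚ) / ((Fintype.card F : ℚ) ^ v.natDegree - 1)))) ∧
      IsAlgebraic (RatFunc F)
        (gammaTwo v (algebraMap (RatFunc F) (Kv v)
          (toK a / (toK v - 1)))
          (ratToPadicInt p ((r : ℚ) / ((Fintype.card F : ℚ) ^ v.natDegree - 1))))) := by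
  constructor
  · intro n hn hcop x hxa xd hxd hxs
    obtain ⟨a, hxa⟩ := hxa
    refine ⟨fun y _ yd hyd hy => ⟨?_, ?_⟩, ?_, ?_, ?_⟩
    · exact gaussMonomial₂_eq_piGeo₂ hv hn hcop hxa hxd hxs hyd hy
    · exact gaussMonomial₂_eq_gammaGeo₂ hv hn hcop hxa hxd hxs hyd hy
    · exact gaussMonomial_eq_piGeo hv hn hcop hxa hxd hxs
    · exact gaussMonomial_eq_gammaGeo hv hn hcop hxa hxd hxs
    · exact isAlgebraic_coe_compField hv hn hcop _
  · intro a r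
    have h := isAlgebraic_gammaGeo₂ (p := p) hv a r
    refine ⟨isAlgebraic_gammaGeo hv a, h, ?_⟩
    rw [gammaTwo, div_eq_mul_inv]
    exact h.mul (isAlgebraic_gammaAri hv r).inv
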